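/- Let $0<q<1$, $0\le s\le 1$ and write $[x]:=(q^x-q^{-x})/(q-q^{-1})$. Let $\mathcal A(S^2_{qs})$ (the coordinate algebra of the Podleś sphere) be the complex unital $*$-algebra generated by $A=A^*$, $B$, $B^*$ with relations $$AB=q^2BA,\qquad BB^*+(A+s^2)(A-1)=0,\qquad B^*B+(q^2A+s^2)(q^2A-1)=0 ,$$ and put $x_1=(1+q^2)^{1/2}B$, $x_0=-(1+q^2)A+(1-s^2)$, $x_{-1}=-q^{-1}x_1^*$. Let $U_q(su(2))$ be the Hopf $*$-algebra generated by $K=K^*$, $K^{-1}$, $E$, $F_U=E^*$ with $KEK^{-1}=qE$, $[E,F_U]=(K^2-K^{-2})/(q-q^{-1})$, $\Delta K=K\otimes K$, $\Delta E=E\otimes K+K^{-1}\otimes E$, $\Delta F_U=F_U\otimes K+K^{-1}\otimes F_U$. It acts on $\mathcal A(S^2_{qs})$ by $h\triangleright(ab)=(h_{(1)}\triangleright a)(h_{(2)}\triangleright b)$ and $$\begin{aligned}K\triangleright A&=A,& K\triangleright B&=qB,& K\triangleright B^*&=q^{-1}B^*,\\ E\triangleright A&=-q^{-1/2}B,& E\triangleright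 B&=0,& E\triangleright B^*&=q^{1/2}\{(1+q^2)A-(1-s^2)\},\\ F_U\triangleright A&=q^{-3/2}B^*,& F_U\triangleright B&=-q^{-1/2}\{(1+q^2)A-(1-s^2)\},& F_U\triangleright B^*&=0.\end{aligned}$$ For $N\in\frac12\mathbb Z$, $N\ne 0$, let $\mathcal H_{N}$ be the Hilbert space with orthonormal basis $|l,m;N\rangle$, $l-|N|\in\mathbb N$, $l-|m|\in\mathbb N$. Then there is exactly one $*$-representation $\pi$ of $\mathcal A(S^2_{qs})$ by bounded operators on $\mathcal H:=\mathcal H_{-N}\oplus\mathcal H_N$ such that, for $N'\in\{N,-N\}$, $$\begin{aligned} x_1|l,m;N'\rangle&=B^+_{l,m}|l+1,m+1;N'\rangle+B^0_{l,m}|l,m+1;N'\rangle+B^-_{l,m}|l-1,m+1;N'\rangle,\\ x_0|l,m;N'\rangle&=A^+_{l,m}|l+1,m;N'\rangle+A^0_{l,m}|l,m;N'\rangle+A^+_{l-1,m}|l-1,m;N'\rangle,\\ -qx_{-1}|l,m;N'\rangle&=B^-_{l+1,m-1}|l+1,m-1;N'\rangle+B^0_{l,m-1}|l,m-1;N'\rangle+B^+_{l-1,m-1}|l-1,m-1;N'\rangle,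 \end{aligned}$$ (vectors with inadmissible labels are $0$), where $$\begin{aligned} A^+_{l,m}&=q^m\sqrt{[2][l-m+1][l+m+1]}\,\alpha_{N',l+1},& A^0_{l,m}&=([2l]-q^{l+m+1}[2][l-m])\,\beta_{N',l},\\ B^+_{l,m}&=q^{-l+m}\sqrt{[l+m+1][l+m+2]}\,\alpha_{N',l+1},& B^0_{l,m}&=-q^{m+2}\sqrt{[2][l-m][l+m+1]}\,\beta_{N',l},\\ B^-_{l,m}&=-q^{l+m+1}\sqrt{[l-m][l-m-1]}\,\alpha_{N',l}, \end{aligned}$$ $$\alpha_{N,l}=\frac1{[2l]}\sqrt{\frac{[2][l+N][l-N]}{[2l-1][2l+1]}}\sqrt{(q^{l+N}+q^{-(l+N)}s^2)(q^{l-N}s^2+q^{-(l-N)})}\quad(\alpha_{N,|N|}:=0),$$ $$\beta_{N,l}=\frac{([2l]-q^{l+N+1}[2][l-N])(1-s^2)+q[2][2N]s^2}{q^2[2l][2l+2]} .$$ Let $F|l,m;\pm N\rangle=|l,m;\mp N\rangle$ and $\gamma=1\oplus-1$ on $\mathcal H_{-N}\oplus\mathcal H_N$. Then: 1. $(\mathcal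 A(S^2_{qs}),\mathcal H,F,\gamma)$ is an even Fredholm module: $F=F^*$, $F^2=1$, $[F,\pi(a)]$ is compact for all $a$, $\gamma=\gamma^*$, $\gamma^2=1$, $\gamma$ commutes with $\pi(a)$ and anticommutes with $F$. It is $1$-summable: $[F,\pi(a)]$ is of trace class for all $a\in\mathcal A(S^2_{qs})$. 2. It is equivariant: $K|l,m;\pm N\rangle=q^m|l,m;\pm N\rangle$, $E|l,m;\pm N\rangle=\sqrt{[l-m][l+m+1]}\,|l,m+1;\pm N\rangle$, $F_U|l,m;\pm N\rangle=\sqrt{[l+m][l-m+1]}\,|l,m-1;\pm N\rangle$ define a $*$-representation of $U_q(su(2))$ on the dense linear span of the basis vectors; together with $\pi$ it gives a $*$-representation of the crossed product (that is, $ha=(h_{(1)}\triangleright a)h_{(2)}$); $F$ commutes with $U_q(su(2))$ and $\gamma$ with the whole crossed product. 3. The matrix $$e_s=\frac1{1+s^2}\begin{pmatrix}s^2+A&qB\\ q^{-1}B^*&1-q^2A\end{pmatrix}$$ satisfies $e_s^2=e_s$ and is invariant: $h\triangleright e_s=\sigma(h_{(1)})^t\,e_s\,\sigma(S^{-1}(h_{(2)}))^t$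 for the generators $h=K,E,F_U$ (hence for all $h$), where $\sigma(K)=\mathrm{diag}(q^{1/2},q^{-1/2})$, $\sigma(E)=\begin{pmatrix}0&1\\0&0\end{pmatrix}$, $\sigma(F_U)=\begin{pmatrix}0&0\\1&0\end{pmatrix}$. 4. The operator $F^+_{e_s}=\frac14(1-\gamma)\pi(e_s)F\pi(e_s)(1+\gamma)$ from $(1+\gamma)\pi(e_s)(\mathcal H\otimes\mathbb C^2)$ to $(1-\gamma)\pi(e_s)(\mathcal H\otimes\mathbb C^2)$ is Fredholm, and $$\mathrm{Index}(F^+_{e_s}):=\dim\ker F^+_{e_s}-\dim\mathrm{coker}\,F^+_{e_s}=2N .$$ In particular the Fredholm module is non-trivial: its index pairing $e\mapsto\mathrm{Index}(F^+_e)$ with idempotent matrices over $\mathcal A(S^2_{qs})$ is not identically zero. -/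

import Mathlib

open scoped InnerProductSpace ComplexConjugate

noncomputable section

/-! ## Even Fredholm modules, trace class operators, index pairing -/

namespace NCG

universe u v

section Fredholm

variable {H : Type u} [NormedAddCommGroup H] [InnerProductSpace ℂ H] [CompleteSpace H]

/-- A bounded operator `T` is of trace class if the trace of `|T| = (T† T)^{1/2}` is finite, computed
in Hilbert bases of `H`. -/
def IsTraceClass (T : H →L[ℂ] H) : Prop :=
  ∀ (ι : Type u) (b : HilbertBasis ι ℂ H), Summable fun i => (⟪b i, CFC.abs T (b i)⟫_ℂ).re

variable {A : Type v} [Ring A] [StarRing A] [Algebra ℂ A]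

/-- An even Fredholm module `(A, H, π, F, γ)` over the complex `*`-algebra `A`. -/
structure IsEvenFredholmModule (π : A →⋆ₐ[ℂ] (H →L[ℂ] H)) (F γ : H →L[ℂ] H) : Prop where
  F_selfAdjoint : IsSelfAdjoint F
  F_sq : F * F = 1
  compact_commutator : ∀ a, IsCompactOperator (F * π a - π a * F)
  γ_selfAdjoint : IsSelfAdjoint γ
  γ_sq : γ * γ = 1
  γ_comm : ∀ a, γ * π a = π a * γ
  γ_anticomm : γ * F = -(F * γ)

/-- `1`-summability: all the commutators `[F, π(a)]` are of trace class. -/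
def IsOneSummable (π : A →⋆ₐ[ℂ] (H →L[ℂ] H)) (F : H →L[ℂ] H) : Prop :=
  ∀ a, IsTraceClass (F * π a - π a * F)

/-- The Hilbert space `H ⊗ ℂ^k`, as the `ℓ²` sum of `k` copies of `H`. -/
abbrev Ampl (H : Type u) (k : ℕ) : Type u := PiLp 2 fun _ : Fin k => H

/-- The operator on `H ⊗ ℂ^k` given by a `k × k` matrix of operators on `H`. -/
def opMatrix {k : ℕ} (T : Matrix (Fin k) (Fin k) (H →L[ℂ] H)) : Ampl H k →L[ℂ] Ampl H k :=
  ((PiLp.continuousLinearEquiv 2 ℂ fun _ : Fin k => H).symm :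
      (Fin k → H) →L[ℂ] Ampl H k) ∘L
    (ContinuousLinearMap.pi fun i => ∑ j, T i j ∘L ContinuousLinearMap.proj j) ∘L
    ((PiLp.continuousLinearEquiv 2 ℂ fun _ : Fin k => H) : Ampl H k →L[ℂ] (Fin k → H))

/-- The operator `T ⊗ 1` on `H ⊗ ℂ^k`. -/
def amplify (k : ℕ) (T : H →L[ℂ] H) : Ampl H k →L[ℂ] Ampl H k :=
  opMatrix (Matrix.diagonal fun _ => T)

/-- The lift of the representation `π` to `Mat_k(A)`, acting on `H ⊗ ℂ^k`. -/
def liftRep (π : A →⋆ₐ[ℂ] (H →L[ℂ] H)) {k : ℕ} (e : Matrix (Fin k) (Fin k) A) :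
    Ampl H k →L[ℂ] Ampl H k :=
  opMatrix (e.map π)

/-- The space `(1 + γ) e (H ⊗ ℂ^k)`. -/
def plusSpace (π : A →⋆ₐ[ℂ] (H →L[ℂ] H)) (γ : H →L[ℂ] H) {k : ℕ}
    (e : Matrix (Fin k) (Fin k) A) : Submodule ℂ (Ampl H k) :=
  LinearMap.range (((1 + amplify k γ) * liftRep π e : Ampl H k →L[ℂ] Ampl H k) :
    Ampl H k →ₗ[ℂ] Ampl H k)

/-- The space `(1 - γ) e (H ⊗ ℂ^k)`. -/
def minusSpace (π : A →⋆ₐ[ℂ] (H →L[ℂ] H)) (γ : H →L[ℂ] H) {k : ℕ}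
    (e : Matrix (Fin k) (Fin k) A) : Submodule ℂ (Ampl H k) :=
  LinearMap.range (((1 - amplify k γ) * liftRep π e : Ampl H k →L[ℂ] Ampl H k) :
    Ampl H k →ₗ[ℂ] Ampl H k)

/-- The operator `F⁺_e = ¼ (1 - γ) π(e) F π(e) (1 + γ)` from `(1 + γ) e (H ⊗ ℂ^k)` to
`(1 - γ) e (H ⊗ ℂ^k)`. -/
def FPlus (π : A →⋆ₐ[ℂ] (H →L[ℂ] H)) (F γ : H →L[ℂ] H) {k : ℕ}
    (e : Matrix (Fin k) (Fin k) A) : plusSpace π γ e →L[ℂ] minusSpace π γ e :=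
  (((1 / 4 : ℂ) • ((1 - amplify k γ) * liftRep π e * amplify k F * liftRep π e *
      (1 + amplify k γ))) ∘L (plusSpace π γ e).subtypeL).codRestrict (minusSpace π γ e) fun v =>
    ⟨(1 / 4 : ℂ) • (amplify k F * liftRep π e * (1 + amplify k γ)) (v : Ampl H k), by
      simp [mul_assoc, smul_add, smul_sub]⟩

/-- `Index(F⁺_e) = dim ker F⁺_e - dim coker F⁺_e`, meaningful when `F⁺_e` is Fredholm. -/
def pairing (π : A →⋆ₐ[ℂ] (H →L[ℂ] H)) (F γ : H →L[ℂ] H) {k : ℕ}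
    (e : Matrix (Fin k) (Fin k) A) : ℤ :=
  (FPlus π F γ e : plusSpace π γ e →ₗ[ℂ] minusSpace π γ e).index

/-- Non-triviality: the index pairing does not vanish on all idempotent matrices over `A`. -/
def IsNontrivial (π : A →⋆ₐ[ℂ] (H →L[ℂ] H)) (F γ : H →L[ℂ] H) : Prop :=
  ∃ (k : ℕ) (e : Matrix (Fin k) (Fin k) A),
    e * e = e ∧ (FPlus π F γ e).IsFredholm ∧ pairing π F γ e ≠ 0

end Fredholm

end NCG

/-! ## The coordinate `*`-algebra of the Podleś sphere -/

namespace Podles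

open NCG

/-- The generators `A`, `B`, `B*`. -/
inductive Gen
  | A
  | B
  | Bs

/-- The involution on generators. -/
def Gen.adj : Gen → Gen
  | .A => .A
  | .B => .Bs
  | .Bs => .B

open FreeAlgebra in
/-- The defining relations (the second one is the adjoint of the first one, the other two are
self-adjoint). -/
inductive Rel (q s : ℝ) : FreeAlgebra ℂ Gen → FreeAlgebra ℂ Gen → Prop
  | AB : Rel q s (ι ℂ Gen.A * ι ℂ Gen.B) ((q : ℂ) ^ 2 • (ι ℂ Gen.B * ι ℂ Gen.A))
  | BsA : Rel q s (ι ℂ Gen.Bs * ι ℂ Gen.A) ((q : ℂ) ^ 2 • (ι ℂ Gen.A * ι ℂ Gen.Bs))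
  | BBs : Rel q s (ι ℂ Gen.B * ι ℂ Gen.Bs +
      (ι ℂ Gen.A + (s : ℂ) ^ 2 • 1) * (ι ℂ Gen.A - 1)) 0
  | BsB : Rel q s (ι ℂ Gen.Bs * ι ℂ Gen.B +
      ((q : ℂ) ^ 2 • ι ℂ Gen.A + (s : ℂ) ^ 2 • 1) * ((q : ℂ) ^ 2 • ι ℂ Gen.A - 1)) 0

/-- The algebra generated by `A`, `B`, `B*` with the above relations. -/
def Alg (q s : ℝ) : Type := RingQuot (Rel q s)

variable {q s : ℝ}

instance : Ring (Alg q s) := inferInstanceAs (Ring (RingQuot (Rel q s)))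
instance : Algebra ℂ (Alg q s) := inferInstanceAs (Algebra ℂ (RingQuot (Rel q s)))

/-- The class of a generator in the algebra. -/
def gen (q s : ℝ) (g : Gen) : Alg q s := RingQuot.mkAlgHom ℂ (Rel q s) (FreeAlgebra.ι ℂ g)

lemma gen_AB : gen q s .A * gen q s .B = (q : ℂ) ^ 2 • (gen q s .B * gen q s .A) := by
  simpa using! RingQuot.mkAlgHom_rel ℂ (Rel.AB (q := q) (s := s))

lemma gen_BsA : gen q s .Bs * gen q s .A = (q : ℂ) ^ 2 • (gen q s .A * gen q s .Bs) := by
  simpa using! RingQuot.mkAlgHom_rel ℂ (Rel.BsA (q := q) (s := s))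

lemma gen_BBs : gen q s .B * gen q s .Bs +
    (gen q s .A + (s : ℂ) ^ 2 • 1) * (gen q s .A - 1) = 0 := by
  simpa using! RingQuot.mkAlgHom_rel ℂ (Rel.BBs (q := q) (s := s))

lemma gen_BsB : gen q s .Bs * gen q s .B +
    ((q : ℂ) ^ 2 • gen q s .A + (s : ℂ) ^ 2 • 1) * ((q : ℂ) ^ 2 • gen q s .A - 1) = 0 := by
  simpa using! RingQuot.mkAlgHom_rel ℂ (Rel.BsB (q := q) (s := s))

/-- The universal property of the algebra. -/
def lift {R : Type*} [Ring R] [Algebra ℂ R] (x : Gen → R)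
    (h₁ : x .A * x .B = (q : ℂ) ^ 2 • (x .B * x .A))
    (h₂ : x .Bs * x .A = (q : ℂ) ^ 2 • (x .A * x .Bs))
    (h₃ : x .B * x .Bs + (x .A + (s : ℂ) ^ 2 • 1) * (x .A - 1) = 0)
    (h₄ : x .Bs * x .B +
      ((q : ℂ) ^ 2 • x .A + (s : ℂ) ^ 2 • 1) * ((q : ℂ) ^ 2 • x .A - 1) = 0) :
    Alg q s →ₐ[ℂ] R :=
  RingQuot.liftAlgHom ℂ ⟨FreeAlgebra.lift ℂ x, by
    intro _ _ h
    cases h <;> simpa⟩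

lemma lift_gen {R : Type*} [Ring R] [Algebra ℂ R] (x : Gen → R) (h₁ h₂ h₃ h₄) (g : Gen) :
    lift (q := q) (s := s) x h₁ h₂ h₃ h₄ (gen q s g) = x g := by
  unfold lift gen
  erw [RingQuot.liftAlgHom_mkAlgHom_apply]
  simp

lemma alg_induction {p : Alg q s → Prop} (h_scalar : ∀ z : ℂ, p (algebraMap ℂ _ z))
    (h_gen : ∀ g, p (gen q s g)) (h_mul : ∀ a b, p a → p b → p (a * b))
    (h_add : ∀ a b, p a → p b → p (a + b)) (a : Alg q s) : p a := by
  obtain ⟨x, rfl⟩ := RingQuot.mkAlgHom_surjective ℂ (Rel q s) a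
  induction x using FreeAlgebra.induction with
  | grade0 r => exact (AlgHom.commutes (RingQuot.mkAlgHom ℂ (Rel q s)) r).symm ▸ h_scalar r
  | grade1 g => exact h_gen g
  | mul x y hx hy => exact (map_mul (RingQuot.mkAlgHom ℂ (Rel q s)) x y).symm ▸ h_mul _ _ hx hy
  | add x y hx hy => exact (map_add (RingQuot.mkAlgHom ℂ (Rel q s)) x y).symm ▸ h_add _ _ hx hy

/-- The opposite algebra with conjugate scalar multiplication: antilinear antihomomorphisms to `R`
are algebra homomorphisms to `ConjOp R`. -/
def ConjOp (R : Type*) : Type _ := Rᵐᵒᵖ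

instance {R : Type*} [Ring R] : Ring (ConjOp R) := inferInstanceAs (Ring Rᵐᵒᵖ)

instance {R : Type*} [Ring R] [Algebra ℂ R] : Algebra ℂ (ConjOp R) :=
  RingHom.toAlgebra' ((algebraMap ℂ Rᵐᵒᵖ).comp (starRingEnd ℂ)) fun c x =>
    Algebra.commutes (A := Rᵐᵒᵖ) (conj c) x

namespace ConjOp

variable {R : Type*} [Ring R]

/-- The identity map from `R` to its conjugate opposite. -/
def mk (x : R) : ConjOp R := MulOpposite.op x

/-- The identity map from the conjugate opposite of `R` to `R`. -/
def out (x : ConjOp R) : R := MulOpposite.unop x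

lemma mk_mul (x y : R) : mk x * mk y = mk (y * x) := rfl
lemma mk_add (x y : R) : mk x + mk y = mk (x + y) := rfl
lemma mk_sub (x y : R) : mk x - mk y = mk (x - y) := rfl
lemma mk_one : (1 : ConjOp R) = mk 1 := rfl
lemma mk_zero : (0 : ConjOp R) = mk 0 := rfl

lemma smul_mk [Algebra ℂ R] (c : ℂ) (x : R) : c • mk x = mk (conj c • x) := by
  rw [Algebra.smul_def]
  refine Eq.trans ?_ (Algebra.smul_def (A := Rᵐᵒᵖ) (conj c) (MulOpposite.op x)).symm
  rfl

end ConjOp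

/-- The antilinear antihomomorphism with `A ↦ A`, `B ↦ B*`, `B* ↦ B`. -/
def starHom (q s : ℝ) : Alg q s →ₐ[ℂ] ConjOp (Alg q s) :=
  lift (fun g => ConjOp.mk (gen q s g.adj))
    (by simpa [Gen.adj, ConjOp.mk_mul, ConjOp.smul_mk] using congrArg ConjOp.mk gen_BsA)
    (by simpa [Gen.adj, ConjOp.mk_mul, ConjOp.smul_mk] using congrArg ConjOp.mk gen_AB)
    (by
      rw [ConjOp.mk_one, ConjOp.mk_zero]
      simp only [Gen.adj, ConjOp.mk_mul, ConjOp.smul_mk, ConjOp.mk_add, ConjOp.mk_sub]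
      refine congrArg ConjOp.mk (Eq.trans ?_ gen_BBs)
      simp [mul_add, add_mul, mul_sub, sub_mul]
      module)
    (by
      rw [ConjOp.mk_one, ConjOp.mk_zero]
      simp only [Gen.adj, ConjOp.mk_mul, ConjOp.smul_mk, ConjOp.mk_add, ConjOp.mk_sub]
      refine congrArg ConjOp.mk (Eq.trans ?_ gen_BsB)
      simp [mul_add, add_mul, mul_sub, sub_mul]
      module)

instance : Star (Alg q s) := ⟨fun a => (starHom q s a).out⟩

lemma star_gen (g : Gen) : star (gen q s g) = gen q s g.adj :=
  congrArg ConjOp.out (lift_gen (q := q) (s := s) _ _ _ _ _ g)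

lemma star_add' (a b : Alg q s) : star (a + b) = star a + star b :=
  congrArg ConjOp.out (map_add (starHom q s) a b)

lemma star_mul' (a b : Alg q s) : star (a * b) = star b * star a :=
  congrArg ConjOp.out (map_mul (starHom q s) a b)

lemma star_scalar (z : ℂ) : star (algebraMap ℂ (Alg q s) z) = algebraMap ℂ (Alg q s) (conj z) :=
  congrArg ConjOp.out ((starHom q s).commutes z)

instance : StarRing (Alg q s) where
  star_involutive a := by
    induction a using alg_induction with
    | h_scalar z => simp [star_scalar]
    | h_gen g => cases g <;> simp [star_gen, Gen.adj]
    | h_mul a b ha hb => rw [star_mul', star_mul', ha, hb]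
    | h_add a b ha hb => rw [star_add', star_add', ha, hb]
  star_mul := star_mul'
  star_add := star_add'

instance : StarModule ℂ (Alg q s) where
  star_smul c a := by
    rw [Algebra.smul_def, star_mul, star_scalar, Algebra.smul_def]
    exact (Algebra.commutes _ _).symm

/-! ## The action of `U_q(su(2))` on the coordinate algebra -/

/-- The automorphism `A ↦ A`, `B ↦ cB`, `B* ↦ c⁻¹B*`. -/
def scale (q s : ℝ) (c : ℂˣ) : Alg q s →ₐ[ℂ] Alg q s :=
  lift (fun
      | .A => gen q s .A
      | .B => (c : ℂ) • gen q s .B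
      | .Bs => (c⁻¹ : ℂˣ).val • gen q s .Bs)
    (by simp only [mul_smul_comm, smul_mul_assoc, gen_AB, smul_comm (c : ℂ)])
    (by simp only [mul_smul_comm, smul_mul_assoc, gen_BsA, smul_comm (c⁻¹ : ℂˣ).val])
    (by simpa only [mul_smul_comm, smul_mul_assoc, smul_smul, Units.mul_inv, Units.inv_mul,
          one_smul] using gen_BBs)
    (by simpa only [mul_smul_comm, smul_mul_assoc, smul_smul, Units.mul_inv, Units.inv_mul,
          one_smul] using gen_BsB)

/-- A positive real number as a unit of `ℂ`. -/
def unitOfPos (hq : 0 < q) : ℂˣ := Units.mk0 (q : ℂ) (Complex.ofReal_ne_zero.2 hq.ne')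

/-- The action of `K`. -/
def actK (s : ℝ) (hq : 0 < q) : Alg q s →ₐ[ℂ] Alg q s := scale q s (unitOfPos hq)

/-- The action of `K⁻¹`. -/
def actKinv (s : ℝ) (hq : 0 < q) : Alg q s →ₐ[ℂ] Alg q s := scale q s (unitOfPos hq)⁻¹

/-- The values of `E` on the generators. -/
def valE (q s : ℝ) : Gen → Alg q s
  | .A => -((√q : ℂ)⁻¹ • gen q s .B)
  | .B => 0
  | .Bs => (√q : ℂ) • ((1 + (q : ℂ) ^ 2) • gen q s .A - (1 - (s : ℂ) ^ 2) • 1)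

/-- The values of `F` on the generators. -/
def valF (q s : ℝ) : Gen → Alg q s
  | .A => ((√q : ℂ)⁻¹ ^ 3) • gen q s .Bs
  | .B => -((√q : ℂ)⁻¹ • ((1 + (q : ℂ) ^ 2) • gen q s .A - (1 - (s : ℂ) ^ 2) • 1))
  | .Bs => 0

/-- The matrix `(K⁻¹ ▷ g, X ▷ g; 0, K ▷ g)` attached to a generator `g`, for given values
of `X ▷ g`. -/
def twistMat (s : ℝ) (hq : 0 < q) (x : Gen → Alg q s) (g : Gen) :
    Matrix (Fin 2) (Fin 2) (Alg q s) :=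
  !![actKinv s hq (gen q s g), x g; 0, actK s hq (gen q s g)]

lemma actK_gen (hq : 0 < q) (g : Gen) : actK s hq (gen q s g) =
    (match g with
      | .A => gen q s .A
      | .B => (q : ℂ) • gen q s .B
      | .Bs => (q : ℂ)⁻¹ • gen q s .Bs) := by
  unfold actK scale
  rw [lift_gen]
  cases g <;> simp [unitOfPos]

lemma actKinv_gen (hq : 0 < q) (g : Gen) : actKinv s hq (gen q s g) =
    (match g with
      | .A => gen q s .A
      | .B => (q : ℂ)⁻¹ • gen q s .B
      | .Bs => (q : ℂ) • gen q s .Bs) := by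
  unfold actKinv scale
  rw [lift_gen]
  cases g <;> simp [unitOfPos]

lemma gen_BBs' : gen q s .B * gen q s .Bs = -(gen q s .A * gen q s .A) +
    (1 - (s : ℂ) ^ 2) • gen q s .A + (s : ℂ) ^ 2 • 1 := by
  have h := gen_BBs (q := q) (s := s)
  rw [← sub_eq_zero, ← h]
  simp only [add_mul, mul_sub, smul_mul_assoc, one_mul, mul_one]
  module

lemma gen_BsB' : gen q s .Bs * gen q s .B = -((q : ℂ) ^ 4 • (gen q s .A * gen q s .A)) +
    ((1 - (s : ℂ) ^ 2) * (q : ℂ) ^ 2) • gen q s .A + (s : ℂ) ^ 2 • 1 := by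
  have h := gen_BsB (q := q) (s := s)
  rw [← sub_eq_zero, ← h]
  simp only [add_mul, mul_sub, smul_mul_assoc, mul_smul_comm, one_mul, mul_one]
  module

section

set_option linter.unusedSimpArgs false
set_option linter.unreachableTactic false
set_option linter.unnecessarySeqFocus false
set_option linter.unusedTactic false

lemma twistE_rel₁ (hq : 0 < q) : twistMat s hq (valE q s) .A * twistMat s hq (valE q s) .B =
    (q : ℂ) ^ 2 • (twistMat s hq (valE q s) .B * twistMat s hq (valE q s) .A) := by
  have hq' : (q : ℂ) ≠ 0 := Complex.ofReal_ne_zero.2 hq.ne'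
  have hr : (√q : ℂ) ≠ 0 := Complex.ofReal_ne_zero.2 (Real.sqrt_pos.2 hq).ne'
  have hr2 : (√q : ℂ) ^ 2 = q := by exact_mod_cast Real.sq_sqrt hq.le
  generalize hu : (q : ℂ) = u at *
  generalize hw : (√q : ℂ) = w at *
  generalize hv : (s : ℂ) = v at *
  subst hr2
  ext i j
  fin_cases i <;> fin_cases j <;>
    simp [twistMat, valE, actK_gen, actKinv_gen, Matrix.mul_apply,
      gen_AB, gen_BsA, gen_BsB', gen_BBs', mul_add, add_mul, mul_sub, sub_mul, hu, hw, hv] <;>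
    match_scalars <;> field_simp <;> ring

lemma twistE_rel₂ (hq : 0 < q) : twistMat s hq (valE q s) .Bs * twistMat s hq (valE q s) .A =
    (q : ℂ) ^ 2 • (twistMat s hq (valE q s) .A * twistMat s hq (valE q s) .Bs) := by
  have hq' : (q : ℂ) ≠ 0 := Complex.ofReal_ne_zero.2 hq.ne'
  have hr : (√q : ℂ) ≠ 0 := Complex.ofReal_ne_zero.2 (Real.sqrt_pos.2 hq).ne'
  have hr2 : (√q : ℂ) ^ 2 = q := by exact_mod_cast Real.sq_sqrt hq.le
  generalize hu : (q : ℂ) = u at *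
  generalize hw : (√q : ℂ) = w at *
  generalize hv : (s : ℂ) = v at *
  subst hr2
  ext i j
  fin_cases i <;> fin_cases j <;>
    simp [twistMat, valE, actK_gen, actKinv_gen, Matrix.mul_apply,
      gen_AB, gen_BsA, gen_BsB', gen_BBs', mul_add, add_mul, mul_sub, sub_mul, hu, hw, hv] <;>
    match_scalars <;> field_simp <;> ring

lemma twistE_rel₃ (hq : 0 < q) : twistMat s hq (valE q s) .B * twistMat s hq (valE q s) .Bs +
    (twistMat s hq (valE q s) .A + (s : ℂ) ^ 2 • 1) * (twistMat s hq (valE q s) .A - 1) = 0 := by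
  have hq' : (q : ℂ) ≠ 0 := Complex.ofReal_ne_zero.2 hq.ne'
  have hr : (√q : ℂ) ≠ 0 := Complex.ofReal_ne_zero.2 (Real.sqrt_pos.2 hq).ne'
  have hr2 : (√q : ℂ) ^ 2 = q := by exact_mod_cast Real.sq_sqrt hq.le
  generalize hu : (q : ℂ) = u at *
  generalize hw : (√q : ℂ) = w at *
  generalize hv : (s : ℂ) = v at *
  subst hr2
  ext i j
  fin_cases i <;> fin_cases j <;>
    simp [twistMat, valE, actK_gen, actKinv_gen, Matrix.mul_apply,
      gen_AB, gen_BsA, gen_BsB', gen_BBs', mul_add, add_mul, mul_sub, sub_mul, hu, hw, hv] <;>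
    match_scalars <;> field_simp <;> ring

lemma twistE_rel₄ (hq : 0 < q) : twistMat s hq (valE q s) .Bs * twistMat s hq (valE q s) .B +
    ((q : ℂ) ^ 2 • twistMat s hq (valE q s) .A + (s : ℂ) ^ 2 • 1) *
      ((q : ℂ) ^ 2 • twistMat s hq (valE q s) .A - 1) = 0 := by
  have hq' : (q : ℂ) ≠ 0 := Complex.ofReal_ne_zero.2 hq.ne'
  have hr : (√q : ℂ) ≠ 0 := Complex.ofReal_ne_zero.2 (Real.sqrt_pos.2 hq).ne'
  have hr2 : (√q : ℂ) ^ 2 = q := by exact_mod_cast Real.sq_sqrt hq.le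
  generalize hu : (q : ℂ) = u at *
  generalize hw : (√q : ℂ) = w at *
  generalize hv : (s : ℂ) = v at *
  subst hr2
  ext i j
  fin_cases i <;> fin_cases j <;>
    simp [twistMat, valE, actK_gen, actKinv_gen, Matrix.mul_apply,
      gen_AB, gen_BsA, gen_BsB', gen_BBs', mul_add, add_mul, mul_sub, sub_mul, hu, hw, hv] <;>
    match_scalars <;> field_simp <;> ring

lemma twistF_rel₁ (hq : 0 < q) : twistMat s hq (valF q s) .A * twistMat s hq (valF q s) .B =
    (q : ℂ) ^ 2 • (twistMat s hq (valF q s) .B * twistMat s hq (valF q s) .A) := by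
  have hq' : (q : ℂ) ≠ 0 := Complex.ofReal_ne_zero.2 hq.ne'
  have hr : (√q : ℂ) ≠ 0 := Complex.ofReal_ne_zero.2 (Real.sqrt_pos.2 hq).ne'
  have hr2 : (√q : ℂ) ^ 2 = q := by exact_mod_cast Real.sq_sqrt hq.le
  generalize hu : (q : ℂ) = u at *
  generalize hw : (√q : ℂ) = w at *
  generalize hv : (s : ℂ) = v at *
  subst hr2
  ext i j
  fin_cases i <;> fin_cases j <;>
    simp [twistMat, valF, actK_gen, actKinv_gen, Matrix.mul_apply,
      gen_AB, gen_BsA, gen_BsB', gen_BBs', mul_add, add_mul, mul_sub, sub_mul, hu, hw, hv] <;>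
    match_scalars <;> field_simp <;> ring

lemma twistF_rel₂ (hq : 0 < q) : twistMat s hq (valF q s) .Bs * twistMat s hq (valF q s) .A =
    (q : ℂ) ^ 2 • (twistMat s hq (valF q s) .A * twistMat s hq (valF q s) .Bs) := by
  have hq' : (q : ℂ) ≠ 0 := Complex.ofReal_ne_zero.2 hq.ne'
  have hr : (√q : ℂ) ≠ 0 := Complex.ofReal_ne_zero.2 (Real.sqrt_pos.2 hq).ne'
  have hr2 : (√q : ℂ) ^ 2 = q := by exact_mod_cast Real.sq_sqrt hq.le
  generalize hu : (q : ℂ) = u at *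
  generalize hw : (√q : ℂ) = w at *
  generalize hv : (s : ℂ) = v at *
  subst hr2
  ext i j
  fin_cases i <;> fin_cases j <;>
    simp [twistMat, valF, actK_gen, actKinv_gen, Matrix.mul_apply,
      gen_AB, gen_BsA, gen_BsB', gen_BBs', mul_add, add_mul, mul_sub, sub_mul, hu, hw, hv] <;>
    match_scalars <;> field_simp <;> ring

lemma twistF_rel₃ (hq : 0 < q) : twistMat s hq (valF q s) .B * twistMat s hq (valF q s) .Bs +
    (twistMat s hq (valF q s) .A + (s : ℂ) ^ 2 • 1) * (twistMat s hq (valF q s) .A - 1) = 0 := by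
  have hq' : (q : ℂ) ≠ 0 := Complex.ofReal_ne_zero.2 hq.ne'
  have hr : (√q : ℂ) ≠ 0 := Complex.ofReal_ne_zero.2 (Real.sqrt_pos.2 hq).ne'
  have hr2 : (√q : ℂ) ^ 2 = q := by exact_mod_cast Real.sq_sqrt hq.le
  generalize hu : (q : ℂ) = u at *
  generalize hw : (√q : ℂ) = w at *
  generalize hv : (s : ℂ) = v at *
  subst hr2
  ext i j
  fin_cases i <;> fin_cases j <;>
    simp [twistMat, valF, actK_gen, actKinv_gen, Matrix.mul_apply,
      gen_AB, gen_BsA, gen_BsB', gen_BBs', mul_add, add_mul, mul_sub, sub_mul, hu, hw, hv] <;>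
    match_scalars <;> field_simp <;> ring

lemma twistF_rel₄ (hq : 0 < q) : twistMat s hq (valF q s) .Bs * twistMat s hq (valF q s) .B +
    ((q : ℂ) ^ 2 • twistMat s hq (valF q s) .A + (s : ℂ) ^ 2 • 1) *
      ((q : ℂ) ^ 2 • twistMat s hq (valF q s) .A - 1) = 0 := by
  have hq' : (q : ℂ) ≠ 0 := Complex.ofReal_ne_zero.2 hq.ne'
  have hr : (√q : ℂ) ≠ 0 := Complex.ofReal_ne_zero.2 (Real.sqrt_pos.2 hq).ne'
  have hr2 : (√q : ℂ) ^ 2 = q := by exact_mod_cast Real.sq_sqrt hq.le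
  generalize hu : (q : ℂ) = u at *
  generalize hw : (√q : ℂ) = w at *
  generalize hv : (s : ℂ) = v at *
  subst hr2
  ext i j
  fin_cases i <;> fin_cases j <;>
    simp [twistMat, valF, actK_gen, actKinv_gen, Matrix.mul_apply,
      gen_AB, gen_BsA, gen_BsB', gen_BBs', mul_add, add_mul, mul_sub, sub_mul, hu, hw, hv] <;>
    match_scalars <;> field_simp <;> ring

end

/-- The algebra morphism `a ↦ (K⁻¹ ▷ a, E ▷ a; 0, K ▷ a)`. -/
def twistE (s : ℝ) (hq : 0 < q) : Alg q s →ₐ[ℂ] Matrix (Fin 2) (Fin 2) (Alg q s) :=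
  lift (twistMat s hq (valE q s)) (twistE_rel₁ hq) (twistE_rel₂ hq) (twistE_rel₃ hq)
    (twistE_rel₄ hq)

/-- The algebra morphism `a ↦ (K⁻¹ ▷ a, F ▷ a; 0, K ▷ a)`. -/
def twistF (s : ℝ) (hq : 0 < q) : Alg q s →ₐ[ℂ] Matrix (Fin 2) (Fin 2) (Alg q s) :=
  lift (twistMat s hq (valF q s)) (twistF_rel₁ hq) (twistF_rel₂ hq) (twistF_rel₃ hq)
    (twistF_rel₄ hq)

/-- The action of `E`: the linear map with the prescribed values on generators and with
`E ▷ (ab) = (E ▷ a)(K ▷ b) + (K⁻¹ ▷ a)(E ▷ b)`. -/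
def actE (s : ℝ) (hq : 0 < q) : Alg q s →ₗ[ℂ] Alg q s :=
  Matrix.entryLinearMap ℂ (Alg q s) 0 1 ∘ₗ (twistE s hq).toLinearMap

/-- The action of `F`: the linear map with the prescribed values on generators and with
`F ▷ (ab) = (F ▷ a)(K ▷ b) + (K⁻¹ ▷ a)(F ▷ b)`. -/
def actF (s : ℝ) (hq : 0 < q) : Alg q s →ₗ[ℂ] Alg q s :=
  Matrix.entryLinearMap ℂ (Alg q s) 0 1 ∘ₗ (twistF s hq).toLinearMap

lemma actE_gen (hq : 0 < q) (g : Gen) : actE s hq (gen q s g) = valE q s g := by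
  simp [actE, twistE, lift_gen, twistMat]

lemma actF_gen (hq : 0 < q) (g : Gen) : actF s hq (gen q s g) = valF q s g := by
  simp [actF, twistF, lift_gen, twistMat]

lemma twist_diag (hq : 0 < q) (x : Gen → Alg q s) (h₁ h₂ h₃ h₄) (a : Alg q s) :
    lift (twistMat s hq x) h₁ h₂ h₃ h₄ a 0 0 = actKinv s hq a ∧
    lift (twistMat s hq x) h₁ h₂ h₃ h₄ a 1 0 = 0 ∧
    lift (twistMat s hq x) h₁ h₂ h₃ h₄ a 1 1 = actK s hq a := by
  induction a using alg_induction with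
  | h_scalar z => simp [AlgHom.commutes, Matrix.algebraMap_matrix_apply]
  | h_gen g => simp [lift_gen, twistMat]
  | h_mul a b ha hb =>
    obtain ⟨a1, a2, a3⟩ := ha
    obtain ⟨b1, b2, b3⟩ := hb
    simp [Matrix.mul_apply, a1, a2, a3, b1, b2, b3]
  | h_add a b ha hb =>
    obtain ⟨a1, a2, a3⟩ := ha
    obtain ⟨b1, b2, b3⟩ := hb
    simp [a1, a2, a3, b1, b2, b3]

lemma actE_mul (hq : 0 < q) (a b : Alg q s) :
    actE s hq (a * b) = actE s hq a * actK s hq b + actKinv s hq a * actE s hq b := by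
  obtain ⟨a1, -, -⟩ := twist_diag hq _ (twistE_rel₁ hq) (twistE_rel₂ hq) (twistE_rel₃ hq)
    (twistE_rel₄ hq) a
  obtain ⟨-, -, b3⟩ := twist_diag hq _ (twistE_rel₁ hq) (twistE_rel₂ hq) (twistE_rel₃ hq)
    (twistE_rel₄ hq) b
  rw [← a1, ← b3]
  simp [actE, twistE, Matrix.mul_apply, add_comm]

lemma actF_mul (hq : 0 < q) (a b : Alg q s) :
    actF s hq (a * b) = actF s hq a * actK s hq b + actKinv s hq a * actF s hq b := by
  obtain ⟨a1, -, -⟩ := twist_diag hq _ (twistF_rel₁ hq) (twistF_rel₂ hq) (twistF_rel₃ hq)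
    (twistF_rel₄ hq) a
  obtain ⟨-, -, b3⟩ := twist_diag hq _ (twistF_rel₁ hq) (twistF_rel₂ hq) (twistF_rel₃ hq)
    (twistF_rel₄ hq) b
  rw [← a1, ← b3]
  simp [actF, twistF, Matrix.mul_apply, add_comm]

/-! ## The invariant idempotent -/

/-- The idempotent `e_s`. -/
def idem (q s : ℝ) : Matrix (Fin 2) (Fin 2) (Alg q s) :=
  (1 + (s : ℂ) ^ 2)⁻¹ •
    !![(s : ℂ) ^ 2 • 1 + gen q s .A, (q : ℂ) • gen q s .B;
       (q : ℂ)⁻¹ • gen q s .Bs, 1 - (q : ℂ) ^ 2 • gen q s .A]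

/-- The matrix `σ(K)` of the spin `1/2` representation `σ` of `U_q(su(2))`. -/
def σK (q : ℝ) : Matrix (Fin 2) (Fin 2) ℂ := !![(√q : ℂ), 0; 0, (√q : ℂ)⁻¹]
/-- The matrix `σ(K⁻¹)`. -/
def σKinv (q : ℝ) : Matrix (Fin 2) (Fin 2) ℂ := !![(√q : ℂ)⁻¹, 0; 0, (√q : ℂ)]
/-- The matrix `σ(E)`. -/
def σE : Matrix (Fin 2) (Fin 2) ℂ := !![0, 1; 0, 0]
/-- The matrix `σ(F)`. -/
def σF : Matrix (Fin 2) (Fin 2) ℂ := !![0, 0; 1, 0]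

/-- The transpose of a complex matrix, with entries seen in the algebra. -/
def scalarT (q s : ℝ) (M : Matrix (Fin 2) (Fin 2) ℂ) : Matrix (Fin 2) (Fin 2) (Alg q s) :=
  M.transpose.map (algebraMap ℂ (Alg q s))

/-- Invariance `h ▷ e = σ(h₍₁₎)ᵗ e σ(S⁻¹(h₍₂₎))ᵗ` for `h` running over the generators `K`, `E`, `F`
of `U_q(su(2))`. Here `ΔK = K ⊗ K`, `ΔX = X ⊗ K + K⁻¹ ⊗ X` for `X = E, F`, and `S⁻¹(K) = K⁻¹`,
`S⁻¹(E) = -q⁻¹E`, `S⁻¹(F) = -qF`. -/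
structure IsInvariant (hq : 0 < q) (e : Matrix (Fin 2) (Fin 2) (Alg q s)) : Prop where
  K : e.map (actK s hq) = scalarT q s (σK q) * e * scalarT q s (σKinv q)
  E : e.map (actE s hq) = scalarT q s σE * e * scalarT q s (σKinv q) +
    scalarT q s (σKinv q) * e * scalarT q s (-(q : ℂ)⁻¹ • σE)
  F : e.map (actF s hq) = scalarT q s σF * e * scalarT q s (σKinv q) +
    scalarT q s (σKinv q) * e * scalarT q s (-(q : ℂ) • σF)

/-! ## The Hilbert space, the grading and the operator `F`

Half-integers are represented by their doubles: `n = 2N`, `L = 2l`, `M = 2m`. -/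

/-- Labels `(2l, 2m)` of the basis vectors `|l,m;N⟩` of `H_N`, `n = 2N`:
`l - |N|` and `l - |m|` are natural numbers. -/
abbrev Idx (n : ℤ) : Type :=
  {p : ℤ × ℤ // (∃ k : ℕ, p.1 - |n| = 2 * k) ∧ (∃ k : ℕ, p.1 - |p.2| = 2 * k)}

/-- The Hilbert space `H_{-N} ⊕ H_N`, `n = 2N`, with orthonormal basis `|l,m;±N⟩`: the label
`(ε, (2l, 2m))` stands for `|l,m;εN⟩`. -/
abbrev Hilb (n : ℤ) : Type := lp (fun _ : ℤˣ × Idx n => ℂ) 2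

open Classical in
/-- The basis vector `|l,m;εN⟩` for `L = 2l`, `M = 2m`, `n = 2N`; it is `0` if `(l, m)` is not
an admissible label. -/
def ket (n : ℤ) (ε : ℤˣ) (L M : ℤ) : Hilb n :=
  if h : (∃ k : ℕ, L - |n| = 2 * k) ∧ (∃ k : ℕ, L - |M| = 2 * k) then
    lp.single 2 (ε, ⟨(L, M), h⟩) 1
  else 0

section Signed

variable {ι : Type*}

lemma memℓp_signed (σ : Equiv.Perm ι) (c : ι → ℤˣ) (f : lp (fun _ : ι => ℂ) 2) :
    Memℓp (fun i => ((c i : ℤ) : ℂ) * f (σ i)) 2 := by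
  have hf := (memℓp_gen_iff (p := 2) (by norm_num)).1 (lp.memℓp f)
  refine (memℓp_gen_iff (p := 2) (by norm_num)).2 ?_
  have h : ∀ i, ‖((c i : ℤ) : ℂ) * f (σ i)‖ = ‖f (σ i)‖ := fun i => by
    rcases Int.units_eq_one_or (c i) with h | h <;> simp [h]
  simpa only [h, Function.comp_def] using (σ.summable_iff).2 hf

/-- The unitary operator `f ↦ (i ↦ c i * f (σ i))` on `ℓ²(ι)`, for a permutation `σ` and signs
`c`. -/
def signedPerm (σ : Equiv.Perm ι) (c : ι → ℤˣ) :
    lp (fun _ : ι => ℂ) 2 →L[ℂ] lp (fun _ : ι => ℂ) 2 :=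
  LinearMap.mkContinuous
    { toFun := fun f => ⟨fun i => ((c i : ℤ) : ℂ) * f (σ i), memℓp_signed σ c f⟩
      map_add' := fun f g => by
        ext i
        exact mul_add _ _ _
      map_smul' := fun z f => by
        ext i
        simp [mul_left_comm] } 1 fun f => by
    have h : ∀ i, ‖((c i : ℤ) : ℂ) * f (σ i)‖ = ‖f (σ i)‖ := fun i => by
      rcases Int.units_eq_one_or (c i) with h | h <;> simp [h]
    rw [one_mul]
    refine le_of_eq ?_
    rw [lp.norm_eq_tsum_rpow (by norm_num), lp.norm_eq_tsum_rpow (by norm_num)]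
    simp only [LinearMap.coe_mk, AddHom.coe_mk, h]
    rw [σ.tsum_eq fun i => ‖f i‖ ^ (2 : ENNReal).toReal]

end Signed

/-- The operator `F|l,m;±N⟩ = |l,m;∓N⟩`. -/
def flip (n : ℤ) : Hilb n →L[ℂ] Hilb n :=
  signedPerm ((Equiv.neg ℤˣ).prodCongr (Equiv.refl (Idx n))) fun _ => 1

/-- The grading `γ = 1 ⊕ -1` of `H_{-N} ⊕ H_N`. -/
def grading (n : ℤ) : Hilb n →L[ℂ] Hilb n :=
  signedPerm (Equiv.refl _) fun i => -i.1

lemma flip_ket (n : ℤ) (ε : ℤˣ) (L M : ℤ) : flip n (ket n ε L M) = ket n (-ε) L M := by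
  classical
  unfold ket
  split_ifs with h
  · ext ⟨δ, i⟩
    simp only [flip, signedPerm, LinearMap.mkContinuous_apply, LinearMap.coe_mk, AddHom.coe_mk,
      lp.coeFn_single, Pi.single_apply, Equiv.prodCongr_apply, Prod.map, Equiv.neg_apply,
      Equiv.refl_apply]
    have : (-δ, i) = (ε, ⟨(L, M), h⟩) ↔ (δ, i) = (-ε, (⟨(L, M), h⟩ : Idx n)) := by
      rw [Prod.mk.injEq, Prod.mk.injEq, neg_eq_iff_eq_neg]
    simp [this]
  · simp

lemma grading_ket (n : ℤ) (ε : ℤˣ) (L M : ℤ) :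
    grading n (ket n ε L M) = (-((ε : ℤ) : ℂ)) • ket n ε L M := by
  classical
  unfold ket
  split_ifs with h
  · ext ⟨δ, i⟩
    rw [lp.coeFn_smul, Pi.smul_apply]
    simp only [grading, signedPerm, LinearMap.mkContinuous_apply, LinearMap.coe_mk, AddHom.coe_mk,
      lp.coeFn_single, Pi.single_apply, Equiv.refl_apply]
    split_ifs with h'
    · simp [(Prod.mk.injEq _ _ _ _).mp h' |>.1]
    · simp
  · simp

/-! ## The representation of the coordinate algebra -/

/-- The `q`-number `[x]`. -/
def br (q x : ℝ) : ℝ := (q ^ x - q ^ (-x)) / (q - q⁻¹)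

/-- The coefficient `α_{N,l}(s)`. -/
def α (q s N l : ℝ) : ℝ :=
  1 / br q (2 * l) * √(br q 2 * br q (l + N) * br q (l - N) / (br q (2 * l - 1) * br q (2 * l + 1))) *
    √((q ^ (l + N) + q ^ (-(l + N)) * s ^ 2) * (q ^ (l - N) * s ^ 2 + q ^ (-(l - N))))

/-- The coefficient `β_{N,l}(s)`. -/
def β (q s N l : ℝ) : ℝ :=
  ((br q (2 * l) - q ^ (l + N + 1) * br q 2 * br q (l - N)) * (1 - s ^ 2) +
      q * br q 2 * br q (2 * N) * s ^ 2) /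
    (q ^ 2 * br q (2 * l) * br q (2 * l + 2))

/-- The coefficient `A⁺_{l,m}`. -/
def Aplus (q s N l m : ℝ) : ℝ :=
  q ^ m * √(br q 2 * br q (l - m + 1) * br q (l + m + 1)) * α q s N (l + 1)

/-- The coefficient `A⁰_{l,m}`. -/
def Azero (q s N l m : ℝ) : ℝ :=
  (br q (2 * l) - q ^ (l + m + 1) * br q 2 * br q (l - m)) * β q s N l

/-- The coefficient `B⁺_{l,m}`. -/
def Bplus (q s N l m : ℝ) : ℝ :=
  q ^ (-l + m) * √(br q (l + m + 1) * br q (l + m + 2)) * α q s N (l + 1)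

/-- The coefficient `B⁰_{l,m}`. -/
def Bzero (q s N l m : ℝ) : ℝ :=
  -(q ^ (m + 2) * √(br q 2 * br q (l - m) * br q (l + m + 1)) * β q s N l)

/-- The coefficient `B⁻_{l,m}`. -/
def Bminus (q s N l m : ℝ) : ℝ :=
  -(q ^ (l + m + 1) * √(br q (l - m) * br q (l - m - 1)) * α q s N l)

/-- The element `x₁ = (1 + q²)^{1/2} B`. -/
def x₁ (q s : ℝ) : Alg q s := (√(1 + q ^ 2) : ℂ) • gen q s .B

/-- The element `x₀ = -(1 + q²) A + (1 - s²)`. -/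
def x₀ (q s : ℝ) : Alg q s :=
  -((1 + (q : ℂ) ^ 2) • gen q s .A) + (1 - (s : ℂ) ^ 2) • 1

/-- The element `x₋₁ = -q⁻¹ x₁*`. -/
def xm₁ (q s : ℝ) : Alg q s := -((q : ℂ)⁻¹ • star (x₁ q s))

/-- The half-integer `εN` for `n = 2N`. -/
def spin (n : ℤ) (ε : ℤˣ) : ℝ := ((ε : ℤ) : ℝ) * n / 2

/-- The formulas that describe the direct sum of the representations on `H_{-N}` and `H_N` on basis
vectors, with `L = 2l`, `M = 2m`, `n = 2N`. -/
structure IsPodlesRep (n : ℤ) (π : Alg q s →⋆ₐ[ℂ] (Hilb n →L[ℂ] Hilb n)) : Prop where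
  x₁_ket : ∀ (ε : ℤˣ) (p : Idx n) (L M : ℤ) (l m : ℝ), p.1 = (L, M) → l = L / 2 → m = M / 2 →
    π (x₁ q s) (ket n ε L M) =
      (Bplus q s (spin n ε) l m : ℂ) • ket n ε (L + 2) (M + 2) +
      (Bzero q s (spin n ε) l m : ℂ) • ket n ε L (M + 2) +
      (Bminus q s (spin n ε) l m : ℂ) • ket n ε (L - 2) (M + 2)
  x₀_ket : ∀ (ε : ℤˣ) (p : Idx n) (L M : ℤ) (l m : ℝ), p.1 = (L, M) → l = L / 2 → m = M / 2 →
    π (x₀ q s) (ket n ε L M) =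
      (Aplus q s (spin n ε) l m : ℂ) • ket n ε (L + 2) M +
      (Azero q s (spin n ε) l m : ℂ) • ket n ε L M +
      (Aplus q s (spin n ε) (l - 1) m : ℂ) • ket n ε (L - 2) M
  xm₁_ket : ∀ (ε : ℤˣ) (p : Idx n) (L M : ℤ) (l m : ℝ), p.1 = (L, M) → l = L / 2 → m = M / 2 →
    π (-((q : ℂ) • xm₁ q s)) (ket n ε L M) =
      (Bminus q s (spin n ε) (l + 1) (m - 1) : ℂ) • ket n ε (L + 2) (M - 2) +
      (Bzero q s (spin n ε) l (m - 1) : ℂ) • ket n ε L (M - 2) +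
      (Bplus q s (spin n ε) (l - 1) (m - 1) : ℂ) • ket n ε (L - 2) (M - 2)

/-! ## Equivariance -/

/-- A `*`-representation of `U_q(su(2))` on a complex inner product space `V`: operators `K`, `K⁻¹`,
`E`, `F` satisfying the defining relations, with `K` symmetric and `F` adjoint to `E`. -/
structure UqRep (q : ℝ) (V : Type*) [NormedAddCommGroup V] [InnerProductSpace ℂ V] where
  K : V →ₗ[ℂ] V
  Kinv : V →ₗ[ℂ] V
  E : V →ₗ[ℂ] V
  F : V →ₗ[ℂ] V
  K_Kinv : K * Kinv = 1
  Kinv_K : Kinv * K = 1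
  K_E : K * E * Kinv = (q : ℂ) • E
  K_F : K * F * Kinv = (q : ℂ)⁻¹ • F
  E_F : E * F - F * E = ((q : ℂ) - (q : ℂ)⁻¹)⁻¹ • (K ^ 2 - Kinv ^ 2)
  K_symm : ∀ v w, ⟪K v, w⟫_ℂ = ⟪v, K w⟫_ℂ
  E_adj : ∀ v w, ⟪E v, w⟫_ℂ = ⟪v, F w⟫_ℂ

/-- Equivariance of `(π, F, γ)`: the dense subspace `V` carries a `*`-representation of the crossed
product of the coordinate algebra with `U_q(su(2))`, i.e. representations of both algebras with
`h a = (h₍₁₎ ▷ a) h₍₂₎`, whose restriction to the coordinate algebra is `π`; the operator `F` commutes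
with `U_q(su(2))` and `γ` commutes with the whole crossed product. -/
structure IsEquivariant (hq : 0 < q) {H : Type*} [NormedAddCommGroup H] [InnerProductSpace ℂ H]
    [CompleteSpace H] (π : Alg q s →⋆ₐ[ℂ] (H →L[ℂ] H)) (F γ : H →L[ℂ] H) {V : Submodule ℂ H}
    (R : UqRep q V) : Prop where
  dense : Dense (V : Set H)
  π_mem : ∀ a, ∀ v ∈ V, π a v ∈ V
  F_mem : ∀ v ∈ V, F v ∈ V
  γ_mem : ∀ v ∈ V, γ v ∈ V
  cross_K : ∀ (a : Alg q s) (v : V),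
    (R.K ⟨π a v, π_mem a v v.2⟩ : H) = π (actK s hq a) (R.K v)
  cross_Kinv : ∀ (a : Alg q s) (v : V),
    (R.Kinv ⟨π a v, π_mem a v v.2⟩ : H) = π (actKinv s hq a) (R.Kinv v)
  cross_E : ∀ (a : Alg q s) (v : V),
    (R.E ⟨π a v, π_mem a v v.2⟩ : H) = π (actE s hq a) (R.K v) + π (actKinv s hq a) (R.E v)
  cross_F : ∀ (a : Alg q s) (v : V),
    (R.F ⟨π a v, π_mem a v v.2⟩ : H) = π (actF s hq a) (R.K v) + π (actKinv s hq a) (R.F v)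
  F_comm : ∀ v : V, (R.K ⟨F v, F_mem v v.2⟩ : H) = F (R.K v) ∧
    (R.Kinv ⟨F v, F_mem v v.2⟩ : H) = F (R.Kinv v) ∧
    (R.E ⟨F v, F_mem v v.2⟩ : H) = F (R.E v) ∧ (R.F ⟨F v, F_mem v v.2⟩ : H) = F (R.F v)
  γ_comm : ∀ v : V, (R.K ⟨γ v, γ_mem v v.2⟩ : H) = γ (R.K v) ∧
    (R.Kinv ⟨γ v, γ_mem v v.2⟩ : H) = γ (R.Kinv v) ∧
    (R.E ⟨γ v, γ_mem v v.2⟩ : H) = γ (R.E v) ∧ (R.F ⟨γ v, γ_mem v v.2⟩ : H) = γ (R.F v)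
  γ_π : ∀ a, γ * π a = π a * γ

/-- The linear span of the basis vectors `|l,m;±N⟩`. -/
def ketSpan (n : ℤ) : Submodule ℂ (Hilb n) :=
  Submodule.span ℂ (Set.range fun i : ℤˣ × ℤ × ℤ => ket n i.1 i.2.1 i.2.2)

/-- A basis vector as an element of the span. -/
def ketS (n : ℤ) (ε : ℤˣ) (L M : ℤ) : ketSpan n :=
  ⟨ket n ε L M, Submodule.subset_span ⟨(ε, L, M), rfl⟩⟩

/-- `U_q(su(2))` acts on the vectors `|l,m;±N⟩`, for each `l`, as in its spin `l` representation. -/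
structure IsSpinRep (n : ℤ) (R : UqRep q (ketSpan n)) : Prop where
  K_ket : ∀ (ε : ℤˣ) (p : Idx n) (L M : ℤ) (m : ℝ), p.1 = (L, M) → m = M / 2 →
    R.K (ketS n ε L M) = ((q ^ m : ℝ) : ℂ) • ketS n ε L M
  E_ket : ∀ (ε : ℤˣ) (p : Idx n) (L M : ℤ) (l m : ℝ), p.1 = (L, M) → l = L / 2 → m = M / 2 →
    R.E (ketS n ε L M) = (√(br q (l - m) * br q (l + m + 1)) : ℂ) • ketS n ε L (M + 2)
  F_ket : ∀ (ε : ℤˣ) (p : Idx n) (L M : ℤ) (l m : ℝ), p.1 = (L, M) → l = L / 2 → m = M / 2 →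
    R.F (ketS n ε L M) = (√(br q (l + m) * br q (l - m + 1)) : ℂ) • ketS n ε L (M - 2)

end Podles

end

/-! The representation is factored through an auxiliary space with half-shifted spins. For each sign
`ε`, let the auxiliary basis `|j,m⟩` run over the spins `j ≥ |εN + 1/2|`. Two bounded operators are
defined on it: `v₁` takes `|j,m⟩` to `|j±1/2, m+1/2⟩`, and `v₂` takes it to `|j±1/2, m-1/2⟩`. Their
adjoints are `w₁` and `w₂`. All operators live on `ℓ²` of a lattice of labels without admissibility
conditions; coefficients are extended by zero.

Two identities carry everything. The first is `w₁v₁ + q²w₂v₂ = 1` on the auxiliary space. It makes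
the matrix with rows `(v₁w₁, q²v₁w₂)` and `(v₂w₁, q²v₂w₂)` idempotent. The second is the trace
identity `(1+s²)q²(v₁w₁ + v₂w₂) = 1 + q²s²` on the Hilbert space. Setting this matrix equal to `e_s`
defines `A`, `B`, `B*`, and the relations of the sphere are then formal consequences
(`relations_of_idem`). Multiplying out the coefficients recovers the stated ones: the path from `l`
to `l+1` passes through `j = l+1/2` and gives `α` (`alpha_sq`), while the paths from `l` to `l` pass
through `j = l±1/2` and give `β` (`beta_eq`). Uniqueness holds because `x₁` and `x₀` generate the
`*`-algebra.

Summability: the squared reduced coefficients `Xc`, `Yc` for `N` and `-N` differ by a quantity of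
order `q^{4j}`, while their prefactors grow at most like `q^{-2j}`. So the coefficients of `v` and
`w` for the two signs differ by `O(q^j)`, which is summable over the labels. Hence `∑ ‖[F,π(a)]eᵢ‖`
converges for every `a`, and this implies both compactness and the trace class property.

Index: by the first identity, the range of `e_s` is a copy of the auxiliary space, in which `F⁺`
becomes the compression `w F v`. This compression exchanges the sign of a label and multiplies by a
positive number (`dg`), bounded below, whenever the label is admissible for both signs. Kernel and
cokernel therefore come only from labels admissible for one sign. The thresholds `|N+1/2|` and
`|-N+1/2|` differ by one, so exactly the spin `j = |N| - 1/2` is left over, with `2|N|` labels. They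
lie in the kernel if `N > 0` and in the cokernel if `N < 0`, so the index is `2N`.

Equivariance is checked on generators by comparing coefficients for `K` and `E`; the statement for
`F_U` is obtained from that for `E` by taking adjoints. -/

noncomputable section

namespace NCG

/-! ## Operators on `ℓ²` -/

section L2

variable {ι κ : Type*}

/-- The Hilbert space `ℓ²(ι)`. -/
abbrev L2 (ι : Type*) : Type _ := lp (fun _ : ι => ℂ) 2

open Classical in
/-- The standard basis vector of `ℓ²(ι)` with label `i`. -/
def bv (i : ι) : L2 ι := lp.single 2 i 1

open Classical in
lemma bv_apply (i j : ι) : bv i j = if j = i then 1 else 0 := by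
  simp [bv, Pi.single_apply]

lemma bv_self (i : ι) : bv i i = 1 := by simp [bv_apply]

lemma bv_ne {i j : ι} (h : j ≠ i) : bv i j = 0 := by simp [bv_apply, h]

lemma norm_bv (i : ι) : ‖bv i‖ = 1 := by
  classical
  rw [bv, lp.norm_single (by norm_num)]; simp

lemma inner_bv_left (i : ι) (f : L2 ι) : ⟪bv i, f⟫_ℂ = f i := by
  classical
  rw [bv, lp.inner_single_left]; simp

/-- The standard Hilbert basis of `ℓ²(ι)`. -/
def stdBasis (ι : Type*) : HilbertBasis ι ℂ (L2 ι) := ⟨LinearIsometryEquiv.refl ℂ _⟩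

lemma stdBasis_apply (i : ι) : stdBasis ι i = bv i := by
  classical
  rw [← HilbertBasis.repr_symm_single]; rfl

/-- Bounded operators that agree on the standard basis are equal. -/
lemma clm_ext {E : Type*} [NormedAddCommGroup E] [NormedSpace ℂ E] {S T : L2 ι →L[ℂ] E}
    (h : ∀ i, S (bv i) = T (bv i)) : S = T := by
  refine ContinuousLinearMap.ext_on (s := Set.range (stdBasis ι)) ?_ ?_
  · exact (Submodule.dense_iff_topologicalClosure_eq_top).2 (stdBasis ι).dense_span
  · rintro _ ⟨i, rfl⟩
    simpa [stdBasis_apply] using h i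

lemma memℓp_weighted (τ : Equiv.Perm ι) (c : ι → ℝ) (hc : ∃ C, ∀ i, |c i| ≤ C) (f : L2 ι) :
    Memℓp (fun i => (c i : ℂ) * f (τ i)) 2 := by
  obtain ⟨C, hC⟩ := hc
  have hf := (memℓp_gen_iff (p := 2) (by norm_num)).1 (lp.memℓp f)
  refine (memℓp_gen_iff (p := 2) (by norm_num)).2 ?_
  refine .of_nonneg_of_le (fun i => by positivity) (fun i => ?_)
    (((τ.summable_iff).2 hf).mul_left (C ^ 2))
  have h1 : ‖(c i : ℂ) * f (τ i)‖ ≤ C * ‖f (τ i)‖ := by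
    rw [norm_mul, Complex.norm_real, Real.norm_eq_abs]
    exact mul_le_mul_of_nonneg_right (hC i) (norm_nonneg _)
  simp only [ENNReal.toReal_ofNat, Real.rpow_two, Function.comp]
  calc _ ≤ (C * ‖f (τ i)‖) ^ 2 := pow_le_pow_left₀ (norm_nonneg _) h1 2
    _ = _ := by ring

/-- The operator `f ↦ (i ↦ c i * f (τ i))` on `ℓ²(ι)`, for a permutation `τ` and bounded weights
`c`. -/
def wperm (τ : Equiv.Perm ι) (c : ι → ℝ) (hc : ∃ C, ∀ i, |c i| ≤ C) : L2 ι →L[ℂ] L2 ι :=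
  LinearMap.mkContinuousOfExistsBound
    { toFun := fun f => ⟨fun i => (c i : ℂ) * f (τ i), memℓp_weighted τ c hc f⟩
      map_add' := fun f g => by
        ext i
        exact mul_add _ _ _
      map_smul' := fun z f => by
        ext i
        simp [mul_left_comm] } (by
    obtain ⟨C, hC⟩ := hc
    refine ⟨|C|, fun f => ?_⟩
    have hf := lp.hasSum_norm (p := 2) (by norm_num) f
    have hg := lp.hasSum_norm (p := 2) (by norm_num)
      (⟨fun i => (c i : ℂ) * f (τ i), memℓp_weighted τ c ⟨C, hC⟩ f⟩ : L2 ι)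
    simp only [ENNReal.toReal_ofNat, Real.rpow_two] at hf hg
    refine le_of_sq_le_sq ?_ (by positivity)
    rw [mul_pow]
    refine hasSum_le (fun i => ?_) hg (((τ.hasSum_iff).2 hf).mul_left (|C| ^ 2))
    simp only [norm_mul, Complex.norm_real, Real.norm_eq_abs, mul_pow, Function.comp]
    exact mul_le_mul_of_nonneg_right
      (pow_le_pow_left₀ (abs_nonneg _) ((hC i).trans (le_abs_self C)) 2) (by positivity))

@[simp] lemma wperm_apply (τ : Equiv.Perm ι) (c : ι → ℝ) (hc) (f : L2 ι) (i : ι) :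
    wperm τ c hc f i = c i * f (τ i) := rfl

lemma wperm_bv (τ : Equiv.Perm ι) (c : ι → ℝ) (hc) (i : ι) :
    wperm τ c hc (bv i) = (c (τ.symm i) : ℂ) • bv (τ.symm i) := by
  ext j
  rw [wperm_apply, lp.coeFn_smul, Pi.smul_apply, bv_apply, bv_apply, smul_eq_mul]
  by_cases h : τ j = i
  · simp [← h]
  · have : j ≠ τ.symm i := fun h' => h (by simp [h'])
    simp [h, this]

lemma bdd_comp {c : ι → ℝ} (hc : ∃ C, ∀ i, |c i| ≤ C) (g : κ → ι) :
    ∃ C, ∀ i, |(c ∘ g) i| ≤ C := hc.imp fun _ h i => h (g i)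

lemma adjoint_wperm (τ : Equiv.Perm ι) (c : ι → ℝ) (hc) :
    ContinuousLinearMap.adjoint (wperm τ c hc) = wperm τ.symm (c ∘ τ.symm) (bdd_comp hc _) := by
  refine clm_ext fun i => ?_
  ext j
  rw [← inner_bv_left, ContinuousLinearMap.adjoint_inner_right, wperm_bv, inner_smul_left,
    inner_bv_left, wperm_apply]
  by_cases h : τ.symm j = i
  · simp [h]
  · simp [bv_ne h]

/-! ### Absolutely summable operators -/

variable {E E' : Type*} [NormedAddCommGroup E] [NormedSpace ℂ E] [NormedAddCommGroup E']
  [NormedSpace ℂ E']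

/-- An operator on `ℓ²(ι)` is absolutely summable if `∑ ‖T eᵢ‖` converges over the standard
basis. -/
def AbsSummable (T : L2 ι →L[ℂ] E) : Prop := Summable fun i => ‖T (bv i)‖

lemma AbsSummable.add {S T : L2 ι →L[ℂ] E} (hS : AbsSummable S) (hT : AbsSummable T) :
    AbsSummable (S + T) :=
  .of_nonneg_of_le (fun _ => norm_nonneg _) (fun _ => norm_add_le _ _) (Summable.add hS hT)

lemma AbsSummable.comp_left {T : L2 ι →L[ℂ] E} (hT : AbsSummable T) (S : E →L[ℂ] E') :
    AbsSummable (S ∘L T) :=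
  .of_nonneg_of_le (fun _ => norm_nonneg _) (fun _ => S.le_opNorm _) (Summable.mul_left ‖S‖ hT)

lemma AbsSummable.smul {T : L2 ι →L[ℂ] E} (hT : AbsSummable T) (z : ℂ) :
    AbsSummable (z • T) := by
  refine .of_nonneg_of_le (fun _ => norm_nonneg _) (fun i => ?_) (Summable.mul_left ‖z‖ hT)
  rw [smul_apply, norm_smul]

lemma absSummable_zero : AbsSummable (0 : L2 ι →L[ℂ] E) := by
  simp [AbsSummable]

lemma AbsSummable.comp_wperm {T : L2 ι →L[ℂ] E} (hT : AbsSummable T) (τ : Equiv.Perm ι)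
    (c : ι → ℝ) (hc) : AbsSummable (T ∘L wperm τ c hc) := by
  obtain ⟨C, hC⟩ := id hc
  refine .of_nonneg_of_le (fun _ => norm_nonneg _) (fun i => ?_)
    (((τ.symm.summable_iff).2 hT).mul_left C)
  rw [ContinuousLinearMap.comp_apply, wperm_bv, map_smul, norm_smul, Complex.norm_real]
  exact mul_le_mul_of_nonneg_right (hC _) (norm_nonneg _)

lemma absSummable_wperm (τ : Equiv.Perm ι) (c : ι → ℝ) (hc) (h : Summable fun i => |c i|) :
    AbsSummable (wperm τ c hc) := by
  refine ((τ.symm.summable_iff).2 h).congr fun i => ?_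
  rw [wperm_bv, norm_smul, norm_bv, mul_one, Complex.norm_real]
  rfl

/-- `T` is the sum of the rank one operators `⟨eᵢ,·⟩ T eᵢ`, whose norms are `‖T eᵢ‖`. The series
converges in operator norm, so `T` is a norm limit of finite rank operators. -/
lemma AbsSummable.isCompactOperator [CompleteSpace E] {T : L2 ι →L[ℂ] E} (hT : AbsSummable T) :
    IsCompactOperator T := by
  let R : ι → L2 ι →L[ℂ] E := fun i => (innerSL ℂ (bv i)).smulRight (T (bv i))
  have hR : Summable R := by
    refine .of_norm (hT.congr fun i => ?_)
    simp [R, ContinuousLinearMap.norm_smulRight_apply, norm_bv]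
  have hcpt : ∀ s : Finset ι, IsCompactOperator (∑ i ∈ s, R i : L2 ι →L[ℂ] E) := by
    classical
    intro s
    induction s using Finset.induction_on with
    | empty => simpa using! isCompactOperator_zero
    | insert a s ha ih =>
      rw [Finset.sum_insert ha]
      refine IsCompactOperator.add ?_ ih
      exact (isCompactOperator_of_locallyCompactSpace_dom
        (innerSL ℂ (bv a))).clm_comp (ContinuousLinearMap.toSpanSingleton ℂ (T (bv a)))
  have hlim := isCompactOperator_of_tendsto hR.hasSum (.of_forall hcpt)
  suffices h : T = ∑' i, R i by rwa [h]
  refine clm_ext fun i => ?_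
  have h1 := (ContinuousLinearMap.apply ℂ E (bv i)).hasSum hR.hasSum
  have h2 : HasSum (fun j => R j (bv i)) (R i (bv i)) := by
    refine hasSum_single i fun j hj => ?_
    simp [R, inner_bv_left, bv_ne hj]
  have h3 : R i (bv i) = T (bv i) := by simp [R, norm_bv]
  rw [← h3]
  exact h2.unique h1

/-! ### A criterion for the trace class property -/

section TraceClass

variable {H : Type*} [NormedAddCommGroup H] [InnerProductSpace ℂ H] [CompleteSpace H]

lemma norm_abs_apply (T : H →L[ℂ] H) (x : H) : ‖CFC.abs T x‖ = ‖T x‖ := by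
  have hsa : IsSelfAdjoint (CFC.abs T) := (CFC.abs_nonneg T).isSelfAdjoint
  have h : ⟪CFC.abs T x, CFC.abs T x⟫_ℂ = ⟪T x, T x⟫_ℂ := by
    rw [← ContinuousLinearMap.adjoint_inner_right, ← ContinuousLinearMap.star_eq_adjoint, hsa.star_eq,
      ← mul_apply_eq_comp, CFC.abs_mul_abs, mul_apply_eq_comp,
      ContinuousLinearMap.star_eq_adjoint, ContinuousLinearMap.adjoint_inner_right]
  rw [inner_self_eq_norm_sq_to_K, inner_self_eq_norm_sq_to_K] at h
  have h' : ‖CFC.abs T x‖ ^ 2 = ‖T x‖ ^ 2 := by exact_mod_cast h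
  exact (pow_left_inj₀ (norm_nonneg _) (norm_nonneg _) two_ne_zero).1 h'

/-- Parseval's identity in `[0,∞]`, where double sums may be exchanged without any summability
check. -/
lemma tsum_norm_sq_inner {H : Type*} [NormedAddCommGroup H] [InnerProductSpace ℂ H]
    (b : HilbertBasis ι ℂ H) (x : H) :
    ∑' i, ENNReal.ofReal (‖⟪b i, x⟫_ℂ‖ ^ 2) = ENNReal.ofReal (‖x‖ ^ 2) := by
  have h := b.hasSum_inner_mul_inner x x
  have h' : HasSum (fun i => ‖⟪b i, x⟫_ℂ‖ ^ 2) (‖x‖ ^ 2) := by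
    have h2 := Complex.reCLM.hasSum h
    rw [inner_self_eq_norm_sq_to_K] at h2
    convert! h2 using 1
    · funext i
      rw [← inner_conj_symm x (b i), mul_comm, Complex.mul_conj,
        Complex.normSq_eq_norm_sq]
      exact (Complex.ofReal_re _).symm
    · rw [← Complex.ofReal_re (‖x‖ ^ 2)]
      push_cast
      rfl
  rw [← ENNReal.ofReal_tsum_of_nonneg (fun _ => by positivity) h'.summable, h'.tsum_eq]

/-- With `S = |T|^{1/2}`, the trace of `|T|` is the squared Hilbert–Schmidt norm of `S`, which does
not depend on the basis by Parseval applied twice. In the basis `e` it is at most `∑ ‖T eᵢ‖`,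
because `⟨eᵢ,|T|eᵢ⟩ ≤ ‖|T|eᵢ‖ = ‖T eᵢ‖`. -/
lemma isTraceClass_of_summable_norm (e : HilbertBasis ι ℂ H) {T : H →L[ℂ] H}
    (hT : Summable fun i => ‖T (e i)‖) : IsTraceClass T := by
  intro κ b
  set S := CFC.sqrt (CFC.abs T) with hS
  have hsa : IsSelfAdjoint S := (CFC.sqrt_nonneg _).isSelfAdjoint
  have hSS : S * S = CFC.abs T := CFC.sqrt_mul_sqrt_self _ (CFC.abs_nonneg T)
  have hin : ∀ x y, ⟪x, S y⟫_ℂ = ⟪S x, y⟫_ℂ := fun x y => by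
    rw [← ContinuousLinearMap.adjoint_inner_right, ← ContinuousLinearMap.star_eq_adjoint,
      hsa.star_eq]
  have hre : ∀ x, (⟪x, CFC.abs T x⟫_ℂ).re = ‖S x‖ ^ 2 := fun x => by
    rw [← hSS, mul_apply_eq_comp, hin, inner_self_eq_norm_sq_to_K]
    norm_cast
  simp only [hre]
  have hfin : ∑' j, ENNReal.ofReal (‖S (b j)‖ ^ 2) ≠ ⊤ := by
    have h1 : ∑' j, ENNReal.ofReal (‖S (b j)‖ ^ 2) =
        ∑' i, ENNReal.ofReal (‖S (e i)‖ ^ 2) := by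
      calc _ = ∑' j, ∑' i, ENNReal.ofReal (‖⟪e i, S (b j)⟫_ℂ‖ ^ 2) := by
            simp only [tsum_norm_sq_inner e]
        _ = ∑' i, ∑' j, ENNReal.ofReal (‖⟪b j, S (e i)⟫_ℂ‖ ^ 2) := by
            rw [ENNReal.tsum_comm]
            simp only [hin, norm_inner_symm (S (e _))]
        _ = _ := by simp only [tsum_norm_sq_inner b]
    rw [h1]
    refine ne_top_of_le_ne_top hT.tsum_ofReal_ne_top (ENNReal.tsum_le_tsum fun i => ?_)
    refine ENNReal.ofReal_le_ofReal ?_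
    rw [← hre, ← norm_abs_apply]
    refine (Complex.re_le_norm _).trans ((norm_inner_le_norm _ _).trans ?_)
    rw [e.orthonormal.1, one_mul]
  exact (ENNReal.summable_toReal hfin).congr fun j => ENNReal.toReal_ofReal (by positivity)

end TraceClass

lemma AbsSummable.isTraceClass {T : L2 ι →L[ℂ] L2 ι} (hT : AbsSummable T) : IsTraceClass T :=
  isTraceClass_of_summable_norm (stdBasis ι) <| by
    simp only [stdBasis_apply]
    exact hT

end L2

end NCG

end

noncomputable section

namespace Podles

/-! ## `q`-numbers and coefficients -/

section Coefficients

variable {q s : ℝ}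

lemma q_sub_inv_neg (hq : 0 < q) (hq1 : q < 1) : q - q⁻¹ < 0 := by
  have := (one_lt_inv₀ hq).2 hq1
  linarith

lemma br_zero (q : ℝ) : br q 0 = 0 := by simp [br]

lemma br_pos (hq : 0 < q) (hq1 : q < 1) {x : ℝ} (hx : 0 < x) : 0 < br q x := by
  refine div_pos_of_neg_of_neg ?_ (q_sub_inv_neg hq hq1)
  have := Real.rpow_lt_rpow_of_exponent_gt hq hq1 (neg_lt_self hx)
  linarith

lemma br_nonneg (hq : 0 < q) (hq1 : q < 1) {x : ℝ} (hx : 0 ≤ x) : 0 ≤ br q x := by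
  rcases hx.eq_or_lt with rfl | h
  · rw [br_zero]
  · exact (br_pos hq hq1 h).le

lemma br_two (hq : 0 < q) (hq1 : q < 1) : br q 2 = (1 + q ^ 2) / q := by
  have h := (q_sub_inv_neg hq hq1).ne
  rw [br, div_eq_div_iff h hq.ne', Real.rpow_neg hq.le]
  norm_cast
  field_simp
  ring

/-- The square of the reduced matrix coefficient raising the spin `j` by `1/2`. -/
def Xc (q s N j : ℝ) : ℝ :=
  br q (j + 1 / 2 - N) * (q ^ (j + 1 / 2 + N) + q ^ (-(j + 1 / 2 + N)) * s ^ 2) /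
    (br q (2 * j + 1) * br q (2 * j + 2) * (1 + s ^ 2))

/-- The square of the reduced matrix coefficient lowering the spin `j` by `1/2`. -/
def Yc (q s N j : ℝ) : ℝ :=
  br q (j + 1 / 2 + N) * (q ^ (j + 1 / 2 - N) * s ^ 2 + q ^ (-(j + 1 / 2 - N))) /
    (br q (2 * j + 1) * br q (2 * j) * (1 + s ^ 2))

/-- The coefficient of `|j+1/2,m+1/2⟩` in `v₁|j,m⟩`. -/
def cP (q s N j m : ℝ) : ℝ := √(q ^ (-(j - m + 1)) * br q (j + m + 1) * Xc q s N j)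

/-- The coefficient of `|j+1/2,m-1/2⟩` in `v₂|j,m⟩`. -/
def cP' (q s N j m : ℝ) : ℝ := √(q ^ (j + m - 1) * br q (j - m + 1) * Xc q s N j)

/-- The coefficient of `|j-1/2,m+1/2⟩` in `v₁|j,m⟩`. -/
def cR (q s N j m : ℝ) : ℝ := -√(q ^ (j + m) * br q (j - m) * Yc q s N j)

/-- The coefficient of `|j-1/2,m-1/2⟩` in `v₂|j,m⟩`. -/
def cR' (q s N j m : ℝ) : ℝ := √(q ^ (-(j - m) - 2) * br q (j + m) * Yc q s N j)

lemma Xc_nonneg (hq : 0 < q) (hq1 : q < 1) {N j : ℝ} (hj : 0 ≤ j) (hN : N ≤ j + 1 / 2) :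
    0 ≤ Xc q s N j := by
  have h1 := br_nonneg hq hq1 (x := j + 1 / 2 - N) (by linarith)
  have h2 := br_nonneg hq hq1 (x := 2 * j + 1) (by linarith)
  have h3 := br_nonneg hq hq1 (x := 2 * j + 2) (by linarith)
  unfold Xc
  positivity

lemma Yc_nonneg (hq : 0 < q) (hq1 : q < 1) {N j : ℝ} (hj : 0 ≤ j) (hN : -N ≤ j + 1 / 2) :
    0 ≤ Yc q s N j := by
  have h1 := br_nonneg hq hq1 (x := j + 1 / 2 + N) (by linarith)
  have h2 := br_nonneg hq hq1 (x := 2 * j + 1) (by linarith)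
  have h3 := br_nonneg hq hq1 (x := 2 * j) (by linarith)
  unfold Yc
  positivity

lemma sqrt_mul_mul_sqrt_mul {t x : ℝ} (ht : 0 ≤ t) (hx : 0 ≤ x) (y : ℝ) :
    √(t * x) * √(t * y) = t * √(x * y) := by
  rw [← Real.sqrt_mul (mul_nonneg ht hx), show t * x * (t * y) = t ^ 2 * (x * y) by ring,
    Real.sqrt_mul (by positivity), Real.sqrt_sq ht]

/-- Both products have the same radicand up to powers of `q`, and the sign in `cR` makes them
cancel. This removes the terms of `w₁v₁ + q²w₂v₂` that change `j` by one. Since `N` and `N'` are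
independent, the same cancellation serves the compression of the flip, where the two signs are
mixed. -/
lemma coeff_cross (hq : 0 < q) (hq1 : q < 1) {N N' j m : ℝ} (hm : |m| ≤ j) (hN : N ≤ j + 1 / 2) :
    cP q s N j m * cR q s N' (j + 1) m + q ^ 2 * (cP' q s N j m * cR' q s N' (j + 1) m) = 0 := by
  obtain ⟨h1, h2⟩ := abs_le.1 hm
  have hX := Xc_nonneg (s := s) hq hq1 (by linarith) hN
  have b1 := br_nonneg hq hq1 (x := j + m + 1) (by linarith)
  have b2 := br_nonneg hq hq1 (x := j - m + 1) (by linarith)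
  unfold cP cR cP' cR'
  rw [mul_neg, ← Real.sqrt_mul (by positivity), ← Real.sqrt_mul (by positivity),
    show q ^ 2 = √((q ^ 2) ^ 2) from (Real.sqrt_sq (by positivity)).symm,
    ← Real.sqrt_mul (by positivity), neg_add_eq_zero]
  congr 1
  have e1 : j + 1 - m = j - m + 1 := by ring
  have e2 : j + 1 + m = j + m + 1 := by ring
  have e3 : q ^ (-(j - m + 1)) * q ^ (j + m + 1) =
      (q ^ 2) ^ 2 * (q ^ (j + m - 1) * q ^ (-(j - m + 1) - 2)) := by
    rw [← Real.rpow_add hq, ← Real.rpow_add hq, ← pow_mul, ← Real.rpow_natCast,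
      ← Real.rpow_add hq]
    congr 1
    push_cast
    ring
  rw [e1, e2]
  linear_combination br q (j + m + 1) * br q (j - m + 1) * Xc q s N j * Yc q s N' (j + 1) * e3

/-- The addition formula of `q`-numbers, from which most identities between brackets below follow.
-/
lemma br_combine (hq : 0 < q) (x y : ℝ) : q ^ (-x) * br q y + q ^ y * br q x = br q (x + y) := by
  simp only [br, neg_add, Real.rpow_add hq]
  ring_nf

/-- The dependence on `m` disappears by the addition formula: the `X` terms combine to `[2j+2]` and
the `Y` terms to `[2j]`. -/
lemma coeff_diag (hq : 0 < q) (hq1 : q < 1) {N N' j m : ℝ} (hm : |m| ≤ j)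
    (hN : N ≤ j + 1 / 2) (hN' : -N ≤ j + 1 / 2) :
    cP q s N j m * cP q s N' j m + cR q s N j m * cR q s N' j m +
      q ^ 2 * (cP' q s N j m * cP' q s N' j m + cR' q s N j m * cR' q s N' j m) =
    br q (2 * j + 2) * √(Xc q s N j * Xc q s N' j) + br q (2 * j) * √(Yc q s N j * Yc q s N' j) := by
  obtain ⟨h1, h2⟩ := abs_le.1 hm
  have hX := Xc_nonneg (s := s) hq hq1 (by linarith) hN
  have hY := Yc_nonneg (s := s) hq hq1 (by linarith) hN'
  have b1 := br_nonneg hq hq1 (x := j + m + 1) (by linarith)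
  have b2 := br_nonneg hq hq1 (x := j - m + 1) (by linarith)
  have b3 := br_nonneg hq hq1 (x := j + m) (by linarith)
  have b4 := br_nonneg hq hq1 (x := j - m) (by linarith)
  unfold cP cR cP' cR'
  rw [neg_mul_neg, sqrt_mul_mul_sqrt_mul (by positivity) hX, sqrt_mul_mul_sqrt_mul (by positivity) hX,
    sqrt_mul_mul_sqrt_mul (by positivity) hY, sqrt_mul_mul_sqrt_mul (by positivity) hY]
  have c1 := br_combine hq (j - m + 1) (j + m + 1)
  have c2 := br_combine hq (j - m) (j + m)
  have e1 : q ^ 2 * q ^ (j + m - 1) = q ^ (j + m + 1) := by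
    rw [← Real.rpow_natCast, ← Real.rpow_add hq]; congr 1; push_cast; ring
  have e2 : q ^ 2 * q ^ (-(j - m) - 2) = q ^ (-(j - m)) := by
    rw [← Real.rpow_natCast, ← Real.rpow_add hq]; congr 1; push_cast; ring
  rw [show 2 * j + 2 = j - m + 1 + (j + m + 1) by ring, show 2 * j = j - m + (j + m) by ring,
    ← c1, ← c2, ← e1, ← e2]
  ring

/-- After cancelling `[2j+2]` and `[2j]`, the numerators add up to `[2j+1](1+s²)` by the addition
formula, used once for the part without `s²` and once for the coefficient of `s²`. -/
lemma coeff_norm (hq : 0 < q) (hq1 : q < 1) {N j : ℝ} (hj : 0 ≤ j) (h0 : j = 0 → N = -(1 / 2)) :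
    br q (2 * j + 2) * Xc q s N j + br q (2 * j) * Yc q s N j = 1 := by
  have b1 := br_pos hq hq1 (x := 2 * j + 1) (by linarith)
  have b2 := br_pos hq hq1 (x := 2 * j + 2) (by linarith)
  have hs : (1 + s ^ 2) ≠ 0 := by positivity
  have key : br q (j + 1 / 2 - N) * (q ^ (j + 1 / 2 + N) + q ^ (-(j + 1 / 2 + N)) * s ^ 2) +
      br q (j + 1 / 2 + N) * (q ^ (j + 1 / 2 - N) * s ^ 2 + q ^ (-(j + 1 / 2 - N))) =
      br q (2 * j + 1) * (1 + s ^ 2) := by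
    have k1 := br_combine hq (j + 1 / 2 - N) (j + 1 / 2 + N)
    have k2 := br_combine hq (j + 1 / 2 + N) (j + 1 / 2 - N)
    rw [show 2 * j + 1 = j + 1 / 2 - N + (j + 1 / 2 + N) by ring]
    rw [add_comm (j + 1 / 2 + N)] at k2
    linear_combination k1 + s ^ 2 * k2
  have hX : br q (2 * j + 2) * Xc q s N j =
      br q (j + 1 / 2 - N) * (q ^ (j + 1 / 2 + N) + q ^ (-(j + 1 / 2 + N)) * s ^ 2) /
        (br q (2 * j + 1) * (1 + s ^ 2)) := by
    unfold Xc
    generalize br q (2 * j + 2) = x at *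
    rw [mul_assoc (br q (2 * j + 1)), mul_left_comm _ x, mul_div_assoc', mul_div_mul_left _ _ b2.ne']
  have hY : br q (2 * j) * Yc q s N j =
      br q (j + 1 / 2 + N) * (q ^ (j + 1 / 2 - N) * s ^ 2 + q ^ (-(j + 1 / 2 - N))) /
        (br q (2 * j + 1) * (1 + s ^ 2)) := by
    unfold Yc
    -- At `j = 0` the denominator of `Yc` is zero and the left side is zero. The right side vanishes
    -- too, because `N = -1/2` kills the factor `[j+1/2+N]`.
    rcases hj.eq_or_lt with rfl | hj
    · simp [h0 rfl, br_zero]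
    · have b3 := br_pos hq hq1 (x := 2 * j) (by linarith)
      rw [mul_assoc (br q (2 * j + 1)), mul_left_comm _ (br q (2 * j)), mul_div_assoc',
        mul_div_mul_left _ _ b3.ne']
  rw [hX, hY, ← add_div, key, div_self (by positivity)]

/-! ### Comparison with the coefficients of the representation -/

lemma Xc_sub_half (q s N l : ℝ) : Xc q s N (l - 1 / 2) =
    br q (l - N) * (q ^ (l + N) + q ^ (-(l + N)) * s ^ 2) /
      (br q (2 * l) * br q (2 * l + 1) * (1 + s ^ 2)) := by
  unfold Xc
  ring_nf

lemma Yc_add_half (q s N l : ℝ) : Yc q s N (l + 1 / 2) =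
    br q (l + 1 + N) * (q ^ (l + 1 - N) * s ^ 2 + q ^ (-(l + 1 - N))) /
      (br q (2 * l + 2) * br q (2 * l + 1) * (1 + s ^ 2)) := by
  unfold Yc
  ring_nf

/-- A diagonal entry of `v w` at spin `l` collects the paths through `j = l-1/2`, weighted by `X`,
and through `j = l+1/2`, weighted by `Y`. Up to normalization `β` is the difference of the two
weights. -/
lemma beta_eq (hq : 0 < q) (hq1 : q < 1) {N l : ℝ} (hl : 0 < l) :
    q * β q s N l = (1 + s ^ 2) * (Yc q s N (l + 1 / 2) - Xc q s N (l - 1 / 2)) := by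
  have b1 := br_pos hq hq1 (x := 2 * l) (by linarith)
  have b2 := br_pos hq hq1 (x := 2 * l + 1) (by linarith)
  have b3 := br_pos hq hq1 (x := 2 * l + 2) (by linarith)
  have hs : 0 < 1 + s ^ 2 := by positivity
  have hd := (q_sub_inv_neg hq hq1).ne
  have key : br q (2 * l + 1) * ((br q (2 * l) - q ^ (l + N + 1) * br q 2 * br q (l - N)) *
        (1 - s ^ 2) + q * br q 2 * br q (2 * N) * s ^ 2) =
      q * (br q (l + 1 + N) * (q ^ (l + 1 - N) * s ^ 2 + q ^ (-(l + 1 - N))) * br q (2 * l) -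
        br q (l - N) * (q ^ (l + N) + q ^ (-(l + N)) * s ^ 2) * br q (2 * l + 2)) := by
    rw [br_two hq hq1]
    have ha := Real.rpow_pos_of_pos hq l
    have hc := Real.rpow_pos_of_pos hq N
    have e2 : q ^ (2 : ℝ) = q ^ 2 := by norm_cast
    simp only [br, two_mul, neg_add, sub_eq_add_neg, neg_neg, Real.rpow_add hq,
      Real.rpow_neg hq.le, Real.rpow_one, e2]
    rw [← sub_eq_add_neg]
    generalize q ^ l = a at *
    generalize q ^ N = c at *
    field_simp
    ring
  rw [Yc_add_half, Xc_sub_half, β]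
  generalize br q (2 * l) = x at *
  generalize br q (2 * l + 1) = y at *
  generalize br q (2 * l + 2) = z at *
  generalize br q (2 * N) = w at *
  field_simp
  linear_combination key

lemma alpha_nonneg (hq : 0 < q) (hq1 : q < 1) {N l : ℝ} (hl : 0 ≤ l) : 0 ≤ α q s N l := by
  have := br_nonneg hq hq1 (x := 2 * l) (by linarith)
  unfold α
  positivity

/-- The spins `l-1` and `l` are connected only through `j = l-1/2`, by one step up (`X`) and one
step down (`Y`). So `α` is, up to normalization, the square root of `XY`. -/
lemma alpha_sq (hq : 0 < q) (hq1 : q < 1) {N l : ℝ} (hl : 1 ≤ l) (hN : |N| ≤ l) :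
    α q s N l ^ 2 = br q 2 * ((1 + s ^ 2) ^ 2) * Xc q s N (l - 1 / 2) * Yc q s N (l - 1 / 2) := by
  obtain ⟨h1, h2⟩ := abs_le.1 hN
  have b1 := br_pos hq hq1 (x := 2 * l) (by linarith)
  have b2 := br_pos hq hq1 (x := 2 * l + 1) (by linarith)
  have b3 := br_pos hq hq1 (x := 2 * l - 1) (by linarith)
  have b4 := br_nonneg hq hq1 (x := l + N) (by linarith)
  have b5 := br_nonneg hq hq1 (x := l - N) (by linarith)
  have b6 := br_pos hq hq1 (x := 2) (by linarith)
  have hY := Yc_add_half q s N (l - 1)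
  rw [show l - 1 + 1 / 2 = l - 1 / 2 by ring, show l - 1 + 1 = l by ring,
    show 2 * (l - 1) + 2 = 2 * l by ring, show 2 * (l - 1) + 1 = 2 * l - 1 by ring] at hY
  rw [Xc_sub_half, hY, α, mul_pow, mul_pow, Real.sq_sqrt (by positivity), Real.sq_sqrt (by positivity)]
  have : 1 + s ^ 2 ≠ 0 := by positivity
  field_simp

/-- The companion of `beta_eq`: a combination of the same two weights that depends neither on `l`
nor on `N`. It is the source of the trace identity and of the scalar term in `Azero_eq`. -/
lemma XY_linear (hq : 0 < q) (hq1 : q < 1) {N l : ℝ} (hl : 0 < l) :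
    q * (1 + s ^ 2) * (br q (2 * l) * Xc q s N (l - 1 / 2) +
      br q (2 * l + 2) * Yc q s N (l + 1 / 2)) = 1 + q ^ 2 * s ^ 2 := by
  have b1 := br_pos hq hq1 (x := 2 * l) (by linarith)
  have b2 := br_pos hq hq1 (x := 2 * l + 1) (by linarith)
  have b3 := br_pos hq hq1 (x := 2 * l + 2) (by linarith)
  have hs : 0 < 1 + s ^ 2 := by positivity
  have hd := (q_sub_inv_neg hq hq1).ne
  have key : q * (br q (l - N) * (q ^ (l + N) + q ^ (-(l + N)) * s ^ 2) +
      br q (l + 1 + N) * (q ^ (l + 1 - N) * s ^ 2 + q ^ (-(l + 1 - N)))) =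
      br q (2 * l + 1) * (1 + q ^ 2 * s ^ 2) := by
    have ha := Real.rpow_pos_of_pos hq l
    have hc := Real.rpow_pos_of_pos hq N
    simp only [br, two_mul, neg_add, sub_eq_add_neg, neg_neg, Real.rpow_add hq,
      Real.rpow_neg hq.le, Real.rpow_one]
    rw [← sub_eq_add_neg]
    generalize q ^ l = a at *
    generalize q ^ N = c at *
    field_simp
    ring
  rw [Yc_add_half, Xc_sub_half]
  generalize br q (2 * l) = x at *
  generalize br q (2 * l + 1) = y at *
  generalize br q (2 * l + 2) = z at *
  field_simp
  linear_combination key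

lemma eq_of_sq_eq_sq' {a b : ℝ} (ha : 0 ≤ a) (hb : 0 ≤ b) (h : a ^ 2 = b ^ 2) : a = b :=
  (pow_left_inj₀ ha hb two_ne_zero).1 h

lemma sqrt_mul_sqrt_common {a b x : ℝ} (ha : 0 ≤ a) (hx : 0 ≤ x) :
    √(a * x) * √(b * x) = √(a * b) * x := by
  rw [← Real.sqrt_mul (mul_nonneg ha hx), show a * x * (b * x) = a * b * x ^ 2 by ring,
    Real.sqrt_mul' _ (by positivity), Real.sqrt_sq hx]

/-- The product is the amplitude of `l → l+1/2 → l+1` in `v₁w₁`. Both sides are nonnegative, so it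
suffices to compare squares, and `alpha_sq` eliminates the roots in `α`. The two lemmas that follow
treat in the same way the entries of `v₁w₂` that raise or lower `l`. -/
lemma cP_mul_cR (hq : 0 < q) (hq1 : q < 1) {N l m : ℝ} (hm : |m| ≤ l) (hN : |N| ≤ l) :
    -((1 + q ^ 2) * (1 + s ^ 2) * (cP q s N (l + 1 / 2) (m - 1 / 2) *
      cR q s N (l + 1 / 2) (m - 1 / 2))) = Aplus q s N l m := by
  obtain ⟨m1, m2⟩ := abs_le.1 hm
  obtain ⟨n1, n2⟩ := abs_le.1 hN
  have hX := Xc_nonneg (s := s) hq hq1 (N := N) (j := l + 1 / 2) (by linarith) (by linarith)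
  have hY := Yc_nonneg (s := s) hq hq1 (N := N) (j := l + 1 / 2) (by linarith) (by linarith)
  have b1 := br_nonneg hq hq1 (x := l + m + 1) (by linarith)
  have b2 := br_nonneg hq hq1 (x := l - m + 1) (by linarith)
  have b3 := br_pos hq hq1 (x := 2) (by linarith)
  have hα := alpha_nonneg (s := s) hq hq1 (N := N) (l := l + 1) (by linarith)
  have hα2 := alpha_sq (s := s) hq hq1 (N := N) (l := l + 1) (by linarith) (by linarith)
  rw [show l + 1 - 1 / 2 = l + 1 / 2 by ring] at hα2
  unfold cP cR Aplus
  rw [show l + 1 / 2 - (m - 1 / 2) + 1 = l - m + 2 by ring,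
    show l + 1 / 2 + (m - 1 / 2) + 1 = l + m + 1 by ring,
    show l + 1 / 2 + (m - 1 / 2) = l + m by ring,
    show l + 1 / 2 - (m - 1 / 2) = l - m + 1 by ring]
  rw [mul_neg, mul_neg, neg_neg]
  refine eq_of_sq_eq_sq' (by positivity) (by positivity) ?_
  rw [mul_pow, mul_pow, mul_pow, mul_pow, mul_pow, Real.sq_sqrt (by positivity),
    Real.sq_sqrt (by positivity), Real.sq_sqrt (by positivity), hα2, br_two hq hq1]
  have e : q ^ 2 * (q ^ (-(l - m + 2)) * q ^ (l + m)) = (q ^ m) ^ 2 := by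
    rw [← Real.rpow_natCast, ← Real.rpow_natCast, ← Real.rpow_add hq, ← Real.rpow_add hq,
      ← Real.rpow_mul hq.le]
    congr 1
    push_cast
    ring
  rw [← e]
  field_simp

lemma cP_mul_cR' (hq : 0 < q) (hq1 : q < 1) {N l m : ℝ} (hm : |m| ≤ l) (hN : |N| ≤ l) :
    √(1 + q ^ 2) * (1 + s ^ 2) * q * (cP q s N (l + 1 / 2) (m + 1 / 2) *
      cR' q s N (l + 1 / 2) (m + 1 / 2)) = Bplus q s N l m := by
  obtain ⟨m1, m2⟩ := abs_le.1 hm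
  obtain ⟨n1, n2⟩ := abs_le.1 hN
  have hX := Xc_nonneg (s := s) hq hq1 (N := N) (j := l + 1 / 2) (by linarith) (by linarith)
  have hY := Yc_nonneg (s := s) hq hq1 (N := N) (j := l + 1 / 2) (by linarith) (by linarith)
  have b1 := br_nonneg hq hq1 (x := l + m + 1) (by linarith)
  have b2 := br_nonneg hq hq1 (x := l + m + 2) (by linarith)
  have b3 := br_pos hq hq1 (x := 2) (by linarith)
  have hα := alpha_nonneg (s := s) hq hq1 (N := N) (l := l + 1) (by linarith)
  have hα2 := alpha_sq (s := s) hq hq1 (N := N) (l := l + 1) (by linarith) (by linarith)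
  rw [show l + 1 - 1 / 2 = l + 1 / 2 by ring] at hα2
  unfold cP cR' Bplus
  rw [show l + 1 / 2 - (m + 1 / 2) = l - m by ring,
    show l + 1 / 2 + (m + 1 / 2) + 1 = l + m + 2 by ring,
    show l + 1 / 2 + (m + 1 / 2) = l + m + 1 by ring]
  refine eq_of_sq_eq_sq' (by positivity) (by positivity) ?_
  rw [mul_pow, mul_pow, mul_pow, mul_pow, mul_pow, mul_pow, Real.sq_sqrt (by positivity),
    Real.sq_sqrt (by positivity), Real.sq_sqrt (by positivity), Real.sq_sqrt (by positivity), hα2,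
    br_two hq hq1]
  have e : q ^ 3 * (q ^ (-(l - m + 1)) * q ^ (-(l - m) - 2)) = (q ^ (-l + m)) ^ 2 := by
    rw [← Real.rpow_natCast, ← Real.rpow_natCast, ← Real.rpow_add hq, ← Real.rpow_add hq,
      ← Real.rpow_mul hq.le]
    congr 1
    push_cast
    ring
  rw [← e]
  field_simp

lemma cR_mul_cP' (hq : 0 < q) (hq1 : q < 1) {N l m : ℝ} (hl : 1 ≤ l) (hm : m + 1 ≤ l)
    (hN : |N| ≤ l) :
    √(1 + q ^ 2) * (1 + s ^ 2) * q * (cR q s N (l - 1 / 2) (m + 1 / 2) *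
      cP' q s N (l - 1 / 2) (m + 1 / 2)) = Bminus q s N l m := by
  obtain ⟨n1, n2⟩ := abs_le.1 hN
  have hX := Xc_nonneg (s := s) hq hq1 (N := N) (j := l - 1 / 2) (by linarith) (by linarith)
  have hY := Yc_nonneg (s := s) hq hq1 (N := N) (j := l - 1 / 2) (by linarith) (by linarith)
  have b1 := br_nonneg hq hq1 (x := l - m) (by linarith)
  have b2 := br_nonneg hq hq1 (x := l - m - 1) (by linarith)
  have b3 := br_pos hq hq1 (x := 2) (by linarith)
  have hα := alpha_nonneg (s := s) hq hq1 (N := N) (l := l) (by linarith)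
  have hα2 := alpha_sq (s := s) hq hq1 (N := N) (l := l) (by linarith) (by linarith)
  unfold cP' cR Bminus
  rw [show l - 1 / 2 - (m + 1 / 2) + 1 = l - m by ring,
    show l - 1 / 2 - (m + 1 / 2) = l - m - 1 by ring,
    show l - 1 / 2 + (m + 1 / 2) = l + m by ring, neg_mul, mul_neg, neg_inj]
  refine eq_of_sq_eq_sq' (by positivity) (by positivity) ?_
  rw [mul_pow, mul_pow, mul_pow, mul_pow, mul_pow, mul_pow, Real.sq_sqrt (by positivity),
    Real.sq_sqrt (by positivity), Real.sq_sqrt (by positivity), Real.sq_sqrt (by positivity), hα2,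
    br_two hq hq1]
  have e : q ^ 3 * (q ^ (l + m) * q ^ (l + m - 1)) = (q ^ (l + m + 1)) ^ 2 := by
    rw [← Real.rpow_natCast, ← Real.rpow_natCast, ← Real.rpow_add hq, ← Real.rpow_add hq,
      ← Real.rpow_mul hq.le]
    congr 1
    push_cast
    ring
  rw [← e]
  field_simp

/-- The paths through `j = l-1/2` and `j = l+1/2` carry the same radical and opposite signs. The sum
is this radical times `X - Y`, which `beta_eq` turns into `-β`. -/
lemma Bzero_eq (hq : 0 < q) (hq1 : q < 1) {N l m : ℝ} (hl : 1 / 2 ≤ l) (hm : |m| ≤ l)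
    (hN : |N| ≤ l) :
    √(1 + q ^ 2) * (1 + s ^ 2) * q *
      (cP q s N (l - 1 / 2) (m + 1 / 2) * cP' q s N (l - 1 / 2) (m + 1 / 2) +
        cR q s N (l + 1 / 2) (m + 1 / 2) * cR' q s N (l + 1 / 2) (m + 1 / 2)) =
      Bzero q s N l m := by
  obtain ⟨m1, m2⟩ := abs_le.1 hm
  obtain ⟨n1, n2⟩ := abs_le.1 hN
  have hX := Xc_nonneg (s := s) hq hq1 (N := N) (j := l - 1 / 2) (by linarith) (by linarith)
  have hY := Yc_nonneg (s := s) hq hq1 (N := N) (j := l + 1 / 2) (by linarith) (by linarith)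
  have b1 := br_nonneg hq hq1 (x := l - m) (by linarith)
  have b2 := br_nonneg hq hq1 (x := l + m + 1) (by linarith)
  have hβ := beta_eq (s := s) hq hq1 (N := N) (l := l) (by linarith)
  unfold cP cP' cR cR' Bzero
  rw [show l - 1 / 2 - (m + 1 / 2) + 1 = l - m by ring,
    show l - 1 / 2 + (m + 1 / 2) + 1 = l + m + 1 by ring,
    show l - 1 / 2 + (m + 1 / 2) - 1 = l + m - 1 by ring,
    show l + 1 / 2 + (m + 1 / 2) = l + m + 1 by ring,
    show l + 1 / 2 - (m + 1 / 2) = l - m by ring, neg_mul,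
    sqrt_mul_sqrt_common (by positivity) hX, sqrt_mul_sqrt_common (by positivity) hY]
  have h1 : √(1 + q ^ 2) * √(q ^ (-(l - m)) * br q (l + m + 1) * (q ^ (l + m - 1) * br q (l - m))) =
      q ^ m * √(br q 2 * br q (l - m) * br q (l + m + 1)) := by
    rw [← Real.sqrt_mul (by positivity), ← Real.sqrt_sq (Real.rpow_pos_of_pos hq m).le,
      ← Real.sqrt_mul (by positivity)]
    congr 1
    have e : q * (q ^ (-(l - m)) * q ^ (l + m - 1)) = (q ^ m) ^ 2 := by
      rw [← Real.rpow_natCast, ← Real.rpow_add hq, ← Real.rpow_mul hq.le, mul_comm q,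
        ← Real.rpow_add_one hq.ne']
      congr 1
      push_cast
      ring
    rw [← e, br_two hq hq1]
    field_simp
  have h2 : q ^ (l + m + 1) * br q (l - m) * (q ^ (-(l - m) - 2) * br q (l + m + 1)) =
      q ^ (-(l - m)) * br q (l + m + 1) * (q ^ (l + m - 1) * br q (l - m)) := by
    have e : q ^ (l + m + 1) * q ^ (-(l - m) - 2) = q ^ (-(l - m)) * q ^ (l + m - 1) := by
      rw [← Real.rpow_add hq, ← Real.rpow_add hq]
      congr 1
      ring
    linear_combination br q (l - m) * br q (l + m + 1) * e
  have h3 : q ^ (m + 2) = q ^ 2 * q ^ m := by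
    rw [Real.rpow_add hq, mul_comm]
    norm_cast
  rw [h2, h3]
  generalize √(q ^ (-(l - m)) * br q (l + m + 1) * (q ^ (l + m - 1) * br q (l - m))) = x at *
  linear_combination (q * (1 + s ^ 2) * (Xc q s N (l - 1 / 2) - Yc q s N (l + 1 / 2))) * h1 +
    q * q ^ m * √(br q 2 * br q (l - m) * br q (l + m + 1)) * hβ

lemma cP_sq (hq : 0 < q) (hq1 : q < 1) {N l m : ℝ} (hl : 1 / 2 ≤ l) (hm : |m| ≤ l)
    (hN : N ≤ l) : cP q s N (l - 1 / 2) (m - 1 / 2) ^ 2 =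
      q ^ (-(l - m) - 1) * br q (l + m) * Xc q s N (l - 1 / 2) := by
  obtain ⟨m1, m2⟩ := abs_le.1 hm
  have hX := Xc_nonneg (s := s) hq hq1 (N := N) (j := l - 1 / 2) (by linarith) (by linarith)
  have b1 := br_nonneg hq hq1 (x := l + m) (by linarith)
  unfold cP
  rw [show l - 1 / 2 + (m - 1 / 2) + 1 = l + m by ring,
    show -(l - 1 / 2 - (m - 1 / 2) + 1) = -(l - m) - 1 by ring, Real.sq_sqrt (by positivity)]

lemma cP'_sq (hq : 0 < q) (hq1 : q < 1) {N l m : ℝ} (hl : 1 / 2 ≤ l) (hm : |m| ≤ l)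
    (hN : N ≤ l) : cP' q s N (l - 1 / 2) (m + 1 / 2) ^ 2 =
      q ^ (l + m - 1) * br q (l - m) * Xc q s N (l - 1 / 2) := by
  obtain ⟨m1, m2⟩ := abs_le.1 hm
  have hX := Xc_nonneg (s := s) hq hq1 (N := N) (j := l - 1 / 2) (by linarith) (by linarith)
  have b1 := br_nonneg hq hq1 (x := l - m) (by linarith)
  unfold cP'
  rw [show l - 1 / 2 - (m + 1 / 2) + 1 = l - m by ring,
    show l - 1 / 2 + (m + 1 / 2) - 1 = l + m - 1 by ring, Real.sq_sqrt (by positivity)]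

lemma cR_sq (hq : 0 < q) (hq1 : q < 1) {N l m : ℝ} (hm : |m| ≤ l)
    (hN : -N ≤ l) : cR q s N (l + 1 / 2) (m - 1 / 2) ^ 2 =
      q ^ (l + m) * br q (l - m + 1) * Yc q s N (l + 1 / 2) := by
  obtain ⟨m1, m2⟩ := abs_le.1 hm
  have hY := Yc_nonneg (s := s) hq hq1 (N := N) (j := l + 1 / 2) (by linarith) (by linarith)
  have b1 := br_nonneg hq hq1 (x := l - m + 1) (by linarith)
  unfold cR
  rw [show l + 1 / 2 + (m - 1 / 2) = l + m by ring,
    show l + 1 / 2 - (m - 1 / 2) = l - m + 1 by ring, neg_sq, Real.sq_sqrt (by positivity)]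

lemma cR'_sq (hq : 0 < q) (hq1 : q < 1) {N l m : ℝ} (hm : |m| ≤ l)
    (hN : -N ≤ l) : cR' q s N (l + 1 / 2) (m + 1 / 2) ^ 2 =
      q ^ (-(l - m) - 2) * br q (l + m + 1) * Yc q s N (l + 1 / 2) := by
  obtain ⟨m1, m2⟩ := abs_le.1 hm
  have hY := Yc_nonneg (s := s) hq hq1 (N := N) (j := l + 1 / 2) (by linarith) (by linarith)
  have b1 := br_nonneg hq hq1 (x := l + m + 1) (by linarith)
  unfold cR'
  rw [show l + 1 / 2 + (m + 1 / 2) = l + m + 1 by ring,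
    show l + 1 / 2 - (m + 1 / 2) = l - m by ring, Real.sq_sqrt (by positivity)]

/-- After the constant has been rewritten by `XY_linear`, the coefficients of `X` and of `Y` are
opposite multiples of the bracket occurring in `Azero`. The difference `Y - X` then gives `β` by
`beta_eq`. -/
lemma Azero_eq (hq : 0 < q) (hq1 : q < 1) {N l m : ℝ} (hl : 1 / 2 ≤ l) (hm : |m| ≤ l)
    (hN : |N| ≤ l) :
    -((1 + q ^ 2) * ((1 + s ^ 2) * (cP q s N (l - 1 / 2) (m - 1 / 2) ^ 2 +
      cR q s N (l + 1 / 2) (m - 1 / 2) ^ 2) - s ^ 2)) + (1 - s ^ 2) = Azero q s N l m := by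
  obtain ⟨n1, n2⟩ := abs_le.1 hN
  rw [cP_sq hq hq1 hl hm (by linarith), cR_sq hq hq1 hm (by linarith), Azero]
  have hβ := beta_eq (s := s) hq hq1 (N := N) (l := l) (by linarith)
  have hl' := XY_linear (s := s) hq hq1 (N := N) (l := l) (by linarith)
  have hd := (q_sub_inv_neg hq hq1).ne
  have ha := Real.rpow_pos_of_pos hq l
  have hb := Real.rpow_pos_of_pos hq m
  have e2 : q ^ (2 : ℝ) = q ^ 2 := by norm_cast
  have hβ' : β q s N l = (1 + s ^ 2) * (Yc q s N (l + 1 / 2) - Xc q s N (l - 1 / 2)) / q := by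
    rw [← hβ]
    field_simp
  rw [hβ', br_two hq hq1]
  have k1 : q * br q (2 * l) - (1 + q ^ 2) * (q ^ (-(l - m) - 1) * br q (l + m)) =
      -(br q (2 * l) - q ^ (l + m + 1) * ((1 + q ^ 2) / q) * br q (l - m)) / q := by
    simp only [br, two_mul, neg_add, sub_eq_add_neg, neg_neg, Real.rpow_add hq,
      Real.rpow_neg hq.le, Real.rpow_one]
    rw [← sub_eq_add_neg]
    generalize q ^ l = a at *
    generalize q ^ m = c at *
    field_simp
    ring
  have k2 : q * br q (2 * l + 2) - (1 + q ^ 2) * (q ^ (l + m) * br q (l - m + 1)) =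
      (br q (2 * l) - q ^ (l + m + 1) * ((1 + q ^ 2) / q) * br q (l - m)) / q := by
    simp only [br, two_mul, neg_add, sub_eq_add_neg, neg_neg, Real.rpow_add hq,
      Real.rpow_neg hq.le, Real.rpow_one, e2]
    rw [← sub_eq_add_neg]
    generalize q ^ l = a at *
    generalize q ^ m = c at *
    field_simp
    ring
  linear_combination (1 + s ^ 2) * Xc q s N (l - 1 / 2) * k1 +
    (1 + s ^ 2) * Yc q s N (l + 1 / 2) * k2 - hl'

/-- The diagonal part of the trace identity. The addition formula reduces the brackets to `[2l]` and
`[2l+2]`, independently of `m`, and what is left is `XY_linear`. -/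
lemma coeff_trace (hq : 0 < q) (hq1 : q < 1) {N l m : ℝ} (hl : 1 / 2 ≤ l) (hm : |m| ≤ l)
    (hN : |N| ≤ l) :
    (1 + s ^ 2) * q ^ 2 * (cP q s N (l - 1 / 2) (m - 1 / 2) ^ 2 +
      cR q s N (l + 1 / 2) (m - 1 / 2) ^ 2 + (cP' q s N (l - 1 / 2) (m + 1 / 2) ^ 2 +
      cR' q s N (l + 1 / 2) (m + 1 / 2) ^ 2)) = 1 + q ^ 2 * s ^ 2 := by
  obtain ⟨n1, n2⟩ := abs_le.1 hN
  rw [cP_sq hq hq1 hl hm (by linarith), cR_sq hq hq1 hm (by linarith),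
    cP'_sq hq hq1 hl hm (by linarith), cR'_sq hq hq1 hm (by linarith),
    ← XY_linear (s := s) hq hq1 (N := N) (l := l) (by linarith)]
  have k1 := br_combine hq (l - m) (l + m)
  have k2 := br_combine hq (l - m + 1) (l + m + 1)
  rw [show l - m + (l + m) = 2 * l by ring] at k1
  rw [show l - m + 1 + (l + m + 1) = 2 * l + 2 by ring] at k2
  have e1 : q * q ^ (-(l - m) - 1) = q ^ (-(l - m)) := by
    rw [Real.rpow_sub_one hq.ne']; field_simp
  have e2 : q * q ^ (l + m - 1) = q ^ (l + m) := by
    rw [Real.rpow_sub_one hq.ne']; field_simp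
  have e3 : q * q ^ (l + m) = q ^ (l + m + 1) := by
    rw [Real.rpow_add_one hq.ne']; ring
  have e4 : q * q ^ (-(l - m) - 2) = q ^ (-(l - m + 1)) := by
    rw [show -(l - m) - 2 = -(l - m + 1) - 1 by ring, Real.rpow_sub_one hq.ne']; field_simp
  rw [← k1, ← k2]
  linear_combination (1 + s ^ 2) * q * (Xc q s N (l - 1 / 2) * (br q (l + m) * e1 +
    br q (l - m) * e2) + Yc q s N (l + 1 / 2) * (br q (l - m + 1) * e3 + br q (l + m + 1) * e4))

/-- The off-diagonal part of the trace identity: the radicands agree and the sign of `cR` cancels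
the two terms. -/
lemma coeff_trace_cross (hq : 0 < q) (hq1 : q < 1) {N l m : ℝ} (hm : |m| ≤ l)
    (hN : N ≤ l + 1) :
    cP q s N (l + 1 / 2) (m - 1 / 2) * cR q s N (l + 1 / 2) (m - 1 / 2) +
      cP' q s N (l + 1 / 2) (m + 1 / 2) * cR' q s N (l + 1 / 2) (m + 1 / 2) = 0 := by
  obtain ⟨m1, m2⟩ := abs_le.1 hm
  have hX := Xc_nonneg (s := s) hq hq1 (N := N) (j := l + 1 / 2) (by linarith) (by linarith)
  have b1 := br_nonneg hq hq1 (x := l + m + 1) (by linarith)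
  have b2 := br_nonneg hq hq1 (x := l - m + 1) (by linarith)
  unfold cP cP' cR cR'
  rw [show l + 1 / 2 + (m - 1 / 2) = l + m by ring,
    show l + 1 / 2 - (m - 1 / 2) = l - m + 1 by ring,
    show l + 1 / 2 + (m + 1 / 2) = l + m + 1 by ring,
    show l + 1 / 2 - (m + 1 / 2) = l - m by ring, mul_neg, neg_add_eq_zero,
    ← Real.sqrt_mul (by positivity), ← Real.sqrt_mul (by positivity)]
  congr 1
  have e : q ^ (-(l - m + 1 + 1)) * q ^ (l + m) = q ^ (l + m + 1 - 1) * q ^ (-(l - m) - 2) := by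
    rw [← Real.rpow_add hq, ← Real.rpow_add hq]
    congr 1
    ring
  linear_combination br q (l + m + 1) * br q (l - m + 1) * Xc q s N (l + 1 / 2) *
    Yc q s N (l + 1 / 2) * e

end Coefficients

end Podles

end

noncomputable section

namespace Podles

open NCG

/-! ## Operators on the lattice of labels -/

section Lattice

/-- Labels `(ε, 2j, 2m)`, without admissibility conditions. -/
abbrev Lat : Type := ℤˣ × ℤ × ℤ

/-- Translation of the labels `(2j, 2m)`. -/
def sh (a b : ℤ) : Equiv.Perm Lat :=
  (Equiv.refl ℤˣ).prodCongr ((Equiv.addRight a).prodCongr (Equiv.addRight b))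

/-- Multiplication of the sign by `δ`. -/
def sgn (δ : ℤˣ) : Equiv.Perm Lat := (Equiv.mulLeft δ).prodCongr (Equiv.refl _)

@[simp] lemma sh_apply (a b : ℤ) (ε : ℤˣ) (J M : ℤ) : sh a b (ε, J, M) = (ε, J + a, M + b) := rfl

@[simp] lemma sh_symm (a b : ℤ) : (sh a b).symm = sh (-a) (-b) := by
  ext ⟨ε, J, M⟩ <;> simp [sh]

@[simp] lemma sgn_apply (δ ε : ℤˣ) (J M : ℤ) : sgn δ (ε, J, M) = (δ * ε, J, M) := rfl

/-- Admissible labels: `j - |εN + 1/2|` and `j - |m|` are natural numbers. -/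
def auxAdm (n : ℤ) (i : Lat) : Prop :=
  (∃ k : ℕ, i.2.1 - |(i.1 : ℤ) * n + 1| = 2 * k) ∧ (∃ k : ℕ, i.2.1 - |i.2.2| = 2 * k)

/-- Admissible labels `(2l, 2m)` of basis vectors of the Hilbert space. -/
abbrev hilbAdm (n L M : ℤ) : Prop :=
  (∃ k : ℕ, L - |n| = 2 * k) ∧ (∃ k : ℕ, L - |M| = 2 * k)

variable {n : ℤ} {q s : ℝ}

lemma spin_one (n : ℤ) : spin n 1 = n / 2 := by simp [spin]

lemma spin_neg_one (n : ℤ) : spin n (-1) = -(n / 2) := by simp [spin]; ring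

lemma abs_spin (n : ℤ) (ε : ℤˣ) : |spin n ε| = |(n : ℝ)| / 2 := by
  rcases Int.units_eq_one_or ε with rfl | rfl
  · rw [spin_one, abs_div]; norm_num
  · rw [spin_neg_one, abs_neg, abs_div]; norm_num

lemma auxAdm.bounds {ε : ℤˣ} {J M : ℤ} (h : auxAdm n (ε, J, M)) :
    |(M : ℝ) / 2| ≤ (J : ℝ) / 2 ∧ |spin n ε + 1 / 2| ≤ (J : ℝ) / 2 := by
  obtain ⟨⟨k, hk⟩, ⟨k', hk'⟩⟩ := h
  simp only at hk hk'
  have h1 : |M| ≤ J := by omega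
  have h2 : |(ε : ℤ) * n + 1| ≤ J := by omega
  have h1' : |(M : ℝ)| ≤ J := by exact_mod_cast h1
  have h2' : |((ε : ℤ) : ℝ) * n + 1| ≤ J := by exact_mod_cast h2
  constructor
  · rw [abs_div, abs_two]; linarith
  · rw [show spin n ε + 1 / 2 = (((ε : ℤ) : ℝ) * n + 1) / 2 by unfold spin; ring, abs_div, abs_two]
    linarith

lemma hilbAdm.bounds {L M : ℤ} (h : hilbAdm n L M) (ε : ℤˣ) :
    |(M : ℝ) / 2| ≤ (L : ℝ) / 2 ∧ |spin n ε| ≤ (L : ℝ) / 2 := by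
  obtain ⟨⟨k, hk⟩, ⟨k', hk'⟩⟩ := h
  have h1 : |M| ≤ L := by omega
  have h2 : |n| ≤ L := by omega
  have h1' : |(M : ℝ)| ≤ L := by exact_mod_cast h1
  have h2' : |(n : ℝ)| ≤ L := by exact_mod_cast h2
  constructor
  · rw [abs_div, abs_two]; linarith
  · rw [abs_spin]; linarith

lemma hilbAdm.one_le (hn : n ≠ 0) {L M : ℤ} (h : hilbAdm n L M) : 1 / 2 ≤ (L : ℝ) / 2 := by
  obtain ⟨⟨k, hk⟩, -⟩ := h
  have := abs_pos.2 hn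
  have h1 : 1 ≤ L := by omega
  have h1' : (1 : ℝ) ≤ L := by exact_mod_cast h1
  linarith

open Classical in
/-- The function `f(N, j, m)` on admissible labels, extended by zero. -/
def wt (n : ℤ) (f : ℝ → ℝ → ℝ → ℝ) (i : Lat) : ℝ :=
  if auxAdm n i then f (spin n i.1) (i.2.1 / 2) (i.2.2 / 2) else 0

lemma wt_of {f : ℝ → ℝ → ℝ → ℝ} {i : Lat} (h : auxAdm n i) :
    wt n f i = f (spin n i.1) (i.2.1 / 2) (i.2.2 / 2) := if_pos h

lemma wt_of_not {f : ℝ → ℝ → ℝ → ℝ} {i : Lat} (h : ¬ auxAdm n i) : wt n f i = 0 := if_neg h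

lemma coeff_sq_sum (hq : 0 < q) (hq1 : q < 1) {ε : ℤˣ} {J M : ℤ} (h : auxAdm n (ε, J, M)) :
    cP q s (spin n ε) (J / 2) (M / 2) ^ 2 + cR q s (spin n ε) (J / 2) (M / 2) ^ 2 +
      q ^ 2 * (cP' q s (spin n ε) (J / 2) (M / 2) ^ 2 +
        cR' q s (spin n ε) (J / 2) (M / 2) ^ 2) = 1 := by
  obtain ⟨h1, h2⟩ := h.bounds
  obtain ⟨h3, h4⟩ := abs_le.1 h2
  have hj : 0 ≤ (J : ℝ) / 2 := (abs_nonneg _).trans h1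
  have hX := Xc_nonneg (s := s) hq hq1 (N := spin n ε) hj (by linarith)
  have hY := Yc_nonneg (s := s) hq hq1 (N := spin n ε) hj (by linarith)
  have := coeff_diag (s := s) hq hq1 (N := spin n ε) (N' := spin n ε) h1 (by linarith) (by linarith)
  -- If `j = 0`, admissibility gives `|εN + 1/2| ≤ 0`, hence `εN = -1/2`, as `coeff_norm` requires.
  rw [Real.sqrt_mul_self hX, Real.sqrt_mul_self hY, coeff_norm hq hq1 hj (fun h0 => by linarith)]
    at this
  rw [← this]
  ring

/-- The weighted sum of the squares of the four coefficients is `1`, so each is bounded; the weight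
`q²` on the primed ones costs a factor `q⁻¹`. -/
lemma bdd_wt (hq : 0 < q) (hq1 : q < 1) (n : ℤ) :
    (∃ C, ∀ i, |wt n (cP q s) i| ≤ C) ∧ (∃ C, ∀ i, |wt n (cR q s) i| ≤ C) ∧
    (∃ C, ∀ i, |wt n (cP' q s) i| ≤ C) ∧ (∃ C, ∀ i, |wt n (cR' q s) i| ≤ C) := by
  have key : ∀ i, |wt n (cP q s) i| ≤ 1 ∧ |wt n (cR q s) i| ≤ 1 ∧ |wt n (cP' q s) i| ≤ q⁻¹ ∧
      |wt n (cR' q s) i| ≤ q⁻¹ := by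
    rintro ⟨ε, J, M⟩
    by_cases h : auxAdm n (ε, J, M)
    · have hs := coeff_sq_sum (s := s) hq hq1 h
      simp only [wt_of h]
      have hqi : 0 < q⁻¹ := inv_pos.2 hq
      have e : q * q⁻¹ = 1 := mul_inv_cancel₀ hq.ne'
      have hA : ∀ x : ℝ, (q * x) ^ 2 ≤ 1 → |x| ≤ q⁻¹ := fun x hx => by
        have := abs_le_one_iff_mul_self_le_one.2 (by nlinarith : q * x * (q * x) ≤ 1)
        rw [abs_mul, abs_of_pos hq] at this
        rw [← one_div, le_div_iff₀ hq]
        linarith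
      refine ⟨abs_le_one_iff_mul_self_le_one.2 ?_, abs_le_one_iff_mul_self_le_one.2 ?_,
        hA _ ?_, hA _ ?_⟩ <;> nlinarith [sq_nonneg (cP q s (spin n ε) (J / 2) (M / 2)),
          sq_nonneg (cR q s (spin n ε) (J / 2) (M / 2)),
          sq_nonneg (q * cP' q s (spin n ε) (J / 2) (M / 2)),
          sq_nonneg (q * cR' q s (spin n ε) (J / 2) (M / 2))]
    · simp only [wt_of_not h, abs_zero]
      have : 0 ≤ q⁻¹ := (inv_pos.2 hq).le
      simp [this]
  exact ⟨⟨1, fun i => (key i).1⟩, ⟨1, fun i => (key i).2.1⟩, ⟨q⁻¹, fun i => (key i).2.2.1⟩,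
    ⟨q⁻¹, fun i => (key i).2.2.2⟩⟩

lemma wt_cross (hq : 0 < q) (hq1 : q < 1) (ε ε' : ℤˣ) (J M : ℤ) :
    wt n (cP q s) (ε, J, M) * wt n (cR q s) (ε', J + 2, M) +
      q ^ 2 * (wt n (cP' q s) (ε, J, M) * wt n (cR' q s) (ε', J + 2, M)) = 0 := by
  by_cases h : auxAdm n (ε, J, M)
  · by_cases h' : auxAdm n (ε', J + 2, M)
    · obtain ⟨h1, h2⟩ := h.bounds
      simp only [wt_of h, wt_of h']
      rw [show ((J + 2 : ℤ) : ℝ) / 2 = J / 2 + 1 by push_cast; ring]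
      exact coeff_cross hq hq1 h1 (by linarith [(abs_le.1 h2).2])
    · simp [wt_of_not h']
  · simp [wt_of_not h]

open Classical in
/-- The diagonal matrix coefficients between the representations with signs `ε` and `δε`. -/
def dg (n : ℤ) (q s : ℝ) (δ : ℤˣ) (i : Lat) : ℝ :=
  if auxAdm n i ∧ auxAdm n (sgn δ i) then
    br q (i.2.1 + 2) * √(Xc q s (spin n i.1) (i.2.1 / 2) * Xc q s (spin n (δ * i.1)) (i.2.1 / 2)) +
    br q i.2.1 * √(Yc q s (spin n i.1) (i.2.1 / 2) * Yc q s (spin n (δ * i.1)) (i.2.1 / 2))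
  else 0

lemma wt_diag (hq : 0 < q) (hq1 : q < 1) (δ : ℤˣ) (i : Lat) :
    wt n (cP q s) i * wt n (cP q s) (sgn δ i) + wt n (cR q s) i * wt n (cR q s) (sgn δ i) +
      q ^ 2 * (wt n (cP' q s) i * wt n (cP' q s) (sgn δ i) +
        wt n (cR' q s) i * wt n (cR' q s) (sgn δ i)) = dg n q s δ i := by
  obtain ⟨ε, J, M⟩ := i
  by_cases h : auxAdm n (ε, J, M)
  · rw [sgn_apply]
    by_cases h' : auxAdm n (δ * ε, J, M)
    · obtain ⟨h1, h2⟩ := h.bounds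
      obtain ⟨h3, h4⟩ := abs_le.1 h2
      rw [dg, if_pos ⟨h, h'⟩]
      simp only [wt_of h, wt_of h']
      rw [coeff_diag hq hq1 h1 (by linarith) (by linarith)]
      congr 3 <;> ring
    · simp [wt_of_not h', dg, h']
  · simp [wt_of_not h, dg, h]

open Classical in
lemma dg_one (hq : 0 < q) (hq1 : q < 1) (i : Lat) :
    dg n q s 1 i = if auxAdm n i then 1 else 0 := by
  obtain ⟨ε, J, M⟩ := i
  rw [← wt_diag hq hq1]
  by_cases h : auxAdm n (ε, J, M)
  · have := coeff_sq_sum (s := s) hq hq1 h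
    simp only [sgn_apply, one_mul, wt_of h, if_pos h]
    rw [← this]
    ring
  · simp [wt_of_not h, h]

/-! ### Admissibility -/

/-- Admissibility is turned into linear inequalities and a divisibility, so that every boundary
discussion becomes a question for `omega`. -/
lemma exists_sub_abs_iff (J a : ℤ) :
    (∃ k : ℕ, J - |a| = 2 * k) ↔ -J ≤ a ∧ a ≤ J ∧ 2 ∣ J - a := by
  constructor
  · rintro ⟨k, hk⟩
    rcases abs_cases a with h | h <;> omega
  · intro h
    refine ⟨((J - |a|) / 2).toNat, ?_⟩
    rcases abs_cases a with h' | h' <;> omega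

lemma auxAdm_iff (ε : ℤˣ) (J M : ℤ) : auxAdm n (ε, J, M) ↔
    (-J ≤ (ε : ℤ) * n + 1 ∧ (ε : ℤ) * n + 1 ≤ J ∧ 2 ∣ J - ((ε : ℤ) * n + 1)) ∧
      -J ≤ M ∧ M ≤ J ∧ 2 ∣ J - M :=
  and_congr (exists_sub_abs_iff _ _) (exists_sub_abs_iff _ _)

lemma hilbAdm_iff (ε : ℤˣ) (L M : ℤ) : hilbAdm n L M ↔
    (-L ≤ (ε : ℤ) * n ∧ (ε : ℤ) * n ≤ L ∧ 2 ∣ L - (ε : ℤ) * n) ∧ -L ≤ M ∧ M ≤ L ∧ 2 ∣ L - M := by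
  have hε : |n| = |(ε : ℤ) * n| := by
    rcases Int.units_eq_one_or ε with rfl | rfl <;> simp
  unfold hilbAdm
  rw [hε]
  exact and_congr (exists_sub_abs_iff _ _) (exists_sub_abs_iff _ _)

lemma auxAdm.hilbAdm_up {ε : ℤˣ} {J M b : ℤ} (h : auxAdm n (ε, J, M)) (hb : b = 1 ∨ b = -1) :
    hilbAdm n (J + 1) (M + b) := by
  rw [hilbAdm_iff ε]
  rw [auxAdm_iff] at h
  omega

lemma hilbAdm.auxAdm_up {L M b : ℤ} (h : hilbAdm n L M) (ε : ℤˣ) (hb : b = 1 ∨ b = -1) :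
    auxAdm n (ε, L + 1, M + b) := by
  rw [auxAdm_iff]
  rw [hilbAdm_iff ε] at h
  omega

lemma spin_eq {ε : ℤˣ} {a : ℤ} (h : (ε : ℤ) * n = a) : spin n ε = a / 2 := by
  rw [spin, ← h]
  push_cast
  rfl

/-- An admissible `j` can lead to an inadmissible `l = j - 1/2` only at `m = j` or `εN = -j-1/2`.
There the factor `[j-m]` or `[j+1/2+N]` vanishes, so the image of `v₁` is supported on admissible
labels without any cutoff. `wt_cR'_eq_zero` does the same for `v₂`. -/
lemma wt_cR_eq_zero {ε : ℤˣ} {J M : ℤ} (h : ¬ hilbAdm n (J - 1) (M + 1)) :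
    wt n (cR q s) (ε, J, M) = 0 := by
  by_cases ha : auxAdm n (ε, J, M)
  · rw [wt_of ha]
    rw [hilbAdm_iff ε] at h
    rw [auxAdm_iff] at ha
    have hc : M = J ∨ (ε : ℤ) * n = -J - 1 := by omega
    rcases hc with hc | hc
    · simp [cR, hc, br_zero]
    · have : (J : ℝ) / 2 + 1 / 2 + spin n ε = 0 := by
        rw [spin_eq hc]; push_cast; ring
      rw [cR, Yc, this]
      simp [br_zero]
  · exact wt_of_not ha

lemma wt_cR'_eq_zero {ε : ℤˣ} {J M : ℤ} (h : ¬ hilbAdm n (J - 1) (M - 1)) :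
    wt n (cR' q s) (ε, J, M) = 0 := by
  by_cases ha : auxAdm n (ε, J, M)
  · rw [wt_of ha]
    rw [hilbAdm_iff ε] at h
    rw [auxAdm_iff] at ha
    have hc : M = -J ∨ (ε : ℤ) * n = -J - 1 := by omega
    rcases hc with hc | hc
    · have : (J : ℝ) / 2 + M / 2 = 0 := by
        rw [hc]; push_cast; ring
      simp [cR', this, br_zero]
    · have : (J : ℝ) / 2 + 1 / 2 + spin n ε = 0 := by
        rw [spin_eq hc]; push_cast; ring
      rw [cR', Yc, this]
      simp [br_zero]
  · exact wt_of_not ha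

/-- Extension by zero does not change the formula for the coefficient when the target `l` is
admissible: the only excluded labels are `m = -l` and `εN = l`, where the formula itself gives zero.
-/
lemma hilbAdm.wt_cP {L M : ℤ} (h : hilbAdm n L M) (ε : ℤˣ) :
    wt n (cP q s) (ε, L - 1, M - 1) = cP q s (spin n ε) (L / 2 - 1 / 2) (M / 2 - 1 / 2) := by
  by_cases ha : auxAdm n (ε, L - 1, M - 1)
  · rw [wt_of ha]
    push_cast
    congr 1 <;> ring
  · rw [wt_of_not ha]
    rw [hilbAdm_iff ε] at h
    rw [auxAdm_iff] at ha
    have hc : M = -L ∨ (ε : ℤ) * n = L := by omega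
    rcases hc with hc | hc
    · have : (L : ℝ) / 2 - 1 / 2 + (M / 2 - 1 / 2) + 1 = 0 := by
        rw [hc]; push_cast; ring
      rw [cP, this]
      simp [br_zero]
    · have : (L : ℝ) / 2 - 1 / 2 + 1 / 2 - spin n ε = 0 := by
        rw [spin_eq hc]; ring
      rw [cP, Xc, this]
      simp [br_zero]

lemma hilbAdm.wt_cP' {L M : ℤ} (h : hilbAdm n L M) (ε : ℤˣ) :
    wt n (cP' q s) (ε, L - 1, M + 1) = cP' q s (spin n ε) (L / 2 - 1 / 2) (M / 2 + 1 / 2) := by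
  by_cases ha : auxAdm n (ε, L - 1, M + 1)
  · rw [wt_of ha]
    push_cast
    congr 1 <;> ring
  · rw [wt_of_not ha]
    rw [hilbAdm_iff ε] at h
    rw [auxAdm_iff] at ha
    have hc : M = L ∨ (ε : ℤ) * n = L := by omega
    rcases hc with hc | hc
    · have : (L : ℝ) / 2 - 1 / 2 - (M / 2 + 1 / 2) + 1 = 0 := by
        rw [hc]; ring
      rw [cP', this]
      simp [br_zero]
    · have : (L : ℝ) / 2 - 1 / 2 + 1 / 2 - spin n ε = 0 := by
        rw [spin_eq hc]; ring
      rw [cP', Xc, this]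
      simp [br_zero]

lemma hilbAdm.wt_up {L M b : ℤ} (h : hilbAdm n L M) (ε : ℤˣ) (hb : b = 1 ∨ b = -1)
    (f : ℝ → ℝ → ℝ → ℝ) :
    wt n f (ε, L + 1, M + b) = f (spin n ε) (L / 2 + 1 / 2) (M / 2 + b / 2) := by
  rw [wt_of (h.auxAdm_up ε hb)]
  push_cast
  congr 1 <;> ring

lemma wt_trace (hq : 0 < q) (hq1 : q < 1) (hn : n ≠ 0) {L M : ℤ} (h : hilbAdm n L M) (ε : ℤˣ) :
    (1 + s ^ 2) * q ^ 2 * (wt n (cP q s) (ε, L - 1, M - 1) ^ 2 +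
      wt n (cR q s) (ε, L + 1, M - 1) ^ 2 + (wt n (cP' q s) (ε, L - 1, M + 1) ^ 2 +
      wt n (cR' q s) (ε, L + 1, M + 1) ^ 2)) = 1 + q ^ 2 * s ^ 2 := by
  rw [h.wt_cP, h.wt_cP', sub_eq_add_neg M, h.wt_up ε (.inr rfl), h.wt_up ε (.inl rfl)]
  rw [← coeff_trace hq hq1 (h.one_le hn) (h.bounds ε).1 (h.bounds ε).2]
  push_cast
  ring_nf

lemma wt_trace_cross (hq : 0 < q) (hq1 : q < 1) {L M : ℤ} (h : hilbAdm n L M) (ε : ℤˣ) :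
    wt n (cP q s) (ε, L + 1, M - 1) * wt n (cR q s) (ε, L + 1, M - 1) +
      wt n (cP' q s) (ε, L + 1, M + 1) * wt n (cR' q s) (ε, L + 1, M + 1) = 0 := by
  obtain ⟨h1, h2⟩ := h.bounds ε
  rw [sub_eq_add_neg M, h.wt_up ε (.inr rfl), h.wt_up ε (.inr rfl), h.wt_up ε (.inl rfl),
    h.wt_up ε (.inl rfl)]
  rw [← coeff_trace_cross (s := s) hq hq1 (N := spin n ε) h1 (by linarith [(abs_le.1 h2).2])]
  push_cast
  ring_nf

/-! ### The operators `v₁`, `v₂` and their adjoints -/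

section Operators

variable (hq : 0 < q) (hq1 : q < 1) (s n)

/-- The adjoint of `v₁`. -/
def w₁ : L2 Lat →L[ℂ] L2 Lat :=
  wperm (sh 1 1) (wt n (cP q s)) (bdd_wt hq hq1 n).1 +
    wperm (sh (-1) 1) (wt n (cR q s)) (bdd_wt hq hq1 n).2.1

/-- The adjoint of `v₂`. -/
def w₂ : L2 Lat →L[ℂ] L2 Lat :=
  wperm (sh 1 (-1)) (wt n (cP' q s)) (bdd_wt hq hq1 n).2.2.1 +
    wperm (sh (-1) (-1)) (wt n (cR' q s)) (bdd_wt hq hq1 n).2.2.2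

/-- The operator `v₁`. -/
def v₁ : L2 Lat →L[ℂ] L2 Lat := ContinuousLinearMap.adjoint (w₁ n s hq hq1)

/-- The operator `v₂`. -/
def v₂ : L2 Lat →L[ℂ] L2 Lat := ContinuousLinearMap.adjoint (w₂ n s hq hq1)

/-- The operator that multiplies the sign by `δ`. -/
def sflip (δ : ℤˣ) : L2 Lat →L[ℂ] L2 Lat := wperm (sgn δ) (fun _ => 1) ⟨1, by simp⟩

lemma sflip_apply (δ : ℤˣ) (f : L2 Lat) (i : Lat) : sflip δ f i = f (sgn δ i) := by
  simp [sflip]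

lemma w₁_apply (f : L2 Lat) (ε : ℤˣ) (J M : ℤ) : w₁ n s hq hq1 f (ε, J, M) =
    wt n (cP q s) (ε, J, M) * f (ε, J + 1, M + 1) +
      wt n (cR q s) (ε, J, M) * f (ε, J - 1, M + 1) := rfl

lemma w₂_apply (f : L2 Lat) (ε : ℤˣ) (J M : ℤ) : w₂ n s hq hq1 f (ε, J, M) =
    wt n (cP' q s) (ε, J, M) * f (ε, J + 1, M - 1) +
      wt n (cR' q s) (ε, J, M) * f (ε, J - 1, M - 1) := rfl

lemma v₁_apply (f : L2 Lat) (ε : ℤˣ) (L M : ℤ) : v₁ n s hq hq1 f (ε, L, M) =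
    wt n (cP q s) (ε, L - 1, M - 1) * f (ε, L - 1, M - 1) +
      wt n (cR q s) (ε, L + 1, M - 1) * f (ε, L + 1, M - 1) := by
  rw [v₁, w₁, map_add, adjoint_wperm, adjoint_wperm]
  simp [sub_eq_add_neg]

lemma v₂_apply (f : L2 Lat) (ε : ℤˣ) (L M : ℤ) : v₂ n s hq hq1 f (ε, L, M) =
    wt n (cP' q s) (ε, L - 1, M + 1) * f (ε, L - 1, M + 1) +
      wt n (cR' q s) (ε, L + 1, M + 1) * f (ε, L + 1, M + 1) := by
  rw [v₂, w₂, map_add, adjoint_wperm, adjoint_wperm]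
  simp [sub_eq_add_neg]

/-- The central computation. For `δ = 1` it says that `(w₁, q²w₂)` is a left inverse of `(v₁, v₂)`;
for `δ = -1` it diagonalizes the compression of the flip, up to the exchange of signs. -/
lemma wv_apply (δ : ℤˣ) (f : L2 Lat) (i : Lat) :
    w₁ n s hq hq1 (sflip δ (v₁ n s hq hq1 f)) i +
      (q : ℂ) ^ 2 * w₂ n s hq hq1 (sflip δ (v₂ n s hq hq1 f)) i =
      dg n q s δ i * f (sgn δ i) := by
  obtain ⟨ε, J, M⟩ := i
  have h1 := wt_diag (n := n) (s := s) hq hq1 δ (ε, J, M)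
  have h2 := wt_cross (n := n) (s := s) hq hq1 ε (δ * ε) J M
  -- The term reaching the label `J - 2` is controlled by the same identity, based at `J - 2` and
  -- with the two signs exchanged.
  have h3 := wt_cross (n := n) (s := s) hq hq1 (δ * ε) ε (J - 2) M
  simp only [w₁_apply, w₂_apply, sflip_apply, sgn_apply, v₁_apply, v₂_apply] at h1 ⊢
  rw [show J + 1 - 1 = J by ring, show J - 1 + 1 = J by ring, show M + 1 - 1 = M by ring,
    show M - 1 + 1 = M by ring, show J + 1 + 1 = J + 2 by ring, show J - 1 - 1 = J - 2 by ring]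
  rw [show J - 2 + 2 = J by ring] at h3
  have h1' := congrArg Complex.ofReal h1
  have h2' := congrArg Complex.ofReal h2
  have h3' := congrArg Complex.ofReal h3
  push_cast at h1' h2' h3'
  rw [← h1']
  linear_combination f (δ * ε, J + 2, M) * h2' + f (δ * ε, J - 2, M) * h3'

lemma v₁_support (f : L2 Lat) {ε : ℤˣ} {L M : ℤ} (h : ¬ hilbAdm n L M) :
    v₁ n s hq hq1 f (ε, L, M) = 0 := by
  have h1 : ¬ auxAdm n (ε, L - 1, M - 1) := fun h' => h (by simpa using h'.hilbAdm_up (.inl rfl))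
  rw [v₁_apply, wt_of_not h1, wt_cR_eq_zero (by simpa using h)]
  simp

lemma v₂_support (f : L2 Lat) {ε : ℤˣ} {L M : ℤ} (h : ¬ hilbAdm n L M) :
    v₂ n s hq hq1 f (ε, L, M) = 0 := by
  have h1 : ¬ auxAdm n (ε, L - 1, M + 1) := fun h' => h (by simpa using h'.hilbAdm_up (.inr rfl))
  rw [v₂_apply, wt_of_not h1, wt_cR'_eq_zero (by simpa using h)]
  simp

lemma w₁_support (f : L2 Lat) {i : Lat} (h : ¬ auxAdm n i) : w₁ n s hq hq1 f i = 0 := by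
  obtain ⟨ε, J, M⟩ := i
  simp [w₁_apply, wt_of_not h]

lemma w₂_support (f : L2 Lat) {i : Lat} (h : ¬ auxAdm n i) : w₂ n s hq hq1 f i = 0 := by
  obtain ⟨ε, J, M⟩ := i
  simp [w₂_apply, wt_of_not h]

lemma vw_trace (hn : n ≠ 0) (f : L2 Lat) (hf : ∀ ε L M, ¬ hilbAdm n L M → f (ε, L, M) = 0)
    {ε : ℤˣ} {L M : ℤ} (h : hilbAdm n L M) :
    (1 + (s : ℂ) ^ 2) * (q : ℂ) ^ 2 * (v₁ n s hq hq1 (w₁ n s hq hq1 f) (ε, L, M) +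
      v₂ n s hq hq1 (w₂ n s hq hq1 f) (ε, L, M)) = (1 + (q : ℂ) ^ 2 * (s : ℂ) ^ 2) * f (ε, L, M) := by
  have h1 := congrArg Complex.ofReal (wt_trace (s := s) hq hq1 hn h ε)
  have h2 := congrArg Complex.ofReal (wt_trace_cross (s := s) hq hq1 h ε)
  simp only [w₁_apply, w₂_apply, v₁_apply, v₂_apply]
  rw [show L + 1 - 1 = L by ring, show L - 1 + 1 = L by ring, show M + 1 - 1 = M by ring,
    show M - 1 + 1 = M by ring, show L + 1 + 1 = L + 2 by ring, show L - 1 - 1 = L - 2 by ring]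
  have h3 : ((wt n (cP q s) (ε, L - 1, M - 1) : ℂ) * wt n (cR q s) (ε, L - 1, M - 1) +
      wt n (cP' q s) (ε, L - 1, M + 1) * wt n (cR' q s) (ε, L - 1, M + 1)) * f (ε, L - 2, M) = 0 := by
    -- If the lower label is not admissible, the cancellation may fail, but `f` vanishes there.
    by_cases h' : hilbAdm n (L - 2) M
    · have h3 := congrArg Complex.ofReal (wt_trace_cross (s := s) hq hq1 h' ε)
      rw [show L - 2 + 1 = L - 1 by ring] at h3
      push_cast at h3
      rw [h3, zero_mul]
    · rw [hf _ _ _ h', mul_zero]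
  push_cast at h1 h2
  rw [← h1]
  linear_combination (1 + (s : ℂ) ^ 2) * (q : ℂ) ^ 2 * (f (ε, L + 2, M) * h2 + h3)

end Operators

end Lattice

end Podles

end

noncomputable section

namespace NCG

variable {ι κ : Type*}

lemma memℓp_comp {g : κ → ι} (hg : Function.Injective g) (f : L2 ι) :
    Memℓp (fun k => f (g k)) 2 :=
  (memℓp_gen_iff (p := 2) (by norm_num)).2
    (((memℓp_gen_iff (p := 2) (by norm_num)).1 (lp.memℓp f)).comp_injective hg)

/-- Composition with an injective map, as an operator `ℓ²(ι) → ℓ²(κ)`. -/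
def pull (g : κ → ι) (hg : Function.Injective g) : L2 ι →L[ℂ] L2 κ :=
  LinearMap.mkContinuous
    { toFun := fun f => ⟨fun k => f (g k), memℓp_comp hg f⟩
      map_add' := fun _ _ => rfl
      map_smul' := fun _ _ => rfl } 1 fun f => by
    have hf := lp.hasSum_norm (p := 2) (by norm_num) f
    have hk := lp.hasSum_norm (p := 2) (by norm_num)
      (⟨fun k => f (g k), memℓp_comp hg f⟩ : L2 κ)
    simp only [ENNReal.toReal_ofNat, Real.rpow_two] at hf hk
    rw [one_mul]
    refine le_of_sq_le_sq ?_ (norm_nonneg _)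
    exact hasSum_le_inj g hg (fun _ _ => by positivity) (fun _ => le_rfl) hk hf

@[simp] lemma pull_apply (g : κ → ι) (hg) (f : L2 ι) (k : κ) : pull g hg f k = f (g k) := rfl

end NCG

namespace Podles

open NCG

variable {n : ℤ} {q s : ℝ}

/-! ## The Hilbert space inside the lattice -/

/-- The lattice label of an admissible label. -/
def lab (n : ℤ) (i : ℤˣ × Idx n) : Lat := (i.1, i.2.1.1, i.2.1.2)

lemma lab_injective (n : ℤ) : Function.Injective (lab n) := by
  rintro ⟨ε, ⟨⟨L, M⟩, h⟩⟩ ⟨ε', ⟨⟨L', M'⟩, h'⟩⟩ heq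
  simp only [lab, Prod.mk.injEq] at heq
  obtain ⟨rfl, rfl, rfl⟩ := heq
  rfl

/-- Restriction to the admissible labels. -/
def res (n : ℤ) : L2 Lat →L[ℂ] Hilb n := pull (lab n) (lab_injective n)

/-- Extension by zero. -/
def ext (n : ℤ) : Hilb n →L[ℂ] L2 Lat := ContinuousLinearMap.adjoint (res n)

lemma res_apply (f : L2 Lat) (i : ℤˣ × Idx n) : res n f i = f (lab n i) := rfl

lemma ket_of {ε : ℤˣ} {L M : ℤ} (h : hilbAdm n L M) : ket n ε L M = bv (ε, ⟨(L, M), h⟩) := by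
  unfold ket bv
  refine (dif_pos (show (∃ k : ℕ, L - |n| = 2 * k) ∧ (∃ k : ℕ, L - |M| = 2 * k) from h)).trans ?_
  congr
  exact Subsingleton.elim _ _

lemma ket_of_not {ε : ℤˣ} {L M : ℤ} (h : ¬ hilbAdm n L M) : ket n ε L M = 0 :=
  dif_neg h

lemma bv_eq_ket (i : ℤˣ × Idx n) : bv i = ket n i.1 i.2.1.1 i.2.1.2 :=
  (ket_of (n := n) (ε := i.1) i.2.2).symm

lemma res_bv (ε : ℤˣ) (L M : ℤ) : res n (bv (ε, L, M)) = ket n ε L M := by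
  by_cases h : hilbAdm n L M
  · rw [ket_of h]
    ext ⟨δ, p⟩
    have hlab : lab n (δ, p) = (ε, L, M) ↔ (δ, p) = (ε, (⟨(L, M), h⟩ : Idx n)) := by
      rw [← (lab_injective n).eq_iff]
      rfl
    rw [res_apply, bv_apply, bv_apply]
    simp only [hlab]
    congr
  · rw [ket_of_not h]
    ext ⟨δ, ⟨⟨L', M'⟩, h'⟩⟩
    rw [res_apply, bv_ne]
    · rfl
    · rintro heq
      simp only [lab, Prod.mk.injEq] at heq
      obtain ⟨-, rfl, rfl⟩ := heq
      exact h h'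

lemma ext_apply (f : Hilb n) (ε : ℤˣ) (L M : ℤ) : ext n f (ε, L, M) = ⟪ket n ε L M, f⟫_ℂ := by
  rw [← inner_bv_left, ext, ContinuousLinearMap.adjoint_inner_right, res_bv]

lemma ext_apply_of {ε : ℤˣ} {L M : ℤ} (f : Hilb n) (h : hilbAdm n L M) :
    ext n f (ε, L, M) = f (ε, ⟨(L, M), h⟩) := by
  rw [ext_apply, ket_of h, inner_bv_left]

lemma ext_apply_of_not {ε : ℤˣ} {L M : ℤ} (f : Hilb n) (h : ¬ hilbAdm n L M) :
    ext n f (ε, L, M) = 0 := by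
  rw [ext_apply, ket_of_not h, inner_zero_left]

lemma res_ext (f : Hilb n) : res n (ext n f) = f := by
  ext ⟨ε, ⟨⟨L, M⟩, h⟩⟩
  rw [res_apply]
  exact ext_apply_of f h

lemma ext_res {f : L2 Lat} (hf : ∀ ε L M, ¬ hilbAdm n L M → f (ε, L, M) = 0) :
    ext n (res n f) = f := by
  ext ⟨ε, L, M⟩
  by_cases h : hilbAdm n L M
  · rw [ext_apply_of _ h]
    rfl
  · rw [ext_apply_of_not _ h, hf _ _ _ h]

lemma ext_ket {ε : ℤˣ} {L M : ℤ} (h : hilbAdm n L M) : ext n (ket n ε L M) = bv (ε, L, M) := by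
  rw [← res_bv, ext_res]
  intro ε' L' M' h'
  refine bv_ne ?_
  rintro heq
  simp only [Prod.mk.injEq] at heq
  obtain ⟨-, rfl, rfl⟩ := heq
  exact h' h

lemma flip_res (f : L2 Lat) : flip n (res n f) = res n (sflip (-1) f) := by
  ext ⟨ε, p⟩
  rw [res_apply, sflip_apply]
  simp [flip, signedPerm, lab, res, LinearMap.mkContinuous_apply]

lemma ext_flip (f : Hilb n) : ext n (flip n f) = sflip (-1) (ext n f) := by
  conv_lhs => rw [← res_ext f]
  rw [flip_res, ext_res]
  intro ε L M h
  rw [sflip_apply, sgn_apply, ext_apply_of_not _ h]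

lemma grading_apply (f : Hilb n) (i : ℤˣ × Idx n) :
    grading n f i = (-((i.1 : ℤ) : ℂ)) * f i := by
  simp [grading, signedPerm, LinearMap.mkContinuous_apply]

/-! ## The representation -/

section Rep

variable (hq : 0 < q) (hq1 : q < 1) (s n)

/-- The operator `VW` compressed to the Hilbert space. -/
def blk (n : ℤ) (V W : L2 Lat →L[ℂ] L2 Lat) : Hilb n →L[ℂ] Hilb n :=
  res n ∘L V ∘L W ∘L ext n

lemma blk_apply (V W : L2 Lat →L[ℂ] L2 Lat) (f : Hilb n) :
    blk n V W f = res n (V (W (ext n f))) := rfl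

lemma star_blk (V W : L2 Lat →L[ℂ] L2 Lat) : star (blk n V W) =
    blk n (ContinuousLinearMap.adjoint W) (ContinuousLinearMap.adjoint V) := by
  rw [ContinuousLinearMap.star_eq_adjoint, blk, ContinuousLinearMap.adjoint_comp,
    ContinuousLinearMap.adjoint_comp, ContinuousLinearMap.adjoint_comp, ext,
    ContinuousLinearMap.adjoint_adjoint]
  rfl

lemma adjoint_v₁ : ContinuousLinearMap.adjoint (v₁ n s hq hq1) = w₁ n s hq hq1 :=
  ContinuousLinearMap.adjoint_adjoint _

lemma adjoint_v₂ : ContinuousLinearMap.adjoint (v₂ n s hq hq1) = w₂ n s hq hq1 :=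
  ContinuousLinearMap.adjoint_adjoint _

lemma ext_res_v₁ (f : L2 Lat) : ext n (res n (v₁ n s hq hq1 f)) = v₁ n s hq hq1 f :=
  ext_res fun _ _ _ h => v₁_support n s hq hq1 f h

lemma ext_res_v₂ (f : L2 Lat) : ext n (res n (v₂ n s hq hq1 f)) = v₂ n s hq hq1 f :=
  ext_res fun _ _ _ h => v₂_support n s hq hq1 f h

lemma sflip_one (f : L2 Lat) : sflip 1 f = f := by
  ext ⟨ε, L, M⟩
  rw [sflip_apply, sgn_apply, one_mul]

lemma wv_eq_self {f : L2 Lat} (hf : ∀ i, ¬ auxAdm n i → f i = 0) :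
    w₁ n s hq hq1 (v₁ n s hq hq1 f) + (q : ℂ) ^ 2 • w₂ n s hq hq1 (v₂ n s hq hq1 f) = f := by
  ext i
  have h := wv_apply n s hq hq1 1 f i
  rw [sflip_one, sflip_one, dg_one hq hq1] at h
  rw [lp.coeFn_add, Pi.add_apply, lp.coeFn_smul, Pi.smul_apply, smul_eq_mul, h]
  have hs : sgn 1 i = i := by
    obtain ⟨ε, L, M⟩ := i
    simp
  rw [hs]
  split_ifs with h'
  · simp
  · simp [hf i h']

/-- The four choices of `V` and `W` are the four entries of the equation `e² = e` for `e = v w`. The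
support of `v` allows `ext ∘ res` to be dropped between the factors, and `wv ` is the identity on
the support of `W`. -/
lemma blk_mul_blk (V : L2 Lat →L[ℂ] L2 Lat) {W : L2 Lat →L[ℂ] L2 Lat}
    (hW : ∀ f i, ¬ auxAdm n i → W f i = 0) :
    blk n V (w₁ n s hq hq1) * blk n (v₁ n s hq hq1) W +
      (q : ℂ) ^ 2 • (blk n V (w₂ n s hq hq1) * blk n (v₂ n s hq hq1) W) = blk n V W := by
  refine ContinuousLinearMap.ext fun f => ?_
  simp only [add_apply, smul_apply, mul_apply_eq_comp, blk_apply, ext_res_v₁, ext_res_v₂]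
  rw [← map_smul, ← map_smul, ← map_add, ← map_add, wv_eq_self n s hq hq1 (hW _)]

/-- The relation beyond idempotency that ties the two diagonal entries together. It needs `l > 0`,
which `n ≠ 0` ensures. -/
lemma blk_trace (hn : n ≠ 0) :
    ((1 + (s : ℂ) ^ 2) * (q : ℂ) ^ 2) • (blk n (v₁ n s hq hq1) (w₁ n s hq hq1) +
      blk n (v₂ n s hq hq1) (w₂ n s hq hq1)) =
      (1 + (q : ℂ) ^ 2 * (s : ℂ) ^ 2) • (1 : Hilb n →L[ℂ] Hilb n) := by
  refine ContinuousLinearMap.ext fun f => ?_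
  ext ⟨ε, ⟨⟨L, M⟩, h⟩⟩
  have := vw_trace n s hq hq1 hn (ext n f) (fun ε L M h => ext_apply_of_not f h) (ε := ε) h
  rw [ext_apply_of f h] at this
  exact this

/-- The values of the representation on the generators. -/
def repGen : Gen → Hilb n →L[ℂ] Hilb n
  | .A => (1 + (s : ℂ) ^ 2) • blk n (v₁ n s hq hq1) (w₁ n s hq hq1) - (s : ℂ) ^ 2 • 1
  | .B => ((1 + (s : ℂ) ^ 2) * q) • blk n (v₁ n s hq hq1) (w₂ n s hq hq1)
  | .Bs => ((1 + (s : ℂ) ^ 2) * q) • blk n (v₂ n s hq hq1) (w₁ n s hq hq1)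

lemma star_repGen (g : Gen) : star (repGen n s hq hq1 g) = repGen n s hq hq1 g.adj := by
  cases g <;> simp [repGen, Gen.adj, star_blk, adjoint_v₁, adjoint_v₂] <;> rfl

end Rep

/-! ### The relations of the sphere from an idempotent matrix -/

section Abstract

variable {R : Type*} [Ring R] [Algebra ℂ R] {q s : ℂ} {a b c d : R}

/-- The defining relations, for generators built from an idempotent matrix. -/
lemma relations_of_idem (h11 : a * a + q ^ 2 • (b * c) = a) (h12 : a * b + q ^ 2 • (b * d) = b)
    (h21 : c * a + q ^ 2 • (d * c) = c) (h22 : c * b + q ^ 2 • (d * d) = d)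
    (ht : ((1 + s ^ 2) * q ^ 2) • (a + d) = (1 + q ^ 2 * s ^ 2) • (1 : R))
    {A B C : R} (hA : A = (1 + s ^ 2) • a - s ^ 2 • (1 : R)) (hB : B = ((1 + s ^ 2) * q) • b)
    (hC : C = ((1 + s ^ 2) * q) • c) :
    A * B = q ^ 2 • (B * A) ∧ C * A = q ^ 2 • (A * C) ∧
      B * C + (A + s ^ 2 • (1 : R)) * (A - 1) = 0 ∧
      C * B + (q ^ 2 • A + s ^ 2 • (1 : R)) * (q ^ 2 • A - 1) = 0 := by
  -- The trace relation expresses the second diagonal entry by `A`. The four entries of the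
  -- idempotent equation then become, up to scalars, the four defining relations.
  have hd : ((1 + s ^ 2) * q ^ 2) • d = 1 - q ^ 2 • A := by
    rw [smul_add] at ht
    rw [eq_sub_of_add_eq' ht]
    rw [hA]
    module
  have ha : (1 + s ^ 2) • a = A + s ^ 2 • (1 : R) := by simp [hA]
  refine ⟨?_, ?_, ?_, ?_⟩
  · have h := congrArg (fun x => ((1 + s ^ 2) * ((1 + s ^ 2) * q)) • x) h12
    have e1 : ((1 + s ^ 2) * ((1 + s ^ 2) * q)) • (a * b + q ^ 2 • (b * d)) =
        ((1 + s ^ 2) • a) * B + B * (((1 + s ^ 2) * q ^ 2) • d) := by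
      simp only [hB, smul_mul_assoc, mul_smul_comm, smul_smul, smul_add]
      module
    have e2 : ((1 + s ^ 2) * ((1 + s ^ 2) * q)) • b = (1 + s ^ 2) • B := by
      simp only [hB, smul_smul]
    beta_reduce at h
    rw [e1, e2, hd, ha] at h
    simp only [add_mul, mul_sub, mul_one, smul_mul_assoc, one_mul,
      mul_smul_comm] at h
    rw [← sub_eq_zero] at h ⊢
    rw [← h]
    module
  · have h := congrArg (fun x => ((1 + s ^ 2) * ((1 + s ^ 2) * q)) • x) h21
    have e1 : ((1 + s ^ 2) * ((1 + s ^ 2) * q)) • (c * a + q ^ 2 • (d * c)) =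
        C * ((1 + s ^ 2) • a) + (((1 + s ^ 2) * q ^ 2) • d) * C := by
      simp only [hC, smul_mul_assoc, mul_smul_comm, smul_smul, smul_add]
      module
    have e2 : ((1 + s ^ 2) * ((1 + s ^ 2) * q)) • c = (1 + s ^ 2) • C := by
      simp only [hC, smul_smul]
    beta_reduce at h
    rw [e1, e2, hd, ha] at h
    simp only [mul_add, sub_mul, mul_one, smul_mul_assoc, one_mul,
      mul_smul_comm] at h
    rw [← sub_eq_zero] at h ⊢
    rw [← h]
    module
  · have h := congrArg (fun x => ((1 + s ^ 2) * (1 + s ^ 2)) • x) h11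
    have e1 : ((1 + s ^ 2) * (1 + s ^ 2)) • (a * a + q ^ 2 • (b * c)) =
        ((1 + s ^ 2) • a) * ((1 + s ^ 2) • a) + B * C := by
      simp only [hB, hC, smul_mul_assoc, mul_smul_comm, smul_smul, smul_add]
      module
    have e2 : ((1 + s ^ 2) * (1 + s ^ 2)) • a = (1 + s ^ 2) • ((1 + s ^ 2) • a) := by
      simp only [smul_smul]
    beta_reduce at h
    rw [e1, e2, ha] at h
    simp only [mul_add, add_mul, mul_one, smul_mul_assoc, one_mul,
      mul_smul_comm, mul_sub] at h ⊢
    rw [← sub_eq_zero] at h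
    rw [← h]
    module
  · have h := congrArg (fun x => (((1 + s ^ 2) * q) * ((1 + s ^ 2) * q)) • x) h22
    have e1 : (((1 + s ^ 2) * q) * ((1 + s ^ 2) * q)) • (c * b + q ^ 2 • (d * d)) =
        C * B + (((1 + s ^ 2) * q ^ 2) • d) * (((1 + s ^ 2) * q ^ 2) • d) := by
      simp only [hB, hC, smul_mul_assoc, mul_smul_comm, smul_smul, smul_add]
      module
    have e2 : (((1 + s ^ 2) * q) * ((1 + s ^ 2) * q)) • d =
        (1 + s ^ 2) • (((1 + s ^ 2) * q ^ 2) • d) := by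
      simp only [smul_smul]
      module
    beta_reduce at h
    rw [e1, e2, hd] at h
    simp only [add_mul, mul_one, smul_mul_assoc, one_mul,
      mul_smul_comm, mul_sub, sub_mul] at h ⊢
    rw [← sub_eq_zero] at h
    rw [← h]
    module

end Abstract

section Rep

variable (hq : 0 < q) (hq1 : q < 1) (s n)

lemma repGen_rel (hn : n ≠ 0) :
    repGen n s hq hq1 .A * repGen n s hq hq1 .B =
      (q : ℂ) ^ 2 • (repGen n s hq hq1 .B * repGen n s hq hq1 .A) ∧
    repGen n s hq hq1 .Bs * repGen n s hq hq1 .A =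
      (q : ℂ) ^ 2 • (repGen n s hq hq1 .A * repGen n s hq hq1 .Bs) ∧
    repGen n s hq hq1 .B * repGen n s hq hq1 .Bs + (repGen n s hq hq1 .A + (s : ℂ) ^ 2 • 1) *
      (repGen n s hq hq1 .A - 1) = 0 ∧
    repGen n s hq hq1 .Bs * repGen n s hq hq1 .B +
      ((q : ℂ) ^ 2 • repGen n s hq hq1 .A + (s : ℂ) ^ 2 • 1) *
        ((q : ℂ) ^ 2 • repGen n s hq hq1 .A - 1) = 0 := by
  have hw₁ : ∀ f i, ¬ auxAdm n i → w₁ n s hq hq1 f i = 0 := fun f i => w₁_support n s hq hq1 f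
  have hw₂ : ∀ f i, ¬ auxAdm n i → w₂ n s hq hq1 f i = 0 := fun f i => w₂_support n s hq hq1 f
  exact relations_of_idem
    (blk_mul_blk n s hq hq1 _ hw₁) (blk_mul_blk n s hq hq1 _ hw₂)
    (blk_mul_blk n s hq hq1 _ hw₁) (blk_mul_blk n s hq hq1 _ hw₂) (blk_trace n s hq hq1 hn) rfl rfl rfl

/-- The representation, as a morphism of algebras. -/
def repHom (hn : n ≠ 0) : Alg q s →ₐ[ℂ] (Hilb n →L[ℂ] Hilb n) :=
  lift (repGen n s hq hq1) (repGen_rel n s hq hq1 hn).1 (repGen_rel n s hq hq1 hn).2.1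
    (repGen_rel n s hq hq1 hn).2.2.1 (repGen_rel n s hq hq1 hn).2.2.2

/-- The representation of the coordinate algebra. -/
def rep (hn : n ≠ 0) : Alg q s →⋆ₐ[ℂ] (Hilb n →L[ℂ] Hilb n) where
  toAlgHom := repHom n s hq hq1 hn
  map_star' a := by
    change repHom n s hq hq1 hn (star a) = star (repHom n s hq hq1 hn a)
    induction a using alg_induction with
    | h_scalar z => rw [star_scalar, AlgHom.commutes, AlgHom.commutes, ← algebraMap_star_comm]; rfl
    | h_gen g => rw [star_gen, repHom, lift_gen, lift_gen, star_repGen]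
    | h_mul a b ha hb => rw [star_mul, map_mul, ha, hb, map_mul, star_mul]
    | h_add a b ha hb => rw [star_add, map_add, ha, hb, map_add, star_add]

lemma rep_gen (hn : n ≠ 0) (g : Gen) : rep n s hq hq1 hn (gen q s g) = repGen n s hq hq1 g :=
  lift_gen (repGen n s hq hq1) (repGen_rel n s hq hq1 hn).1 (repGen_rel n s hq hq1 hn).2.1
    (repGen_rel n s hq hq1 hn).2.2.1 (repGen_rel n s hq hq1 hn).2.2.2 g

end Rep

end Podles

end

noncomputable section

namespace Podles

open NCG

variable {n : ℤ} {q s : ℝ}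

/-! ## The formulas on basis vectors -/

section Formulas

variable (hq : 0 < q) (hq1 : q < 1) (s n)

lemma w₁_bv (ε : ℤˣ) (L M : ℤ) : w₁ n s hq hq1 (bv (ε, L, M)) =
    (wt n (cP q s) (ε, L - 1, M - 1) : ℂ) • bv (ε, L - 1, M - 1) +
      (wt n (cR q s) (ε, L + 1, M - 1) : ℂ) • bv (ε, L + 1, M - 1) := by
  rw [w₁, add_apply, wperm_bv, wperm_bv]
  simp [sub_eq_add_neg]

lemma w₂_bv (ε : ℤˣ) (L M : ℤ) : w₂ n s hq hq1 (bv (ε, L, M)) =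
    (wt n (cP' q s) (ε, L - 1, M + 1) : ℂ) • bv (ε, L - 1, M + 1) +
      (wt n (cR' q s) (ε, L + 1, M + 1) : ℂ) • bv (ε, L + 1, M + 1) := by
  rw [w₂, add_apply, wperm_bv, wperm_bv]
  simp [sub_eq_add_neg]

lemma v₁_bv (ε : ℤˣ) (J M : ℤ) : v₁ n s hq hq1 (bv (ε, J, M)) =
    (wt n (cP q s) (ε, J, M) : ℂ) • bv (ε, J + 1, M + 1) +
      (wt n (cR q s) (ε, J, M) : ℂ) • bv (ε, J - 1, M + 1) := by
  rw [v₁, w₁, map_add, adjoint_wperm, adjoint_wperm, add_apply, wperm_bv, wperm_bv]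
  simp [sub_eq_add_neg]

lemma v₂_bv (ε : ℤˣ) (J M : ℤ) : v₂ n s hq hq1 (bv (ε, J, M)) =
    (wt n (cP' q s) (ε, J, M) : ℂ) • bv (ε, J + 1, M - 1) +
      (wt n (cR' q s) (ε, J, M) : ℂ) • bv (ε, J - 1, M - 1) := by
  rw [v₂, w₂, map_add, adjoint_wperm, adjoint_wperm, add_apply, wperm_bv, wperm_bv]
  simp [sub_eq_add_neg]

lemma blk₁₁_ket {ε : ℤˣ} {L M : ℤ} (h : hilbAdm n L M) :
    blk n (v₁ n s hq hq1) (w₁ n s hq hq1) (ket n ε L M) =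
      ((wt n (cP q s) (ε, L + 1, M - 1) * wt n (cR q s) (ε, L + 1, M - 1) : ℝ) : ℂ) •
        ket n ε (L + 2) M +
      ((wt n (cP q s) (ε, L - 1, M - 1) ^ 2 + wt n (cR q s) (ε, L + 1, M - 1) ^ 2 : ℝ) : ℂ) •
        ket n ε L M +
      ((wt n (cP q s) (ε, L - 1, M - 1) * wt n (cR q s) (ε, L - 1, M - 1) : ℝ) : ℂ) •
        ket n ε (L - 2) M := by
  rw [blk_apply, ext_ket h, w₁_bv]
  simp only [map_add, map_smul, v₁_bv, res_bv]
  rw [show L + 1 - 1 = L by ring, show L - 1 + 1 = L by ring, show M - 1 + 1 = M by ring,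
    show L + 1 + 1 = L + 2 by ring, show L - 1 - 1 = L - 2 by ring]
  push_cast
  module

lemma blk₁₂_ket {ε : ℤˣ} {L M : ℤ} (h : hilbAdm n L M) :
    blk n (v₁ n s hq hq1) (w₂ n s hq hq1) (ket n ε L M) =
      ((wt n (cP q s) (ε, L + 1, M + 1) * wt n (cR' q s) (ε, L + 1, M + 1) : ℝ) : ℂ) •
        ket n ε (L + 2) (M + 2) +
      ((wt n (cP q s) (ε, L - 1, M + 1) * wt n (cP' q s) (ε, L - 1, M + 1) +
        wt n (cR q s) (ε, L + 1, M + 1) * wt n (cR' q s) (ε, L + 1, M + 1) : ℝ) : ℂ) •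
        ket n ε L (M + 2) +
      ((wt n (cR q s) (ε, L - 1, M + 1) * wt n (cP' q s) (ε, L - 1, M + 1) : ℝ) : ℂ) •
        ket n ε (L - 2) (M + 2) := by
  rw [blk_apply, ext_ket h, w₂_bv]
  simp only [map_add, map_smul, v₁_bv, res_bv]
  rw [show L + 1 - 1 = L by ring, show L - 1 + 1 = L by ring, show M + 1 + 1 = M + 2 by ring,
    show L + 1 + 1 = L + 2 by ring, show L - 1 - 1 = L - 2 by ring]
  push_cast
  module

lemma blk₂₁_ket {ε : ℤˣ} {L M : ℤ} (h : hilbAdm n L M) :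
    blk n (v₂ n s hq hq1) (w₁ n s hq hq1) (ket n ε L M) =
      ((wt n (cR q s) (ε, L + 1, M - 1) * wt n (cP' q s) (ε, L + 1, M - 1) : ℝ) : ℂ) •
        ket n ε (L + 2) (M - 2) +
      ((wt n (cP q s) (ε, L - 1, M - 1) * wt n (cP' q s) (ε, L - 1, M - 1) +
        wt n (cR q s) (ε, L + 1, M - 1) * wt n (cR' q s) (ε, L + 1, M - 1) : ℝ) : ℂ) •
        ket n ε L (M - 2) +
      ((wt n (cP q s) (ε, L - 1, M - 1) * wt n (cR' q s) (ε, L - 1, M - 1) : ℝ) : ℂ) •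
        ket n ε (L - 2) (M - 2) := by
  rw [blk_apply, ext_ket h, w₁_bv]
  simp only [map_add, map_smul, v₂_bv, res_bv]
  rw [show L + 1 - 1 = L by ring, show L - 1 + 1 = L by ring, show M - 1 - 1 = M - 2 by ring,
    show L + 1 + 1 = L + 2 by ring, show L - 1 - 1 = L - 2 by ring]
  push_cast
  module

/-- Coefficients have to be compared only when the target label is admissible, since otherwise the
vector is zero. This is what supplies the bounds on `l` and `m` used below. -/
lemma smul_ket_congr {ε : ℤˣ} {L M : ℤ} {a b : ℂ} (h : hilbAdm n L M → a = b) :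
    a • ket n ε L M = b • ket n ε L M := by
  by_cases h' : hilbAdm n L M
  · rw [h h']
  · rw [ket_of_not h', smul_zero, smul_zero]

lemma neg_q_smul_xm₁ (hq : 0 < q) : -((q : ℂ) • xm₁ q s) = (√(1 + q ^ 2) : ℂ) • gen q s .Bs := by
  have : (q : ℂ) ≠ 0 := Complex.ofReal_ne_zero.2 hq.ne'
  rw [xm₁, x₁, star_smul, star_gen, smul_neg, neg_neg, smul_smul, mul_inv_cancel₀ this, one_smul]
  simp [Gen.adj]

lemma isPodlesRep_rep (hn : n ≠ 0) : IsPodlesRep n (rep n s hq hq1 hn) where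
  x₁_ket := by
    rintro ε ⟨p, h⟩ L M l m hp rfl rfl
    dsimp only at hp
    subst hp
    replace h : hilbAdm n L M := h
    obtain ⟨h1, h2⟩ := h.bounds ε
    rw [x₁, map_smul, rep_gen, repGen, smul_apply, smul_apply, blk₁₂_ket n s hq hq1 h]
    simp only [smul_add, smul_smul]
    congr 1
    · congr 1
      · refine smul_ket_congr n fun _ => ?_
        rw [h.wt_up ε (.inl rfl), h.wt_up ε (.inl rfl)]
        rw [← cP_mul_cR' hq hq1 h1 h2]
        push_cast
        ring
      · refine smul_ket_congr n fun h' => ?_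
        -- The coefficient at the intermediate label `(L-1, M+1)` is read off from the admissible
        -- target `(L, M+2)`, since `hilbAdm.wt_cP` looks from `l` down and to the left in `m`.
        have e := h'.wt_cP (q := q) (s := s) ε
        rw [show M + 2 - 1 = M + 1 by ring] at e
        rw [h.wt_up ε (.inl rfl), h.wt_up ε (.inl rfl), h.wt_cP', e,
          ← Bzero_eq hq hq1 (h.one_le hn) h1 h2]
        push_cast
        rw [show ((M : ℝ) + 2) / 2 - 1 / 2 = M / 2 + 1 / 2 by ring]
        ring
    · refine smul_ket_congr n fun h' => ?_
      have e := h'.wt_up (b := -1) ε (.inr rfl) (cR q s)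
      rw [show M + 2 + -1 = M + 1 by ring, show L - 2 + 1 = L - 1 by ring] at e
      obtain ⟨h3, h4⟩ := h'.bounds ε
      have h5 := (abs_le.1 h3).2
      -- The target spin `l - 1` is admissible, hence at least `1/2`.
      have h6 : 1 ≤ (L : ℝ) / 2 := by
        have := h'.one_le hn
        push_cast at this
        linarith
      push_cast at h5
      rw [h.wt_cP', e, ← cR_mul_cP' hq hq1 h6 (by linarith) h2]
      push_cast
      rw [show ((M : ℝ) + 2) / 2 + -1 / 2 = M / 2 + 1 / 2 by ring,
        show ((L : ℝ) - 2) / 2 + 1 / 2 = L / 2 - 1 / 2 by ring]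
      ring
  x₀_ket := by
    rintro ε ⟨p, h⟩ L M l m hp rfl rfl
    dsimp only at hp
    subst hp
    replace h : hilbAdm n L M := h
    obtain ⟨h1, h2⟩ := h.bounds ε
    rw [x₀, map_add, map_neg, map_smul, map_smul, map_one, rep_gen, repGen]
    simp only [add_apply, neg_apply, smul_apply, sub_apply, one_apply_eq_self,
      blk₁₁_ket n s hq hq1 h]
    have c1 : ((Aplus q s (spin n ε) (L / 2) (M / 2) : ℝ) : ℂ) • ket n ε (L + 2) M =
        (-((1 + (q : ℂ) ^ 2) * (1 + (s : ℂ) ^ 2) * ((wt n (cP q s) (ε, L + 1, M - 1) *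
          wt n (cR q s) (ε, L + 1, M - 1) : ℝ) : ℂ))) • ket n ε (L + 2) M := by
      refine smul_ket_congr n fun _ => ?_
      rw [sub_eq_add_neg M, h.wt_up ε (.inr rfl), h.wt_up ε (.inr rfl),
        ← cP_mul_cR hq hq1 h1 h2]
      push_cast
      ring_nf
    have c2 : ((Azero q s (spin n ε) (L / 2) (M / 2) : ℝ) : ℂ) =
        -((1 + (q : ℂ) ^ 2) * ((1 + (s : ℂ) ^ 2) * ((wt n (cP q s) (ε, L - 1, M - 1) ^ 2 +
          wt n (cR q s) (ε, L + 1, M - 1) ^ 2 : ℝ) : ℂ) - (s : ℂ) ^ 2)) + (1 - (s : ℂ) ^ 2) := by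
      rw [h.wt_cP, sub_eq_add_neg M, h.wt_up ε (.inr rfl),
        ← Azero_eq hq hq1 (h.one_le hn) h1 h2]
      push_cast
      ring_nf
    have c3 : ((Aplus q s (spin n ε) (L / 2 - 1) (M / 2) : ℝ) : ℂ) • ket n ε (L - 2) M =
        (-((1 + (q : ℂ) ^ 2) * (1 + (s : ℂ) ^ 2) * ((wt n (cP q s) (ε, L - 1, M - 1) *
          wt n (cR q s) (ε, L - 1, M - 1) : ℝ) : ℂ))) • ket n ε (L - 2) M := by
      refine smul_ket_congr n fun h' => ?_
      have e := fun f => h'.wt_up (b := -1) ε (.inr rfl) f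
      rw [show L - 2 + 1 = L - 1 by ring] at e
      obtain ⟨h3, h4⟩ := h'.bounds ε
      rw [show ((L - 2 : ℤ) : ℝ) / 2 = L / 2 - 1 by push_cast; ring] at h3 h4 e
      rw [sub_eq_add_neg M, e, e, ← cP_mul_cR hq hq1 h3 h4]
      push_cast
      ring_nf
    rw [c1, c2, c3]
    module
  xm₁_ket := by
    rintro ε ⟨p, h⟩ L M l m hp rfl rfl
    dsimp only at hp
    subst hp
    replace h : hilbAdm n L M := h
    obtain ⟨h1, h2⟩ := h.bounds ε
    rw [neg_q_smul_xm₁ s hq, map_smul, rep_gen, repGen, smul_apply, smul_apply,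
      blk₂₁_ket n s hq hq1 h]
    simp only [smul_add, smul_smul]
    congr 1
    · congr 1
      · refine smul_ket_congr n fun h' => ?_
        obtain ⟨h3, h4⟩ := h'.bounds ε
        have h5 := (abs_le.1 h1).2
        have h6 := h.one_le hn
        push_cast at h4
        rw [sub_eq_add_neg M, h.wt_up ε (.inr rfl), h.wt_up ε (.inr rfl),
          ← cR_mul_cP' hq hq1 (by linarith) (by linarith) (by linarith)]
        push_cast
        ring_nf
      · refine smul_ket_congr n fun h' => ?_
        have e := h'.wt_cP' (q := q) (s := s) ε
        rw [show M - 2 + 1 = M - 1 by ring] at e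
        obtain ⟨h3, h4⟩ := h'.bounds ε
        rw [show ((M - 2 : ℤ) : ℝ) / 2 = M / 2 - 1 by push_cast; ring] at h3 e
        rw [h.wt_cP, e, sub_eq_add_neg M, h.wt_up ε (.inr rfl), h.wt_up ε (.inr rfl),
          ← Bzero_eq hq hq1 (h.one_le hn) h3 h2]
        push_cast
        ring_nf
    · refine smul_ket_congr n fun h' => ?_
      have e := fun f => h'.wt_up (b := 1) ε (.inl rfl) f
      rw [show M - 2 + 1 = M - 1 by ring, show L - 2 + 1 = L - 1 by ring] at e
      obtain ⟨h3, h4⟩ := h'.bounds ε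
      rw [show ((M - 2 : ℤ) : ℝ) / 2 = M / 2 - 1 by push_cast; ring,
        show ((L - 2 : ℤ) : ℝ) / 2 = L / 2 - 1 by push_cast; ring] at h3 e
      rw [show ((L - 2 : ℤ) : ℝ) / 2 = L / 2 - 1 by push_cast; ring] at h4
      rw [e, e, ← cP_mul_cR' hq hq1 h3 h4]
      push_cast
      ring_nf

end Formulas

/-! ## Uniqueness -/

lemma hilb_ext {S T : Hilb n →L[ℂ] Hilb n}
    (h : ∀ (ε : ℤˣ) (p : Idx n), S (ket n ε p.1.1 p.1.2) = T (ket n ε p.1.1 p.1.2)) : S = T := by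
  refine clm_ext fun i => ?_
  rw [bv_eq_ket]
  exact h i.1 i.2

lemma gen_A_eq (q s : ℝ) : gen q s .A =
    (1 + (q : ℂ) ^ 2)⁻¹ • ((1 - (s : ℂ) ^ 2) • (1 : Alg q s) - x₀ q s) := by
  have : (1 + (q : ℂ) ^ 2) ≠ 0 := by
    norm_cast
    positivity
  rw [eq_inv_smul_iff₀ this, x₀]
  abel

lemma sqrt_ne (q : ℝ) : (√(1 + q ^ 2) : ℂ) ≠ 0 :=
  Complex.ofReal_ne_zero.2 (Real.sqrt_pos.2 (by positivity)).ne'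

/-- The formulas fix the images of `x₁` and `x₀` on an orthonormal basis, hence as bounded
operators. `A` is a combination of `1` and `x₀`, `B` is a multiple of `x₁`, and `B*` follows because
both maps preserve `*`. -/
lemma isPodlesRep_unique {π π' : Alg q s →⋆ₐ[ℂ] (Hilb n →L[ℂ] Hilb n)}
    (h : IsPodlesRep n π) (h' : IsPodlesRep n π') : π' = π := by
  have e₁ : π' (x₁ q s) = π (x₁ q s) := hilb_ext fun ε p => by
    rw [h.x₁_ket ε p _ _ _ _ rfl rfl rfl, h'.x₁_ket ε p _ _ _ _ rfl rfl rfl]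
  have e₀ : π' (x₀ q s) = π (x₀ q s) := hilb_ext fun ε p => by
    rw [h.x₀_ket ε p _ _ _ _ rfl rfl rfl, h'.x₀_ket ε p _ _ _ _ rfl rfl rfl]
  have hB : gen q s .B = (√(1 + q ^ 2) : ℂ)⁻¹ • x₁ q s := by
    rw [x₁, inv_smul_smul₀ (sqrt_ne q)]
  have hBs : gen q s .Bs = star (gen q s .B) := (star_gen .B).symm
  have hg : ∀ g, π' (gen q s g) = π (gen q s g) := by
    intro g
    cases g with
    | A => rw [gen_A_eq, map_smul, map_sub, map_smul, map_one, e₀, map_smul, map_sub, map_smul,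
        map_one]
    | B => rw [hB, map_smul, map_smul, e₁]
    | Bs => rw [hBs, map_star, map_star, hB, map_smul, map_smul, e₁]
  refine StarAlgHom.ext fun a => ?_
  induction a using alg_induction with
  | h_scalar z => rw [AlgHomClass.commutes, AlgHomClass.commutes]
  | h_gen g => exact hg g
  | h_mul a b ha hb => rw [map_mul, map_mul, ha, hb]
  | h_add a b ha hb => rw [map_add, map_add, ha, hb]

end Podles

end

noncomputable section

namespace Podles

variable {q s : ℝ}

/-! ## The invariant idempotent -/

section Idem

lemma one_add_sq_ne_zero (s : ℝ) : (1 + (s : ℂ) ^ 2) ≠ 0 := by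
  norm_cast
  positivity

lemma idem_mul_idem (hq : 0 < q) (s : ℝ) : idem q s * idem q s = idem q s := by
  have hq' : (q : ℂ) ≠ 0 := Complex.ofReal_ne_zero.2 hq.ne'
  have hs := one_add_sq_ne_zero s
  rw [idem, smul_mul_smul_comm]
  generalize hu : (q : ℂ) = u at *
  generalize hv : (s : ℂ) = v at *
  ext i j
  fin_cases i <;> fin_cases j <;>
    simp [gen_AB, gen_BsA, gen_BsB', gen_BBs', mul_add, add_mul, mul_sub, sub_mul,
      hu, hv] <;>
    match_scalars <;> field_simp <;> ring

lemma idem_isInvariant (hq : 0 < q) (s : ℝ) : IsInvariant hq (idem q s) := by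
  have hq' : (q : ℂ) ≠ 0 := Complex.ofReal_ne_zero.2 hq.ne'
  have hs := one_add_sq_ne_zero s
  have hr : (√q : ℂ) ≠ 0 := Complex.ofReal_ne_zero.2 (Real.sqrt_pos.2 hq).ne'
  have hr2 : (√q : ℂ) ^ 2 = q := by exact_mod_cast Real.sq_sqrt hq.le
  have e1 : actE s hq 1 = 0 := by simp [actE]
  have e2 : actF s hq 1 = 0 := by simp [actF]
  constructor
  all_goals
    unfold idem scalarT
    ext i j
    fin_cases i <;> fin_cases j <;>
    simp [-Complex.coe_smul, Matrix.mul_apply, σK, σKinv, σE, σF, actK_gen, actE_gen, actF_gen, valE, valF,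
      e1, e2,
      Algebra.algebraMap_eq_smul_one] <;>
    generalize (q : ℂ) = u at * <;> generalize (s : ℂ) = v at * <;>
    generalize (√q : ℂ) = w at * <;> (try subst hr2) <;>
    match_scalars <;> field_simp <;> (try ring1)

end Idem

end Podles

end

noncomputable section

namespace NCG

/-- A bound on differences of roots that needs no positive lower bound on `x` and `y`. This matters
at `s = 0`, where `Xc` itself is as small as the difference to be estimated. -/
lemma abs_sqrt_sub_sqrt_le {x y : ℝ} (hx : 0 ≤ x) (hy : 0 ≤ y) : |√x - √y| ≤ √|x - y| := by
  wlog h : y ≤ x generalizing x y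
  · rw [abs_sub_comm, abs_sub_comm x]
    exact this hy hx (le_of_not_ge h)
  have h1 := Real.sqrt_le_sqrt h
  rw [abs_of_nonneg (by linarith), abs_of_nonneg (by linarith)]
  refine Real.le_sqrt_of_sq_le ?_
  nlinarith [Real.sq_sqrt hx, Real.sq_sqrt hy, Real.sqrt_nonneg x, Real.sqrt_nonneg y]

end NCG

namespace Podles

open NCG

variable {n : ℤ} {q s : ℝ}

/-! ## Comparison of the coefficients for `N` and `-N` -/

section Decay

lemma br_neg (q x : ℝ) : br q (-x) = -br q x := by
  rw [br, br, neg_neg]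
  ring

lemma br_one (hq : 0 < q) (hq1 : q < 1) : br q 1 = 1 := by
  rw [br, Real.rpow_one, Real.rpow_neg_one]
  exact div_self (q_sub_inv_neg hq hq1).ne

lemma br_le (hq : 0 < q) (hq1 : q < 1) (x : ℝ) : br q x ≤ q ^ (-x) / (q⁻¹ - q) := by
  have h := q_sub_inv_neg hq hq1
  have h1 := Real.rpow_pos_of_pos hq x
  rw [br, ← neg_div_neg_eq, neg_sub, neg_sub]
  exact div_le_div_of_nonneg_right (by linarith) (by linarith)

lemma le_br (hq : 0 < q) (hq1 : q < 1) {x : ℝ} (hx : 1 ≤ x) : q ^ (1 - x) ≤ br q x := by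
  have h := br_combine hq (x - 1) 1
  have h1 := br_nonneg hq hq1 (x := x - 1) (by linarith)
  have h2 := mul_nonneg (Real.rpow_pos_of_pos hq (1 : ℝ)).le h1
  rw [br_one hq hq1, sub_add_cancel, neg_sub] at h
  linarith

lemma inv_br_le (hq : 0 < q) (hq1 : q < 1) {x : ℝ} (hx : 1 ≤ x) : (br q x)⁻¹ ≤ q ^ (x - 1) := by
  rw [show x - 1 = -(1 - x) by ring, Real.rpow_neg hq.le]
  exact inv_anti₀ (Real.rpow_pos_of_pos hq _) (le_br hq hq1 hx)

/-- In the numerator all terms depending on `j` cancel and only `-[2N](1+s²)` remains, so the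
difference decays like `1/([2j+1][2j+2])`. `Yc_sub_Yc` is analogous. -/
lemma Xc_sub_Xc (hq : 0 < q) (hq1 : q < 1) (N : ℝ) {j : ℝ} (hj : 0 ≤ j) :
    Xc q s N j - Xc q s (-N) j = -br q (2 * N) * ((br q (2 * j + 1))⁻¹ * (br q (2 * j + 2))⁻¹) := by
  have b1 := br_pos hq hq1 (x := 2 * j + 1) (by linarith)
  have b2 := br_pos hq hq1 (x := 2 * j + 2) (by linarith)
  have hs : 0 < 1 + s ^ 2 := by positivity
  have hd := (q_sub_inv_neg hq hq1).ne
  have key : br q (j + 1 / 2 - N) * (q ^ (j + 1 / 2 + N) + q ^ (-(j + 1 / 2 + N)) * s ^ 2) -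
      br q (j + 1 / 2 - -N) * (q ^ (j + 1 / 2 + -N) + q ^ (-(j + 1 / 2 + -N)) * s ^ 2) =
      -br q (2 * N) * (1 + s ^ 2) := by
    generalize j + 1 / 2 = a
    have ha := Real.rpow_pos_of_pos hq a
    have hc := Real.rpow_pos_of_pos hq N
    simp only [br, two_mul, neg_add, sub_eq_add_neg, neg_neg, Real.rpow_add hq,
      Real.rpow_neg hq.le]
    rw [← sub_eq_add_neg]
    generalize q ^ a = x at *
    generalize q ^ N = c at *
    field_simp
    ring
  unfold Xc
  rw [← sub_div, key]
  field_simp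

lemma Yc_sub_Yc (hq : 0 < q) (hq1 : q < 1) (N : ℝ) {j : ℝ} (hj : 0 < j) :
    Yc q s N j - Yc q s (-N) j = br q (2 * N) * ((br q (2 * j + 1))⁻¹ * (br q (2 * j))⁻¹) := by
  have b1 := br_pos hq hq1 (x := 2 * j + 1) (by linarith)
  have b2 := br_pos hq hq1 (x := 2 * j) (by linarith)
  have hs : 0 < 1 + s ^ 2 := by positivity
  have hd := (q_sub_inv_neg hq hq1).ne
  have key : br q (j + 1 / 2 + N) * (q ^ (j + 1 / 2 - N) * s ^ 2 + q ^ (-(j + 1 / 2 - N))) -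
      br q (j + 1 / 2 + -N) * (q ^ (j + 1 / 2 - -N) * s ^ 2 + q ^ (-(j + 1 / 2 - -N))) =
      br q (2 * N) * (1 + s ^ 2) := by
    generalize j + 1 / 2 = a
    have ha := Real.rpow_pos_of_pos hq a
    have hc := Real.rpow_pos_of_pos hq N
    simp only [br, two_mul, neg_add, sub_eq_add_neg, neg_neg, Real.rpow_add hq,
      Real.rpow_neg hq.le]
    rw [← sub_eq_add_neg]
    generalize q ^ a = x at *
    generalize q ^ N = c at *
    field_simp
    ring
  unfold Yc
  rw [← sub_div, key]
  field_simp

lemma abs_Xc_sub_le (hq : 0 < q) (hq1 : q < 1) (N : ℝ) {j : ℝ} (hj : 1 / 2 ≤ j) :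
    |Xc q s N j - Xc q s (-N) j| ≤ |br q (2 * N)| * q ^ (4 * j - 1) := by
  have b1 := br_pos hq hq1 (x := 2 * j + 1) (by linarith)
  have b2 := br_pos hq hq1 (x := 2 * j + 2) (by linarith)
  rw [Xc_sub_Xc hq hq1 N (by linarith), abs_mul, abs_neg]
  refine mul_le_mul_of_nonneg_left ?_ (abs_nonneg _)
  rw [abs_of_nonneg (by positivity)]
  have h := mul_le_mul (inv_br_le hq hq1 (x := 2 * j + 1) (by linarith))
    (inv_br_le hq hq1 (x := 2 * j + 2) (by linarith)) (by positivity) (by positivity)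
  rw [← Real.rpow_add hq] at h
  exact h.trans (Real.rpow_le_rpow_of_exponent_ge hq hq1.le (by linarith))

lemma abs_Yc_sub_le (hq : 0 < q) (hq1 : q < 1) (N : ℝ) {j : ℝ} (hj : 1 / 2 ≤ j) :
    |Yc q s N j - Yc q s (-N) j| ≤ |br q (2 * N)| * q ^ (4 * j - 1) := by
  have b1 := br_pos hq hq1 (x := 2 * j + 1) (by linarith)
  have b2 := br_pos hq hq1 (x := 2 * j) (by linarith)
  rw [Yc_sub_Yc hq hq1 N (by linarith), abs_mul]
  refine mul_le_mul_of_nonneg_left ?_ (abs_nonneg _)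
  rw [abs_of_nonneg (by positivity)]
  have h := mul_le_mul (inv_br_le hq hq1 (x := 2 * j + 1) (by linarith))
    (inv_br_le hq hq1 (x := 2 * j) (by linarith)) (by positivity) (by positivity)
  rw [← Real.rpow_add hq] at h
  exact h.trans (Real.rpow_le_rpow_of_exponent_ge hq hq1.le (by linarith))

lemma rpow_mul_br_le (hq : 0 < q) (hq1 : q < 1) {a b j : ℝ} (h : b - a ≤ 2 * j + 2) :
    q ^ a * br q b ≤ q ^ (-(2 * j + 2)) / (q⁻¹ - q) := by
  have hd : 0 < q⁻¹ - q := by linarith [q_sub_inv_neg hq hq1]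
  calc q ^ a * br q b ≤ q ^ a * (q ^ (-b) / (q⁻¹ - q)) :=
        mul_le_mul_of_nonneg_left (br_le hq hq1 b) (Real.rpow_pos_of_pos hq _).le
    _ = q ^ (a - b) / (q⁻¹ - q) := by
        rw [← mul_div_assoc, ← Real.rpow_add hq, ← sub_eq_add_neg]
    _ ≤ _ := div_le_div_of_nonneg_right
        (Real.rpow_le_rpow_of_exponent_ge hq hq1.le (by linarith)) hd.le

/-- The prefactor `t` grows at most like `q^{-2j}` and the difference decays like `q^{4j}`, so the
square root of the product is of order `q^j`. -/
lemma abs_sqrt_coeff_sub_le (hq : 0 < q) (hq1 : q < 1) {t x y j D : ℝ} (ht : 0 ≤ t)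
    (ht' : t ≤ q ^ (-(2 * j + 2)) / (q⁻¹ - q)) (hx : 0 ≤ x) (hy : 0 ≤ y) (hD : 0 ≤ D)
    (hxy : |x - y| ≤ D * q ^ (4 * j - 1)) :
    |√(t * x) - √(t * y)| ≤ √(D * (q ^ (-3 : ℝ) / (q⁻¹ - q))) * q ^ j := by
  have hd : 0 < q⁻¹ - q := by linarith [q_sub_inv_neg hq hq1]
  refine (abs_sqrt_sub_sqrt_le (by positivity) (by positivity)).trans ?_
  rw [← mul_sub, abs_mul, abs_of_nonneg ht, ← Real.sqrt_sq (Real.rpow_pos_of_pos hq j).le,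
    ← Real.sqrt_mul (by positivity)]
  refine Real.sqrt_le_sqrt ((mul_le_mul ht' hxy (abs_nonneg _) (by positivity)).trans_eq ?_)
  have e : q ^ (-(2 * j + 2)) * q ^ (4 * j - 1) = q ^ (-3 : ℝ) * (q ^ j) ^ 2 := by
    rw [← Real.rpow_add hq, ← Real.rpow_natCast (q ^ j), ← Real.rpow_mul hq.le,
      ← Real.rpow_add hq]
    congr 1
    push_cast
    ring
  linear_combination D / (q⁻¹ - q) * e

/-- A constant that controls the differences of the coefficients. -/
def decayConst (q N : ℝ) : ℝ := √(|br q (2 * N)| * (q ^ (-3 : ℝ) / (q⁻¹ - q)))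

lemma abs_coeff_sub_le (hq : 0 < q) (hq1 : q < 1) (s : ℝ) {N j m : ℝ} (hm : |m| ≤ j)
    (hN : |N| + 1 / 2 ≤ j) :
    |cP q s N j m - cP q s (-N) j m| ≤ decayConst q N * q ^ j ∧
    |cR q s N j m - cR q s (-N) j m| ≤ decayConst q N * q ^ j ∧
    |cP' q s N j m - cP' q s (-N) j m| ≤ decayConst q N * q ^ j ∧
    |cR' q s N j m - cR' q s (-N) j m| ≤ decayConst q N * q ^ j := by
  obtain ⟨m1, m2⟩ := abs_le.1 hm
  have hN0 := abs_nonneg N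
  obtain ⟨n1, n2⟩ := abs_le.1 (show |N| ≤ j by linarith)
  have hX := Xc_nonneg (s := s) hq hq1 (N := N) (j := j) (by linarith) (by linarith)
  have hX' := Xc_nonneg (s := s) hq hq1 (N := -N) (j := j) (by linarith) (by linarith)
  have hY := Yc_nonneg (s := s) hq hq1 (N := N) (j := j) (by linarith) (by linarith)
  have hY' := Yc_nonneg (s := s) hq hq1 (N := -N) (j := j) (by linarith) (by linarith)
  have b1 := br_nonneg hq hq1 (x := j + m + 1) (by linarith)
  have b2 := br_nonneg hq hq1 (x := j - m + 1) (by linarith)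
  have b3 := br_nonneg hq hq1 (x := j + m) (by linarith)
  have b4 := br_nonneg hq hq1 (x := j - m) (by linarith)
  have dX := abs_Xc_sub_le (s := s) hq hq1 N (j := j) (by linarith)
  have dY := abs_Yc_sub_le (s := s) hq hq1 N (j := j) (by linarith)
  refine ⟨?_, ?_, ?_, ?_⟩
  · exact abs_sqrt_coeff_sub_le hq hq1 (by positivity) (rpow_mul_br_le hq hq1 (by linarith)) hX hX'
      (abs_nonneg _) dX
  · rw [cR, cR, neg_sub_neg, abs_sub_comm]
    exact abs_sqrt_coeff_sub_le hq hq1 (by positivity) (rpow_mul_br_le hq hq1 (by linarith)) hY hY'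
      (abs_nonneg _) dY
  · exact abs_sqrt_coeff_sub_le hq hq1 (by positivity) (rpow_mul_br_le hq hq1 (by linarith)) hX hX'
      (abs_nonneg _) dX
  · exact abs_sqrt_coeff_sub_le hq hq1 (by positivity) (rpow_mul_br_le hq hq1 (by linarith)) hY hY'
      (abs_nonneg _) dY

lemma summable_rpow_abs (hq : 0 < q) (hq1 : q < 1) :
    Summable fun k : ℤ => q ^ (|(k : ℝ)| / 4) := by
  have h : Summable fun k : ℕ => (q ^ (1 / 4 : ℝ)) ^ k :=
    summable_geometric_of_lt_one (by positivity) (Real.rpow_lt_one hq.le hq1 (by norm_num))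
  refine .of_nat_of_neg (h.congr fun k => ?_) (h.congr fun k => ?_)
  all_goals
    push_cast
    rw [← Real.rpow_natCast, ← Real.rpow_mul hq.le]
    congr 1
    simp
    ring

lemma summable_rpow_lat (hq : 0 < q) (hq1 : q < 1) :
    Summable fun i : Lat => q ^ (|(i.2.1 : ℝ)| / 4) * q ^ (|(i.2.2 : ℝ)| / 4) := by
  have h := (summable_rpow_abs hq hq1).mul_of_nonneg (summable_rpow_abs hq hq1)
    (fun _ => by positivity) (fun _ => by positivity)
  have h1 : Summable fun _ : ℤˣ => (1 : ℝ) := (hasSum_fintype _).summable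
  refine (h1.mul_of_nonneg h (fun _ => by positivity) (fun _ => by positivity)).congr fun i => ?_
  simp

lemma spin_neg (n : ℤ) (ε : ℤˣ) : spin n (-ε) = -spin n ε := by
  simp [spin]
  ring

lemma abs_br_spin (n : ℤ) (ε : ℤˣ) : |br q (2 * spin n ε)| = |br q n| := by
  rcases Int.units_eq_one_or ε with rfl | rfl
  · rw [spin_one]
    ring_nf
  · rw [spin_neg_one, mul_neg, br_neg, abs_neg]
    ring_nf

lemma auxAdm.abs_spin_le {ε : ℤˣ} {J M : ℤ} (h : auxAdm n (ε, J, M)) (h' : auxAdm n (-ε, J, M)) :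
    |spin n ε| + 1 / 2 ≤ J / 2 := by
  have h1 := (abs_le.1 h.bounds.2).2
  have h2 := (abs_le.1 h'.bounds.2).2
  rw [spin_neg] at h2
  rcases abs_cases (spin n ε) with h | h <;> linarith

lemma auxAdm.le_of_not {ε : ℤˣ} {J M : ℤ} (h : auxAdm n (ε, J, M)) (h' : ¬ auxAdm n (-ε, J, M)) :
    J ≤ |n| + 1 := by
  rw [auxAdm_iff] at h h'
  have hn : (-ε : ℤˣ) = (-(ε : ℤ) : ℤ) := by simp
  have hε : |(ε : ℤ) * n| = |n| := by
    rcases Int.units_eq_one_or ε with rfl | rfl <;> simp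
  rw [hn, neg_mul] at h'
  rcases abs_cases ((ε : ℤ) * n) with h | h <;> omega

/-- Where both signs are admissible the difference is `O(q^j)` by hypothesis. Where only one is, the
spin is bounded and the crude bound `C` is absorbed in a multiple of `q^j`. -/
lemma summable_wt_sub (hq : 0 < q) (hq1 : q < 1) {f : ℝ → ℝ → ℝ → ℝ}
    (hb : ∃ C, ∀ i, |wt n f i| ≤ C)
    (hf : ∀ N j m, |m| ≤ j → |N| + 1 / 2 ≤ j → |f N j m - f (-N) j m| ≤ decayConst q N * q ^ j) :
    Summable fun i : Lat => |wt n f (sgn (-1) i) - wt n f i| := by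
  obtain ⟨C, hC⟩ := hb
  set D := √(|br q n| * (q ^ (-3 : ℝ) / (q⁻¹ - q))) with hD
  have hC0 : 0 ≤ C := (abs_nonneg _).trans (hC (1, 0, 0))
  -- Chosen so that `C ≤ C' q^j` on the range `2j ≤ |n| + 1` of labels admissible for one sign only.
  set C' := C * q ^ (-((|n| + 1 : ℤ) / 2 : ℝ)) with hC'
  have hC'0 : 0 ≤ C' := by positivity
  -- Since `|m| ≤ j`, half of the exponent can be spent on each variable. The result is a product
  -- that is summable over the whole lattice, without counting the labels of a given spin.
  have hpow : ∀ {ε : ℤˣ} {J M : ℤ}, auxAdm n (ε, J, M) →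
      q ^ (J / 2 : ℝ) ≤ q ^ (|(J : ℝ)| / 4) * q ^ (|(M : ℝ)| / 4) := fun {ε J M} h => by
    rw [← Real.rpow_add hq]
    refine Real.rpow_le_rpow_of_exponent_ge hq hq1.le ?_
    have h1 := h.bounds.1
    have h2 : 0 ≤ (J : ℝ) / 2 := (abs_nonneg _).trans h1
    rw [abs_div, abs_two] at h1
    rw [abs_of_nonneg (by linarith : (0 : ℝ) ≤ J)]
    linarith
  have hlow : ∀ {ε : ℤˣ} {J M : ℤ}, auxAdm n (ε, J, M) → ¬ auxAdm n (-ε, J, M) →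
      C ≤ C' * (q ^ (|(J : ℝ)| / 4) * q ^ (|(M : ℝ)| / 4)) := fun {ε J M} h h' => by
    refine le_trans ?_ (mul_le_mul_of_nonneg_left (hpow h) hC'0)
    rw [hC', mul_assoc, ← Real.rpow_add hq]
    refine le_mul_of_one_le_right hC0 (Real.one_le_rpow_of_pos_of_le_one_of_nonpos hq hq1.le ?_)
    have : (J : ℝ) ≤ (|n| + 1 : ℤ) := by exact_mod_cast h.le_of_not h'
    linarith
  refine .of_nonneg_of_le (fun _ => abs_nonneg _) ?_ ((summable_rpow_lat hq hq1).mul_left (D + C'))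
  rintro ⟨ε, J, M⟩
  rw [sgn_apply, neg_one_mul]
  dsimp only
  have hS : 0 ≤ q ^ (|(J : ℝ)| / 4) * q ^ (|(M : ℝ)| / 4) := by positivity
  have hD0 : 0 ≤ D := Real.sqrt_nonneg _
  rw [add_mul]
  by_cases h : auxAdm n (ε, J, M) <;> by_cases h' : auxAdm n (-ε, J, M)
  · have := hf (spin n ε) (J / 2) (M / 2) h.bounds.1 (h.abs_spin_le h')
    rw [decayConst, abs_br_spin] at this
    rw [wt_of h, wt_of h', spin_neg, abs_sub_comm]
    have h2 := mul_le_mul_of_nonneg_left (hpow h) hD0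
    have h3 := mul_nonneg hC'0 hS
    linarith
  · rw [wt_of_not h', zero_sub, abs_neg]
    have := hC (ε, J, M)
    have h2 := hlow h h'
    have h3 := mul_nonneg hD0 hS
    linarith
  · rw [wt_of_not h, sub_zero]
    have := hC (-ε, J, M)
    have h2 := hlow h' (by simpa using h)
    have h3 := mul_nonneg hD0 hS
    linarith
  · rw [wt_of_not h, wt_of_not h', sub_zero, abs_zero]
    positivity

end Decay

end Podles

end

noncomputable section

namespace Podles

open NCG

variable {n : ℤ} {q s : ℝ}

/-! ## The Fredholm module -/

section Fredholm

lemma absSummable_comp_ext {E : Type*} [NormedAddCommGroup E] [NormedSpace ℂ E]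
    {T : L2 Lat →L[ℂ] E} (hT : AbsSummable T) : AbsSummable (T ∘L ext n) := by
  refine (Summable.comp_injective hT (lab_injective n)).congr fun i => ?_
  rw [ContinuousLinearMap.comp_apply, bv_eq_ket, ext_ket i.2.2]
  rfl

lemma absSummable_comp_res {E : Type*} [NormedAddCommGroup E] [NormedSpace ℂ E]
    {T : Hilb n →L[ℂ] E} (hT : AbsSummable T) : AbsSummable (T ∘L res n) := by
  refine ((lab_injective n).summable_iff ?_).1 (hT.congr fun i => ?_)
  · rintro ⟨ε, L, M⟩ h
    rw [ContinuousLinearMap.comp_apply, res_bv, ket_of_not, map_zero, norm_zero]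
    exact fun h' => h ⟨(ε, ⟨(L, M), h'⟩), rfl⟩
  · rw [bv_eq_ket, ← res_bv]
    rfl

variable (s n)

lemma summable_w_sub (hq : 0 < q) (hq1 : q < 1) :
    (Summable fun i => |wt n (cP q s) (sgn (-1) i) - wt n (cP q s) i|) ∧
    (Summable fun i => |wt n (cR q s) (sgn (-1) i) - wt n (cR q s) i|) ∧
    (Summable fun i => |wt n (cP' q s) (sgn (-1) i) - wt n (cP' q s) i|) ∧
    (Summable fun i => |wt n (cR' q s) (sgn (-1) i) - wt n (cR' q s) i|) := by
  obtain ⟨b1, b2, b3, b4⟩ := bdd_wt (s := s) hq hq1 n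
  exact ⟨summable_wt_sub hq hq1 b1 fun N j m hm hN => (abs_coeff_sub_le hq hq1 s hm hN).1,
    summable_wt_sub hq hq1 b2 fun N j m hm hN => (abs_coeff_sub_le hq hq1 s hm hN).2.1,
    summable_wt_sub hq hq1 b3 fun N j m hm hN => (abs_coeff_sub_le hq hq1 s hm hN).2.2.1,
    summable_wt_sub hq hq1 b4 fun N j m hm hN => (abs_coeff_sub_le hq hq1 s hm hN).2.2.2⟩

/-- Operators on the lattice that commute with the flip up to absolutely summable ones, and
preserve absolute summability. -/
structure Tame (T : L2 Lat →L[ℂ] L2 Lat) : Prop where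
  comm : AbsSummable (sflip (-1) ∘L T - T ∘L sflip (-1))
  stable : ∀ S : L2 Lat →L[ℂ] Hilb n, AbsSummable S → AbsSummable (S ∘L T)
  stable' : ∀ S : L2 Lat →L[ℂ] L2 Lat, AbsSummable S → AbsSummable (S ∘L T)

variable {n} in
lemma Tame.add {S T : L2 Lat →L[ℂ] L2 Lat} (hS : Tame n S) (hT : Tame n T) : Tame n (S + T) where
  comm := by
    convert hS.comm.add hT.comm using 1
    rw [ContinuousLinearMap.comp_add, ContinuousLinearMap.add_comp]
    abel
  stable R hR := by
    rw [ContinuousLinearMap.comp_add]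
    exact (hS.stable R hR).add (hT.stable R hR)
  stable' R hR := by
    rw [ContinuousLinearMap.comp_add]
    exact (hS.stable' R hR).add (hT.stable' R hR)

/-- Weighted shifts send basis vectors to multiples of basis vectors, so composing with one on the
right preserves absolute summability. The commutator with the flip is again a weighted permutation,
with the difference of the weights for the two signs. -/
lemma tame_wperm (a b : ℤ) (c : Lat → ℝ) (hc)
    (h : Summable fun i => |c (sgn (-1) i) - c i|) : Tame n (wperm (sh a b) c hc) where
  comm := by
    have hb : ∃ C, ∀ i, |c (sgn (-1) i) - c i| ≤ C := by
      obtain ⟨C, hC⟩ := hc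
      exact ⟨C + C, fun i => (abs_sub _ _).trans (add_le_add (hC _) (hC _))⟩
    convert absSummable_wperm ((sh a b).trans (sgn (-1))) _ hb h using 1
    refine ContinuousLinearMap.ext fun f => ?_
    ext ⟨ε, J, M⟩
    simp [sflip, sub_mul]
  stable S hS := hS.comp_wperm _ _ _
  stable' S hS := hS.comp_wperm _ _ _

lemma tame_adjoint_wperm (a b : ℤ) (c : Lat → ℝ) (hc)
    (h : Summable fun i => |c (sgn (-1) i) - c i|) :
    Tame n (ContinuousLinearMap.adjoint (wperm (sh a b) c hc)) := by
  rw [adjoint_wperm]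
  have h2 : Summable fun i => |(c ∘ (sh a b).symm) (sgn (-1) i) - (c ∘ (sh a b).symm) i| := by
    refine (((sh a b).symm.summable_iff).2 h).congr ?_
    rintro ⟨ε, J, M⟩
    simp
  have h3 := tame_wperm n (-a) (-b) (c ∘ (sh a b).symm) (bdd_comp hc _) h2
  convert h3 using 2
  exact sh_symm a b

variable (hq : 0 < q) (hq1 : q < 1)

lemma tame_w₁ : Tame n (w₁ n s hq hq1) :=
  (tame_wperm n _ _ _ _ (summable_w_sub n s hq hq1).1).add
    (tame_wperm n _ _ _ _ (summable_w_sub n s hq hq1).2.1)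

lemma tame_w₂ : Tame n (w₂ n s hq hq1) :=
  (tame_wperm n _ _ _ _ (summable_w_sub n s hq hq1).2.2.1).add
    (tame_wperm n _ _ _ _ (summable_w_sub n s hq hq1).2.2.2)

lemma tame_v₁ : Tame n (v₁ n s hq hq1) := by
  rw [v₁, w₁, map_add]
  exact (tame_adjoint_wperm n _ _ _ _ (summable_w_sub n s hq hq1).1).add
    (tame_adjoint_wperm n _ _ _ _ (summable_w_sub n s hq hq1).2.1)

lemma tame_v₂ : Tame n (v₂ n s hq hq1) := by
  rw [v₂, w₂, map_add]
  exact (tame_adjoint_wperm n _ _ _ _ (summable_w_sub n s hq hq1).2.2.1).add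
    (tame_adjoint_wperm n _ _ _ _ (summable_w_sub n s hq hq1).2.2.2)

/-- Operators on the Hilbert space whose commutator with the flip is absolutely summable, and that
preserve absolute summability. -/
structure TameOn (T : Hilb n →L[ℂ] Hilb n) : Prop where
  comm : AbsSummable (flip n * T - T * flip n)
  stable : ∀ S : Hilb n →L[ℂ] Hilb n, AbsSummable S → AbsSummable (S * T)

variable {n}

lemma TameOn.add {S T : Hilb n →L[ℂ] Hilb n} (hS : TameOn n S) (hT : TameOn n T) :
    TameOn n (S + T) where
  comm := by
    convert hS.comm.add hT.comm using 1
    rw [mul_add, add_mul]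
    abel
  stable R hR := by
    rw [mul_add]
    exact (hS.stable R hR).add (hT.stable R hR)

lemma TameOn.smul {T : Hilb n →L[ℂ] Hilb n} (hT : TameOn n T) (z : ℂ) : TameOn n (z • T) where
  comm := by
    convert hT.comm.smul z using 1
    rw [mul_smul_comm, smul_mul_assoc, smul_sub]
  stable R hR := by
    rw [mul_smul_comm]
    exact (hT.stable R hR).smul z

/-- The commutator is a derivation: `[F,ST] = [F,S]T + S[F,T]`. Absolute summability refers to the
standard basis and is immediate only for composition on the left, which is why `stable` is carried
along to treat the first term. -/
lemma TameOn.mul {S T : Hilb n →L[ℂ] Hilb n} (hS : TameOn n S) (hT : TameOn n T) :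
    TameOn n (S * T) where
  comm := by
    convert (hT.stable _ hS.comm).add (hT.comm.comp_left S) using 1
    change _ = _ + S * _
    noncomm_ring
  stable R hR := by
    rw [← mul_assoc]
    exact hT.stable _ (hS.stable R hR)

lemma tameOn_one : TameOn n (1 : Hilb n →L[ℂ] Hilb n) where
  comm := by
    rw [mul_one, one_mul, sub_self]
    exact absSummable_zero
  stable R hR := by rwa [mul_one]

/-- Restriction and extension intertwine the flip with the sign change on the lattice, so the
commutator of `res V W ext` reduces to those of `V` and `W`. -/
lemma tameOn_blk {V W : L2 Lat →L[ℂ] L2 Lat} (hV : Tame n V) (hW : Tame n W) :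
    TameOn n (blk n V W) where
  comm := by
    have h1 : AbsSummable ((sflip (-1) ∘L V - V ∘L sflip (-1)) ∘L W) := hW.stable' _ hV.comm
    have h2 : AbsSummable (V ∘L (sflip (-1) ∘L W - W ∘L sflip (-1))) := hW.comm.comp_left V
    have h3 : AbsSummable (res n ∘L ((sflip (-1) ∘L V - V ∘L sflip (-1)) ∘L W +
      V ∘L (sflip (-1) ∘L W - W ∘L sflip (-1)))) := (h1.add h2).comp_left (res n)
    have h4 := absSummable_comp_ext (n := n) h3
    convert h4 using 1
    refine ContinuousLinearMap.ext fun f => ?_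
    simp only [sub_apply, mul_apply_eq_comp, blk_apply, flip_res, ext_flip, add_apply,
      ContinuousLinearMap.comp_apply, map_sub, map_add]
    abel
  stable S hS := by
    have h1 : AbsSummable (S ∘L res n) := absSummable_comp_res hS
    have h2 : AbsSummable ((S ∘L res n) ∘L V) := hV.stable _ h1
    have h3 : AbsSummable (((S ∘L res n) ∘L V) ∘L W) := hW.stable _ h2
    have h4 : AbsSummable ((((S ∘L res n) ∘L V) ∘L W) ∘L ext n) := absSummable_comp_ext h3
    have e : S * blk n V W = (((S ∘L res n) ∘L V) ∘L W) ∘L ext n :=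
      ContinuousLinearMap.ext fun _ => rfl
    rwa [e]

lemma tameOn_repGen (g : Gen) : TameOn n (repGen n s hq hq1 g) := by
  have hv₁ := tame_v₁ n s hq hq1
  have hv₂ := tame_v₂ n s hq hq1
  have hw₁ := tame_w₁ n s hq hq1
  have hw₂ := tame_w₂ n s hq hq1
  cases g with
  | A =>
    rw [repGen, sub_eq_add_neg, ← neg_smul]
    exact ((tameOn_blk hv₁ hw₁).smul _).add (tameOn_one.smul _)
  | B => exact (tameOn_blk hv₁ hw₂).smul _
  | Bs => exact (tameOn_blk hv₂ hw₁).smul _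

lemma tameOn_rep (hn : n ≠ 0) (a : Alg q s) : TameOn n (rep n s hq hq1 hn a) := by
  induction a using alg_induction with
  | h_scalar z =>
    rw [AlgHomClass.commutes, Algebra.algebraMap_eq_smul_one]
    exact tameOn_one.smul z
  | h_gen g => rw [rep_gen]; exact tameOn_repGen s hq hq1 g
  | h_mul a b ha hb => rw [map_mul]; exact ha.mul hb
  | h_add a b ha hb => rw [map_add]; exact ha.add hb

lemma isOneSummable_rep (hn : n ≠ 0) : IsOneSummable (rep n s hq hq1 hn) (flip n) := fun a =>
  (tameOn_rep s hq hq1 hn a).comm.isTraceClass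

/-! ### The operators `F` and `γ` -/

lemma flip_apply (f : Hilb n) (ε : ℤˣ) (p : Idx n) : flip n f (ε, p) = f (-ε, p) := by
  simp [flip, signedPerm, LinearMap.mkContinuous_apply]

lemma flip_mul_flip : flip n * flip n = 1 := by
  refine ContinuousLinearMap.ext fun f => ?_
  ext ⟨ε, p⟩
  rw [mul_apply_eq_comp, flip_apply, flip_apply, neg_neg]
  rfl

lemma grading_mul_grading : grading n * grading n = 1 := by
  refine ContinuousLinearMap.ext fun f => ?_
  ext ⟨ε, p⟩
  rw [mul_apply_eq_comp, grading_apply, grading_apply]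
  rcases Int.units_eq_one_or ε with rfl | rfl <;> simp

lemma grading_mul_flip : grading n * flip n = -(flip n * grading n) := by
  refine ContinuousLinearMap.ext fun f => ?_
  ext ⟨ε, p⟩
  rw [mul_apply_eq_comp, grading_apply, neg_apply, mul_apply_eq_comp, lp.coeFn_neg, Pi.neg_apply,
    flip_apply, flip_apply, grading_apply]
  simp

lemma isSelfAdjoint_of_bv {ι : Type*} {T : L2 ι →L[ℂ] L2 ι}
    (h : ∀ i f, ⟪T (bv i), f⟫_ℂ = T f i) : IsSelfAdjoint T := by
  rw [ContinuousLinearMap.isSelfAdjoint_iff']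
  refine ContinuousLinearMap.ext fun f => ?_
  ext i
  rw [← inner_bv_left, ContinuousLinearMap.adjoint_inner_right, h]

lemma isSelfAdjoint_flip : IsSelfAdjoint (flip n) := by
  refine isSelfAdjoint_of_bv fun ⟨ε, p⟩ f => ?_
  rw [bv_eq_ket, flip_ket, flip_apply, ket_of p.2, inner_bv_left]

lemma isSelfAdjoint_grading : IsSelfAdjoint (grading n) := by
  refine isSelfAdjoint_of_bv fun ⟨ε, p⟩ f => ?_
  rw [bv_eq_ket, grading_ket, grading_apply, ket_of p.2, inner_smul_left, inner_bv_left]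
  simp

lemma grading_comm_of_ket {T : Hilb n →L[ℂ] Hilb n}
    (h : ∀ {ε : ℤˣ} {L M : ℤ}, hilbAdm n L M →
      grading n (T (ket n ε L M)) = (-((ε : ℤ) : ℂ)) • T (ket n ε L M)) :
    grading n * T = T * grading n := by
  refine hilb_ext fun ε p => ?_
  rw [mul_apply_eq_comp, mul_apply_eq_comp, grading_ket, map_smul, h p.2]

lemma grading_comm_repGen (g : Gen) :
    grading n * repGen n s hq hq1 g = repGen n s hq hq1 g * grading n := by
  cases g with
  | A =>
    rw [repGen, mul_sub, sub_mul, mul_smul_comm, mul_smul_comm, smul_mul_assoc, smul_mul_assoc,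
      mul_one, one_mul, grading_comm_of_ket fun h => ?_]
    rw [blk₁₁_ket n s hq hq1 h]
    simp only [map_add, map_smul, grading_ket]
    module
  | B =>
    rw [repGen, mul_smul_comm, smul_mul_assoc, grading_comm_of_ket fun h => ?_]
    rw [blk₁₂_ket n s hq hq1 h]
    simp only [map_add, map_smul, grading_ket]
    module
  | Bs =>
    rw [repGen, mul_smul_comm, smul_mul_assoc, grading_comm_of_ket fun h => ?_]
    rw [blk₂₁_ket n s hq hq1 h]
    simp only [map_add, map_smul, grading_ket]
    module

lemma grading_comm_rep (hn : n ≠ 0) (a : Alg q s) :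
    grading n * rep n s hq hq1 hn a = rep n s hq hq1 hn a * grading n := by
  induction a using alg_induction with
  | h_scalar z => rw [AlgHomClass.commutes]; exact (Algebra.commutes z (grading n)).symm
  | h_gen g => rw [rep_gen]; exact grading_comm_repGen s hq hq1 g
  | h_mul a b ha hb => rw [map_mul, ← mul_assoc, ha, mul_assoc, hb, mul_assoc]
  | h_add a b ha hb => rw [map_add, mul_add, add_mul, ha, hb]

lemma isEvenFredholmModule_rep (hn : n ≠ 0) :
    IsEvenFredholmModule (rep n s hq hq1 hn) (flip n) (grading n) where
  F_selfAdjoint := isSelfAdjoint_flip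
  F_sq := flip_mul_flip
  compact_commutator a := (tameOn_rep s hq hq1 hn a).comm.isCompactOperator
  γ_selfAdjoint := isSelfAdjoint_grading
  γ_sq := grading_mul_grading
  γ_comm := grading_comm_rep s hq hq1 hn
  γ_anticomm := grading_mul_flip

end Fredholm

end Podles

end

noncomputable section

namespace NCG

/-! ### A criterion for the Fredholm property and the index -/

section Fredholm

variable {E F : Type*} [NormedAddCommGroup E] [NormedSpace ℂ E] [NormedAddCommGroup F]
  [NormedSpace ℂ F] {S S' : Type*} [Finite S] [Finite S']

/-- An operator with a generalized inverse, whose kernel and cokernel are described by finitely many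
coordinates, is Fredholm, and its index is the difference of the numbers of coordinates. -/
lemma isFredholm_and_index (u : E →L[ℂ] F) (w : F →L[ℂ] E) (a : E →ₗ[ℂ] (S → ℂ))
    (b : F →ₗ[ℂ] (S' → ℂ)) (ha : ∀ x, u x = 0 → a x = 0 → x = 0)
    (ha' : ∀ c, ∃ x, u x = 0 ∧ a x = c) (hbu : ∀ x, b (u x) = 0)
    (hb : ∀ y, b y = 0 → u (w y) = y) (hb' : Function.Surjective b) :
    u.IsFredholm ∧ (u : E →ₗ[ℂ] F).index = (Nat.card S : ℤ) - Nat.card S' := by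
  have := Fintype.ofFinite S
  have := Fintype.ofFinite S'
  -- `hbu` gives one inclusion; on `ker b` the map `w` is a right inverse of `u`, which gives the
  -- other. So `b` identifies the cokernel, as `a` identifies the kernel.
  have hrange : LinearMap.range (u : E →ₗ[ℂ] F) = LinearMap.ker b := by
    ext y
    exact ⟨fun ⟨x, hx⟩ => hx ▸ hbu x, fun hy => ⟨w y, hb y hy⟩⟩
  let eK : LinearMap.ker (u : E →ₗ[ℂ] F) ≃ₗ[ℂ] (S → ℂ) :=
    LinearEquiv.ofBijective (a ∘ₗ (LinearMap.ker (u : E →ₗ[ℂ] F)).subtype) ⟨by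
      refine (injective_iff_map_eq_zero _).2 fun x hx => ?_
      exact Subtype.ext (ha x x.2 hx), fun c => by
      obtain ⟨x, hx, hc⟩ := ha' c
      exact ⟨⟨x, hx⟩, hc⟩⟩
  let eC : (F ⧸ LinearMap.range (u : E →ₗ[ℂ] F)) ≃ₗ[ℂ] (S' → ℂ) :=
    (Submodule.quotEquivOfEq _ _ hrange).trans (b.quotKerEquivOfSurjective hb')
  have hK : FiniteDimensional ℂ (LinearMap.ker (u : E →ₗ[ℂ] F)) := eK.symm.finiteDimensional
  have hC : FiniteDimensional ℂ (F ⧸ LinearMap.range (u : E →ₗ[ℂ] F)) := eC.symm.finiteDimensional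
  refine ⟨.of_isQuasiInverse (v := w) ⟨?_, ?_⟩, ?_⟩
  · refine LinearMap.FiniteRangeSetoid.equiv_iff_hasNoetherianRange.2 ?_
    -- `u w u = u`, so `w u - 1` takes values in the finite dimensional kernel of `u`.
    have hle : LinearMap.range ((w : F →ₗ[ℂ] E) ∘ₗ (u : E →ₗ[ℂ] F) - LinearMap.id) ≤
        LinearMap.ker (u : E →ₗ[ℂ] F) := by
      rintro _ ⟨x, rfl⟩
      simp [hb _ (hbu x)]
    exact isNoetherian_of_le hle
  · exact LinearMap.FiniteRangeSetoid.equiv_of_eqOn_coFG (A := LinearMap.ker b)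
      (Submodule.CoFG.ker b) fun y hy => hb y hy
  · rw [LinearMap.index_eq_finrank_sub, eK.finrank_eq, eC.finrank_eq]
    simp [Nat.card_eq_fintype_card]

end Fredholm

end NCG

end

noncomputable section

namespace NCG

section Ampl

variable {H : Type*} [NormedAddCommGroup H] [InnerProductSpace ℂ H] {k : ℕ}

lemma opMatrix_apply (T : Matrix (Fin k) (Fin k) (H →L[ℂ] H)) (x : Ampl H k) (i : Fin k) :
    opMatrix T x i = ∑ j, T i j (x j) := by
  simp [opMatrix]

lemma amplify_apply (T : H →L[ℂ] H) (x : Ampl H k) (i : Fin k) : amplify k T x i = T (x i) := by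
  rw [amplify, opMatrix_apply, Finset.sum_eq_single i]
  · simp
  · intro j _ hj
    simp [Matrix.diagonal_apply_ne' _ hj]
  · simp

end Ampl

end NCG

namespace Podles

open NCG

variable {n : ℤ} {q s : ℝ}

/-! ## The index -/

section Defect

/-- Admissible labels for the sign `ε` that are not admissible for the sign `-ε`. -/
abbrev Defect (n : ℤ) (ε : ℤˣ) : Type :=
  {p : ℤ × ℤ // auxAdm n (ε, p.1, p.2) ∧ ¬ auxAdm n (-ε, p.1, p.2)}

/-- In doubled labels the thresholds `|εn+1|` and `|εn-1|` have the same parity and differ by two if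
`n ≠ 0`. So one value of `J` at most is admissible for `ε` and not for `-ε`, namely `-εn-1`, which
requires `εn < 0`. Its `J + 1 = -εn` values of `M` are enumerated by `defectEquiv`. -/
lemma defect_iff (ε : ℤˣ) (J M : ℤ) :
    (auxAdm n (ε, J, M) ∧ ¬ auxAdm n (-ε, J, M)) ↔
      (ε : ℤ) * n < 0 ∧ J = -((ε : ℤ) * n) - 1 ∧ -J ≤ M ∧ M ≤ J ∧ 2 ∣ J - M := by
  have hn : ((-ε : ℤˣ) : ℤ) = -(ε : ℤ) := by simp
  rw [auxAdm_iff, auxAdm_iff, hn, neg_mul]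
  omega

/-- The labels in the defect, enumerated. -/
def defectEquiv (n : ℤ) (ε : ℤˣ) : Fin (-((ε : ℤ) * n)).toNat ≃ Defect n ε where
  toFun k := ⟨(-((ε : ℤ) * n) - 1, ((ε : ℤ) * n) + 1 + 2 * k), by
    rw [defect_iff]
    have := k.2
    omega⟩
  invFun p := ⟨((p.1.2 - ((ε : ℤ) * n) - 1) / 2).toNat, by
    have h := (defect_iff ε p.1.1 p.1.2).1 p.2
    omega⟩
  left_inv k := by
    ext
    simp only
    omega
  right_inv := by
    rintro ⟨⟨J, M⟩, h⟩
    have h' := (defect_iff ε J M).1 h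
    ext <;> simp only <;> omega

instance (n : ℤ) (ε : ℤˣ) : Finite (Defect n ε) := Finite.of_equiv _ (defectEquiv n ε)

lemma card_defect (n : ℤ) (ε : ℤˣ) : (Nat.card (Defect n ε) : ℤ) = max (-((ε : ℤ) * n)) 0 := by
  rw [← Nat.card_congr (defectEquiv n ε), Nat.card_eq_fintype_card, Fintype.card_fin,
    Int.toNat_eq_max]

end Defect

/-! ### A positive lower bound for the compressed flip -/

section LowerBound

/-- The term with `s²` is dropped. In the remaining one the growth of `[j+1/2+N] q^{-(j+1/2-N)}`
balances that of `[2j+1]`, and the powers of `q` multiply to `q(q⁻¹-q) = 1-q²`. The hypothesis makes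
the argument `j+1/2+N` at least `1`, as `le_br` needs. -/
lemma le_br_mul_Yc (hq : 0 < q) (hq1 : q < 1) {N j : ℝ} (hN : |N| + 1 / 2 ≤ j) :
    (1 - q ^ 2) / (1 + s ^ 2) ≤ br q (2 * j) * Yc q s N j := by
  have hN0 := abs_nonneg N
  obtain ⟨n1, n2⟩ := abs_le.1 (show |N| ≤ j - 1 / 2 by linarith)
  have b1 := br_pos hq hq1 (x := 2 * j + 1) (by linarith)
  have b2 := br_pos hq hq1 (x := 2 * j) (by linarith)
  have hd : 0 < q⁻¹ - q := by linarith [q_sub_inv_neg hq hq1]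
  have hs : 0 < 1 + s ^ 2 := by positivity
  have h1 := le_br hq hq1 (x := j + 1 / 2 + N) (by linarith)
  have h2 : (q⁻¹ - q) * q ^ (2 * j + 1) ≤ (br q (2 * j + 1))⁻¹ := by
    rw [le_inv_comm₀ (by positivity) b1, mul_inv, ← Real.rpow_neg hq.le]
    exact (br_le hq hq1 _).trans_eq (div_eq_inv_mul _ _)
  have h3 : q ^ (-(j + 1 / 2 - N)) ≤ q ^ (j + 1 / 2 - N) * s ^ 2 + q ^ (-(j + 1 / 2 - N)) :=
    le_add_of_nonneg_left (by positivity)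
  have e : br q (2 * j) * Yc q s N j = br q (j + 1 / 2 + N) *
      (q ^ (j + 1 / 2 - N) * s ^ 2 + q ^ (-(j + 1 / 2 - N))) * (br q (2 * j + 1))⁻¹ /
        (1 + s ^ 2) := by
    unfold Yc
    field_simp
  rw [e]
  refine div_le_div_of_nonneg_right ?_ hs.le
  have h4 := mul_le_mul (mul_le_mul h1 h3 (by positivity) (br_nonneg hq hq1 (by linarith))) h2
    (by positivity) (mul_nonneg (br_nonneg hq hq1 (by linarith)) (by positivity))
  refine le_trans (le_of_eq ?_) h4
  have e2 : q ^ (1 - (j + 1 / 2 + N)) * q ^ (-(j + 1 / 2 - N)) * q ^ (2 * j + 1) = q := by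
    rw [← Real.rpow_add hq, ← Real.rpow_add hq]
    ring_nf
    exact Real.rpow_one q
  rw [show q ^ (1 - (j + 1 / 2 + N)) * q ^ (-(j + 1 / 2 - N)) * ((q⁻¹ - q) * q ^ (2 * j + 1)) =
    q ^ (1 - (j + 1 / 2 + N)) * q ^ (-(j + 1 / 2 - N)) * q ^ (2 * j + 1) * (q⁻¹ - q) by ring, e2]
  field_simp

/-- The `X` part is nonnegative and may be dropped, and the `Y` part is the geometric mean of two
quantities bounded below by `le_br_mul_Yc`. Admissibility for both signs yields `|N| + 1/2 ≤ j`. -/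
lemma le_dg (hq : 0 < q) (hq1 : q < 1) {i : Lat} (h : auxAdm n i) (h' : auxAdm n (sgn (-1) i)) :
    (1 - q ^ 2) / (1 + s ^ 2) ≤ dg n q s (-1) i := by
  obtain ⟨ε, J, M⟩ := i
  rw [dg, if_pos ⟨h, h'⟩]
  rw [sgn_apply, neg_one_mul] at h'
  have hN := h.abs_spin_le h'
  have hN' := h'.abs_spin_le (by simpa using h)
  have hN0 := abs_nonneg (spin n ε)
  have h1 := le_br_mul_Yc (s := s) hq hq1 hN
  have h2 := le_br_mul_Yc (s := s) hq hq1 hN'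
  rw [show 2 * ((J : ℝ) / 2) = J by ring] at h1 h2
  have hJ : (0 : ℝ) ≤ J := by linarith
  have b1 := br_nonneg hq hq1 (x := (J : ℝ) + 2) (by linarith)
  have b2 := br_nonneg hq hq1 hJ
  have hq2 : 0 ≤ 1 - q ^ 2 := by nlinarith
  have hc : 0 ≤ (1 - q ^ 2) / (1 + s ^ 2) := by positivity
  dsimp only
  rw [neg_one_mul]
  refine le_add_of_nonneg_of_le (by positivity) ?_
  rw [show br q J * √(Yc q s (spin n ε) (J / 2) * Yc q s (spin n (-ε)) (J / 2)) =
    √((br q J * Yc q s (spin n ε) (J / 2)) * (br q J * Yc q s (spin n (-ε)) (J / 2))) by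
      rw [mul_mul_mul_comm, Real.sqrt_mul (mul_self_nonneg (br q J)), Real.sqrt_mul_self b2]]
  exact Real.le_sqrt_of_sq_le (by rw [sq]; exact mul_le_mul h1 h2 hc (hc.trans h1))

lemma dg_of_not {δ : ℤˣ} {i : Lat} (h : ¬ (auxAdm n i ∧ auxAdm n (sgn δ i))) :
    dg n q s δ i = 0 := if_neg h

lemma sgn_neg_one_sgn (i : Lat) : sgn (-1) (sgn (-1) i) = i := by
  obtain ⟨ε, J, M⟩ := i
  simp

lemma dg_pos (hq : 0 < q) (hq1 : q < 1) {i : Lat} (h : auxAdm n i) (h' : auxAdm n (sgn (-1) i)) :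
    0 < dg n q s (-1) i :=
  (div_pos (by nlinarith) (by positivity)).trans_le (le_dg hq hq1 h h')

/-- Off the labels admissible for both signs `dg` is zero and so is its inverse by convention, which
is the value wanted for a generalized inverse. -/
lemma bdd_inv_dg (hq : 0 < q) (hq1 : q < 1) (n : ℤ) (s : ℝ) :
    ∃ C, ∀ i, |(dg n q s (-1) (sgn (-1) i))⁻¹| ≤ C := by
  have hq2 : 0 < 1 - q ^ 2 := by nlinarith
  refine ⟨((1 - q ^ 2) / (1 + s ^ 2))⁻¹, fun i => ?_⟩
  by_cases h : auxAdm n (sgn (-1) i) ∧ auxAdm n (sgn (-1) (sgn (-1) i))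
  · rw [abs_of_pos (inv_pos.2 (dg_pos hq hq1 h.1 h.2))]
    exact inv_anti₀ (by positivity) (le_dg hq hq1 h.1 h.2)
  · rw [dg_of_not h, inv_zero, abs_zero]
    positivity

end LowerBound

/-! ### The range of the idempotent as a copy of the auxiliary space -/

section Split

variable (hq : 0 < q) (hq1 : q < 1) (s n)

/-- The operators `res v₁` and `res v₂`, as an operator to the amplification. -/
def vOp : L2 Lat →L[ℂ] Ampl (Hilb n) 2 :=
  ((PiLp.continuousLinearEquiv 2 ℂ fun _ : Fin 2 => Hilb n).symm :
      (Fin 2 → Hilb n) →L[ℂ] Ampl (Hilb n) 2) ∘L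
    ContinuousLinearMap.pi ![res n ∘L v₁ n s hq hq1, res n ∘L v₂ n s hq hq1]

/-- A left inverse of `vOp` on functions with admissible support. -/
def wOp : Ampl (Hilb n) 2 →L[ℂ] L2 Lat :=
  w₁ n s hq hq1 ∘L ext n ∘L PiLp.proj 2 _ 0 +
    (q : ℂ) ^ 2 • (w₂ n s hq hq1 ∘L ext n ∘L PiLp.proj 2 _ 1)

lemma vOp_apply_zero (f : L2 Lat) : vOp n s hq hq1 f 0 = res n (v₁ n s hq hq1 f) := rfl

lemma vOp_apply_one (f : L2 Lat) : vOp n s hq hq1 f 1 = res n (v₂ n s hq hq1 f) := rfl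

lemma wOp_apply (x : Ampl (Hilb n) 2) : wOp n s hq hq1 x =
    w₁ n s hq hq1 (ext n (x 0)) + (q : ℂ) ^ 2 • w₂ n s hq hq1 (ext n (x 1)) := rfl

lemma wOp_support (x : Ampl (Hilb n) 2) {i : Lat} (h : ¬ auxAdm n i) :
    wOp n s hq hq1 x i = 0 := by
  rw [wOp_apply, lp.coeFn_add, Pi.add_apply, lp.coeFn_smul, Pi.smul_apply,
    w₁_support n s hq hq1 _ h, w₂_support n s hq hq1 _ h, smul_zero, add_zero]

lemma wOp_vOp {f : L2 Lat} (hf : ∀ i, ¬ auxAdm n i → f i = 0) :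
    wOp n s hq hq1 (vOp n s hq hq1 f) = f := by
  rw [wOp_apply, vOp_apply_zero, vOp_apply_one, ext_res_v₁, ext_res_v₂,
    wv_eq_self n s hq hq1 hf]

/-- The flip of `H ⊗ ℂ²`, compressed to the auxiliary space, is diagonal up to the exchange of
signs. This is `wv_apply` for `δ = -1`. -/
lemma wOp_flip_vOp (f : L2 Lat) (i : Lat) :
    wOp n s hq hq1 (amplify 2 (flip n) (vOp n s hq hq1 f)) i =
      dg n q s (-1) i * f (sgn (-1) i) := by
  rw [wOp_apply, amplify_apply, amplify_apply, vOp_apply_zero, vOp_apply_one, ext_flip, ext_flip,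
    ext_res_v₁, ext_res_v₂, ← wv_apply n s hq hq1]
  rfl

/-- Three entries hold by the choice of `repGen`; the lower right one, `1 - q²A`, is where the trace
identity enters. -/
lemma rep_idem (hn : n ≠ 0) : (idem q s).map (rep n s hq hq1 hn) =
    !![blk n (v₁ n s hq hq1) (w₁ n s hq hq1), (q : ℂ) ^ 2 • blk n (v₁ n s hq hq1) (w₂ n s hq hq1);
      blk n (v₂ n s hq hq1) (w₁ n s hq hq1),
      (q : ℂ) ^ 2 • blk n (v₂ n s hq hq1) (w₂ n s hq hq1)] := by
  have hq' : (q : ℂ) ≠ 0 := Complex.ofReal_ne_zero.2 hq.ne'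
  have hs := one_add_sq_ne_zero s
  have ht := blk_trace n s hq hq1 hn
  ext1 i j
  fin_cases i <;> fin_cases j
  · simp only [idem, Matrix.map_apply, Matrix.smul_apply, Fin.zero_eta, Matrix.of_apply,
      Matrix.cons_val', Matrix.cons_val_zero, Matrix.cons_val_fin_one, map_smul, map_add, map_one,
      rep_gen, repGen]
    rw [add_sub_cancel, inv_smul_smul₀ hs]
  · simp only [idem, Matrix.map_apply, Matrix.smul_apply, Fin.zero_eta, Fin.mk_one,
      Matrix.of_apply, Matrix.cons_val', Matrix.cons_val_zero, Matrix.cons_val_one,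
      Matrix.cons_val_fin_one, map_smul, rep_gen, repGen, smul_smul]
    congr 1
    field_simp
  · simp only [idem, Matrix.map_apply, Matrix.smul_apply, Fin.zero_eta, Fin.mk_one,
      Matrix.of_apply, Matrix.cons_val', Matrix.cons_val_zero, Matrix.cons_val_one,
      Matrix.cons_val_fin_one, map_smul, rep_gen, repGen, smul_smul]
    rw [show (1 + (s : ℂ) ^ 2)⁻¹ * (q : ℂ)⁻¹ * ((1 + (s : ℂ) ^ 2) * q) = 1 by field_simp, one_smul]
  · simp only [idem, Matrix.map_apply, Matrix.smul_apply, Fin.mk_one,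
      Matrix.of_apply, Matrix.cons_val', Matrix.cons_val_one,
      Matrix.cons_val_fin_one, map_smul, map_sub, map_one, rep_gen, repGen]
    rw [inv_smul_eq_iff₀ hs, smul_smul, sub_eq_iff_eq_add]
    rw [smul_add, ← eq_sub_iff_add_eq'] at ht
    rw [ht]
    module

/-- Together with `wOp_vOp` this splits the idempotent, so that `vOp` identifies the functions with
admissible support with the range of `π(e_s)`. -/
lemma vOp_wOp (hn : n ≠ 0) (x : Ampl (Hilb n) 2) :
    vOp n s hq hq1 (wOp n s hq hq1 x) = liftRep (rep n s hq hq1 hn) (idem q s) x := by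
  ext1 i
  rw [liftRep, rep_idem, opMatrix_apply, Fin.sum_univ_two, wOp_apply]
  fin_cases i
  · simp [vOp_apply_zero, blk_apply]
  · simp [vOp_apply_one, blk_apply]

end Split

end Podles

end

noncomputable section

namespace Podles

open NCG

variable {n : ℤ} {q s : ℝ}

/-! ### Transport of `F⁺` to the auxiliary space -/

section Index

/-- Functions supported on admissible labels with sign `ε`. -/
def Supp (n : ℤ) (ε : ℤˣ) (f : L2 Lat) : Prop := ∀ i, ¬ (auxAdm n i ∧ i.1 = ε) → f i = 0

lemma Supp.apply_of_not {ε : ℤˣ} {f : L2 Lat} (h : Supp n ε f) {i : Lat} (hi : ¬ auxAdm n i) :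
    f i = 0 := h i fun h' => hi h'.1

lemma Supp.apply_of_ne {ε : ℤˣ} {f : L2 Lat} (h : Supp n ε f) {i : Lat} (hi : i.1 ≠ ε) :
    f i = 0 := h i fun h' => hi h'.2

lemma Supp.smul {ε : ℤˣ} {f : L2 Lat} (h : Supp n ε f) (z : ℂ) : Supp n ε (z • f) := fun i hi => by
  rw [lp.coeFn_smul, Pi.smul_apply, h i hi, smul_zero]

lemma Supp.ext {ε : ℤˣ} {f g : L2 Lat} (hf : Supp n ε f) (hg : Supp n ε g)
    (h : ∀ J M, auxAdm n (ε, J, M) → f (ε, J, M) = g (ε, J, M)) : f = g := by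
  ext ⟨δ, J, M⟩
  by_cases hi : auxAdm n (δ, J, M) ∧ δ = ε
  · obtain ⟨h1, rfl⟩ := hi
    exact h _ _ h1
  · rw [hf _ hi, hg _ hi]

open Classical in
/-- Restriction to the labels with sign `ε`. -/
def cut (ε : ℤˣ) : L2 Lat →L[ℂ] L2 Lat :=
  wperm (Equiv.refl _) (fun i => if i.1 = ε then 1 else 0)
    ⟨1, fun i => by split_ifs <;> simp⟩

lemma cut_apply_self (ε : ℤˣ) (f : L2 Lat) (p : ℤ × ℤ) : cut ε f (ε, p) = f (ε, p) := by
  simp [cut]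

lemma cut_apply_of_ne {ε : ℤˣ} (f : L2 Lat) {i : Lat} (h : i.1 ≠ ε) : cut ε f i = 0 := by
  simp [cut, h]

lemma supp_cut (ε : ℤˣ) {f : L2 Lat} (hf : ∀ i, ¬ auxAdm n i → f i = 0) : Supp n ε (cut ε f) := by
  rintro ⟨δ, p⟩ h
  by_cases hδ : δ = ε
  · subst hδ
    rw [cut_apply_self]
    exact hf _ fun h' => h ⟨h', rfl⟩
  · exact cut_apply_of_ne f hδ

lemma cut_add_cut (ε : ℤˣ) (f : L2 Lat) : cut ε f + cut (-ε) f = f := by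
  ext ⟨δ, p⟩
  rw [lp.coeFn_add, Pi.add_apply]
  by_cases hδ : δ = ε
  · subst hδ
    rw [cut_apply_self, cut_apply_of_ne, add_zero]
    intro h
    rcases Int.units_eq_one_or δ with rfl | rfl <;> simp at h
  · obtain rfl : δ = -ε := by
      rcases Int.units_eq_one_or δ with rfl | rfl <;> rcases Int.units_eq_one_or ε with rfl | rfl <;>
        simp_all
    rw [cut_apply_self, cut_apply_of_ne _ hδ, zero_add]

variable (hq : 0 < q) (hq1 : q < 1) (s)

lemma Supp.v₁_apply {ε : ℤˣ} {f : L2 Lat} (h : Supp n ε f) {δ : ℤˣ} (hδ : δ ≠ ε) (L M : ℤ) :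
    v₁ n s hq hq1 f (δ, L, M) = 0 := by
  rw [Podles.v₁_apply, h.apply_of_ne (i := (δ, L - 1, M - 1)) hδ,
    h.apply_of_ne (i := (δ, L + 1, M - 1)) hδ]
  simp

lemma Supp.v₂_apply {ε : ℤˣ} {f : L2 Lat} (h : Supp n ε f) {δ : ℤˣ} (hδ : δ ≠ ε) (L M : ℤ) :
    v₂ n s hq hq1 f (δ, L, M) = 0 := by
  rw [Podles.v₂_apply, h.apply_of_ne (i := (δ, L - 1, M + 1)) hδ,
    h.apply_of_ne (i := (δ, L + 1, M + 1)) hδ]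
  simp

lemma grading_res {ε : ℤˣ} {f : L2 Lat} (h : ∀ δ L M, δ ≠ ε → f (δ, L, M) = 0) :
    grading n (res n f) = (-((ε : ℤ) : ℂ)) • res n f := by
  ext ⟨δ, p⟩
  rw [grading_apply, lp.coeFn_smul, Pi.smul_apply, smul_eq_mul]
  by_cases hδ : δ = ε
  · rw [hδ]
  · rw [res_apply, lab, h _ _ _ hδ, mul_zero, mul_zero]

lemma Supp.grading_vOp {ε : ℤˣ} {f : L2 Lat} (h : Supp n ε f) :
    amplify 2 (grading n) (vOp n s hq hq1 f) = (-((ε : ℤ) : ℂ)) • vOp n s hq hq1 f := by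
  ext1 i
  rw [amplify_apply, PiLp.smul_apply]
  fin_cases i
  · exact grading_res fun δ L M hδ => h.v₁_apply s hq hq1 hδ L M
  · exact grading_res fun δ L M hδ => h.v₂_apply s hq hq1 hδ L M

lemma Supp.liftRep_vOp (hn : n ≠ 0) {ε : ℤˣ} {f : L2 Lat} (h : Supp n ε f) :
    liftRep (rep n s hq hq1 hn) (idem q s) (vOp n s hq hq1 f) = vOp n s hq hq1 f := by
  rw [← vOp_wOp, wOp_vOp n s hq hq1 fun i hi => h.apply_of_not hi]

lemma exists_supp (hn : n ≠ 0) (ε : ℤˣ) (x : Ampl (Hilb n) 2) : ∃ f, Supp n ε f ∧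
    liftRep (rep n s hq hq1 hn) (idem q s) x - ((ε : ℤ) : ℂ) •
      amplify 2 (grading n) (liftRep (rep n s hq hq1 hn) (idem q s) x) = vOp n s hq hq1 f := by
  set h := wOp n s hq hq1 x with hh
  have hs : ∀ i, ¬ auxAdm n i → h i = 0 := fun i hi => wOp_support n s hq hq1 x hi
  -- The grading acts on `vOp (cut ε h)` as `-ε`, so `1 - εγ` doubles the part of sign `ε` and kills
  -- the other.
  refine ⟨(2 : ℂ) • cut ε h, (supp_cut ε hs).smul 2, ?_⟩
  have h1 := (supp_cut ε hs).grading_vOp s hq hq1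
  have h2 := (supp_cut (-ε) hs).grading_vOp s hq hq1
  have e : vOp n s hq hq1 h = vOp n s hq hq1 (cut ε h) + vOp n s hq hq1 (cut (-ε) h) := by
    rw [← map_add, cut_add_cut]
  rw [← vOp_wOp, ← hh, e, map_add, h1, h2, map_smul]
  rcases Int.units_eq_one_or ε with rfl | rfl
  · simp only [Units.val_one, Units.val_neg, Int.cast_one, Int.cast_neg, one_smul, neg_smul, neg_neg]
    module
  · simp only [Units.val_one, Units.val_neg, Int.cast_one, Int.cast_neg, one_smul, neg_smul, neg_neg]
    module

/-- The grading is `+1` on `H_{-N}`, so `1 + γ` selects the sign `-1`; accordingly `minusSpace`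
belongs to the sign `+1`. -/
lemma mem_plusSpace (hn : n ≠ 0) (x : Ampl (Hilb n) 2) :
    x ∈ plusSpace (rep n s hq hq1 hn) (grading n) (idem q s) ↔
      ∃ f, Supp n (-1) f ∧ vOp n s hq hq1 f = x := by
  constructor
  · rintro ⟨y, rfl⟩
    obtain ⟨f, hf, h⟩ := exists_supp s hq hq1 hn (-1) y
    refine ⟨f, hf, h.symm.trans ?_⟩
    simp
  · rintro ⟨f, hf, rfl⟩
    refine ⟨(2 : ℂ)⁻¹ • vOp n s hq hq1 f, ?_⟩
    have h := hf.grading_vOp s hq hq1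
    simp only [map_smul, ContinuousLinearMap.coe_coe, mul_apply_eq_comp, add_apply,
      one_apply_eq_self, hf.liftRep_vOp s hq hq1 hn, h]
    simp only [Units.val_one, Units.val_neg, Int.cast_one, Int.cast_neg, one_smul, neg_neg]
    module

lemma mem_minusSpace (hn : n ≠ 0) (x : Ampl (Hilb n) 2) :
    x ∈ minusSpace (rep n s hq hq1 hn) (grading n) (idem q s) ↔
      ∃ f, Supp n 1 f ∧ vOp n s hq hq1 f = x := by
  constructor
  · rintro ⟨y, rfl⟩
    obtain ⟨f, hf, h⟩ := exists_supp s hq hq1 hn 1 y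
    refine ⟨f, hf, h.symm.trans ?_⟩
    simp
  · rintro ⟨f, hf, rfl⟩
    refine ⟨(2 : ℂ)⁻¹ • vOp n s hq hq1 f, ?_⟩
    have h := hf.grading_vOp s hq hq1
    simp only [map_smul, ContinuousLinearMap.coe_coe, mul_apply_eq_comp, sub_apply,
      one_apply_eq_self, hf.liftRep_vOp s hq hq1 hn, h]
    simp only [Units.val_one, Int.cast_one]
    module

variable (n)

/-- The compression of the flip, `wOp F vOp`. -/
def tOp : L2 Lat →L[ℂ] L2 Lat := wOp n s hq hq1 ∘L amplify 2 (flip n) ∘L vOp n s hq hq1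

/-- A generalized inverse of `tOp`. -/
def dOp : L2 Lat →L[ℂ] L2 Lat :=
  wperm (sgn (-1)) (fun i => (dg n q s (-1) (sgn (-1) i))⁻¹) (bdd_inv_dg hq hq1 n s)

variable {n}

lemma tOp_apply (f : L2 Lat) (i : Lat) :
    tOp n s hq hq1 f i = dg n q s (-1) i * f (sgn (-1) i) :=
  wOp_flip_vOp n s hq hq1 f i

lemma dOp_apply (f : L2 Lat) (i : Lat) :
    dOp n s hq hq1 f i = ((dg n q s (-1) (sgn (-1) i))⁻¹ : ℝ) * f (sgn (-1) i) := rfl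

lemma Supp.tOp {ε : ℤˣ} {f : L2 Lat} (h : Supp n ε f) : Supp n (-ε) (tOp n s hq hq1 f) := by
  rintro ⟨δ, J, M⟩ hi
  rw [tOp_apply]
  by_cases hd : auxAdm n (δ, J, M)
  · have hδ : δ ≠ -ε := fun h' => hi ⟨hd, h'⟩
    rw [h.apply_of_ne, mul_zero]
    simpa [neg_eq_iff_eq_neg] using hδ
  · rw [dg_of_not fun h' => hd h'.1, Complex.ofReal_zero, zero_mul]

lemma Supp.dOp {ε : ℤˣ} {f : L2 Lat} (h : Supp n ε f) : Supp n (-ε) (dOp n s hq hq1 f) := by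
  rintro ⟨δ, J, M⟩ hi
  rw [dOp_apply]
  by_cases hd : auxAdm n (δ, J, M)
  · have hδ : δ ≠ -ε := fun h' => hi ⟨hd, h'⟩
    rw [h.apply_of_ne, mul_zero]
    simpa [neg_eq_iff_eq_neg] using hδ
  · rw [dg_of_not, inv_zero, Complex.ofReal_zero, zero_mul]
    rw [sgn_neg_one_sgn]
    exact fun h' => hd h'.2

/-- On the sign `-1` the factor `1 + γ` acts as `2`; after the flip the sign is `+1` and `1 - γ`
acts as `2`. The prefactor `1/4` cancels them, and what remains is `e F v = v (w F v)`. -/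
lemma FPlus_vOp (hn : n ≠ 0) {f : L2 Lat} (hf : Supp n (-1) f)
    (x : plusSpace (rep n s hq hq1 hn) (grading n) (idem q s))
    (hx : (x : Ampl (Hilb n) 2) = vOp n s hq hq1 f) :
    (FPlus (rep n s hq hq1 hn) (flip n) (grading n) (idem q s) x : Ampl (Hilb n) 2) =
      vOp n s hq hq1 (tOp n s hq hq1 f) := by
  have hT : Supp n 1 (tOp n s hq hq1 f) := by simpa using hf.tOp s hq hq1
  have h1 := hf.grading_vOp s hq hq1
  have h2 := hT.grading_vOp s hq hq1
  have h3 : liftRep (rep n s hq hq1 hn) (idem q s)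
      (amplify 2 (flip n) (vOp n s hq hq1 f)) = vOp n s hq hq1 (tOp n s hq hq1 f) :=
    (vOp_wOp n s hq hq1 hn _).symm
  change (1 / 4 : ℂ) • ((1 - amplify 2 (grading n)) * liftRep (rep n s hq hq1 hn) (idem q s) *
    amplify 2 (flip n) * liftRep (rep n s hq hq1 hn) (idem q s) * (1 + amplify 2 (grading n)))
      (x : Ampl (Hilb n) 2) = _
  rw [hx]
  simp only [mul_apply_eq_comp, add_apply, sub_apply, one_apply_eq_self, h1, map_add, map_smul,
    hf.liftRep_vOp s hq hq1 hn, h3, h2]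
  simp only [Units.val_one, Units.val_neg, Int.cast_one, Int.cast_neg, neg_neg]
  module

end Index

end Podles

end

noncomputable section

namespace Podles

open NCG

variable {n : ℤ} {q s : ℝ}

/-! ### Kernel and cokernel of the compressed flip -/

section Index

variable (hq : 0 < q) (hq1 : q < 1) (s)

/-- The function on the lattice with prescribed values on the defect labels. -/
def defectFun (n : ℤ) (ε : ℤˣ) (c : Defect n ε → ℂ) : L2 Lat :=
  ∑ᶠ p, c p • bv (ε, p.1)

lemma defectFun_apply (ε : ℤˣ) (c : Defect n ε → ℂ) (p : Defect n ε) :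
    defectFun n ε c (ε, p.1) = c p := by
  have := Fintype.ofFinite (Defect n ε)
  rw [defectFun, finsum_eq_sum_of_fintype, ← inner_bv_left, inner_sum, Finset.sum_eq_single p]
  · rw [inner_smul_right, inner_bv_left, bv_self, mul_one]
  · intro p' _ hp
    rw [inner_smul_right, inner_bv_left, bv_ne, mul_zero]
    exact fun h => hp (Subtype.ext (Prod.mk.inj h).2.symm)
  · exact fun h => absurd (Finset.mem_univ _) h

lemma defectFun_apply_of_not (ε : ℤˣ) (c : Defect n ε → ℂ) {i : Lat}
    (h : ∀ p : Defect n ε, i ≠ (ε, p.1)) : defectFun n ε c i = 0 := by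
  have := Fintype.ofFinite (Defect n ε)
  rw [defectFun, finsum_eq_sum_of_fintype, ← inner_bv_left, inner_sum]
  refine Finset.sum_eq_zero fun p _ => ?_
  rw [inner_smul_right, inner_bv_left, bv_ne (h p), mul_zero]

lemma supp_defectFun (ε : ℤˣ) (c : Defect n ε → ℂ) : Supp n ε (defectFun n ε c) := fun i hi =>
  defectFun_apply_of_not ε c fun p hp => hi (by subst hp; exact ⟨p.2.1, rfl⟩)

/-- The coordinates at the defect labels. -/
def defectCoord (n : ℤ) (ε : ℤˣ) : L2 Lat →ₗ[ℂ] (Defect n ε → ℂ) where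
  toFun f p := f (ε, p.1)
  map_add' _ _ := rfl
  map_smul' _ _ := rfl

lemma defectCoord_defectFun (ε : ℤˣ) (c : Defect n ε → ℂ) :
    defectCoord n ε (defectFun n ε c) = c := funext fun p => defectFun_apply ε c p

lemma tOp_defectFun (ε : ℤˣ) (c : Defect n ε → ℂ) : tOp n s hq hq1 (defectFun n ε c) = 0 := by
  ext ⟨δ, J, M⟩
  rw [tOp_apply, sgn_apply, neg_one_mul]
  by_cases h : auxAdm n (δ, J, M) ∧ auxAdm n (-δ, J, M)
  · rw [defectFun_apply_of_not, mul_zero]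
    · rfl
    · rintro ⟨p, hp⟩ heq
      obtain ⟨rfl, rfl⟩ := Prod.mk.inj heq
      exact hp.2 (by simpa using h.1)
  · rw [dg_of_not (by simpa using h)]
    simp

/-- At a label also admissible for `-ε` the factor `dg` is nonzero, which forces `f` to vanish
there; the remaining labels of the support are the defect. -/
lemma Supp.eq_zero_of_tOp {ε : ℤˣ} {f : L2 Lat} (hf : Supp n ε f) (h : Podles.tOp n s hq hq1 f = 0)
    (h' : defectCoord n ε f = 0) : f = 0 := by
  refine hf.ext (g := 0) (fun _ _ => rfl) fun J M hi => ?_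
  by_cases hi' : auxAdm n (-ε, J, M)
  · have h1 := tOp_apply (n := n) s hq hq1 f (-ε, J, M)
    have hpos := dg_pos (s := s) hq hq1 hi' (by simpa using hi)
    rw [h, sgn_apply, neg_one_mul, neg_neg] at h1
    have h2 := h1.symm
    rw [lp.coeFn_zero, Pi.zero_apply, mul_eq_zero] at h2
    exact h2.resolve_left (Complex.ofReal_ne_zero.2 hpos.ne')
  · exact congrFun h' ⟨(J, M), hi, hi'⟩

lemma Supp.tOp_dOp {ε : ℤˣ} {f : L2 Lat} (hf : Supp n ε f) (h' : defectCoord n ε f = 0) :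
    Podles.tOp n s hq hq1 (Podles.dOp n s hq hq1 f) = f := by
  have hs : Supp n ε (Podles.tOp n s hq hq1 (Podles.dOp n s hq hq1 f)) := by
    simpa using (hf.dOp s hq hq1).tOp s hq hq1
  refine hs.ext hf fun J M hi => ?_
  rw [tOp_apply, dOp_apply, sgn_neg_one_sgn]
  by_cases hi' : auxAdm n (-ε, J, M)
  · have hpos := dg_pos (s := s) hq hq1 hi (by simpa using hi')
    have : (dg n q s (-1) (ε, J, M) : ℂ) ≠ 0 := Complex.ofReal_ne_zero.2 hpos.ne'
    rw [Complex.ofReal_inv, mul_inv_cancel_left₀ this]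
  · have h0 : f (ε, J, M) = 0 := congrFun h' ⟨(J, M), hi, hi'⟩
    rw [h0, mul_zero, mul_zero]

lemma defectCoord_tOp (ε : ℤˣ) (f : L2 Lat) : defectCoord n ε (tOp n s hq hq1 f) = 0 := by
  funext ⟨⟨J, M⟩, hp⟩
  change tOp n s hq hq1 f (ε, J, M) = 0
  rw [tOp_apply, dg_of_not, Complex.ofReal_zero, zero_mul]
  rintro ⟨-, h⟩
  exact hp.2 (by simpa using h)

/-- The Fredholm property and the index of `F⁺` for the invariant idempotent. -/
lemma isFredholm_and_pairing (hn : n ≠ 0) :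
    (FPlus (rep n s hq hq1 hn) (flip n) (grading n) (idem q s)).IsFredholm ∧
      pairing (rep n s hq hq1 hn) (flip n) (grading n) (idem q s) = n := by
  set P := plusSpace (rep n s hq hq1 hn) (grading n) (idem q s) with hP
  set Q := minusSpace (rep n s hq hq1 hn) (grading n) (idem q s) with hQ
  have hw : ∀ {ε : ℤˣ} {f : L2 Lat}, Supp n ε f → wOp n s hq hq1 (vOp n s hq hq1 f) = f :=
    fun hf => wOp_vOp n s hq hq1 fun i hi => hf.apply_of_not hi
  -- The generalized inverse: `dOp`, which divides by `dg` after changing the sign, transported by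
  -- `vOp` and `wOp`.
  let G : Q →L[ℂ] P :=
    ((vOp n s hq hq1 ∘L dOp n s hq hq1 ∘L wOp n s hq hq1) ∘L Q.subtypeL).codRestrict P fun y => by
      obtain ⟨f, hf, hy⟩ := (mem_minusSpace s hq hq1 hn _).1 y.2
      refine (mem_plusSpace s hq hq1 hn _).2 ⟨dOp n s hq hq1 f, hf.dOp s hq hq1, ?_⟩
      simp [← hy, hw hf]
  have hG : ∀ y, (G y : Ampl (Hilb n) 2) =
      vOp n s hq hq1 (dOp n s hq hq1 (wOp n s hq hq1 y)) := fun y => rfl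
  let a : P →ₗ[ℂ] (Defect n (-1) → ℂ) :=
    defectCoord n (-1) ∘ₗ (wOp n s hq hq1 : Ampl (Hilb n) 2 →ₗ[ℂ] L2 Lat) ∘ₗ P.subtype
  let b : Q →ₗ[ℂ] (Defect n 1 → ℂ) :=
    defectCoord n 1 ∘ₗ (wOp n s hq hq1 : Ampl (Hilb n) 2 →ₗ[ℂ] L2 Lat) ∘ₗ Q.subtype
  have hpair := isFredholm_and_index (FPlus (rep n s hq hq1 hn) (flip n) (grading n) (idem q s))
    G a b ?_ ?_ ?_ ?_ ?_
  · refine ⟨hpair.1, hpair.2.trans ?_⟩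
    rw [card_defect, card_defect]
    simp only [Units.val_one, Units.val_neg]
    -- The kernel has dimension `max(n,0)` and the cokernel `max(-n,0)`; their difference is `n` for
    -- either sign of `n`.
    omega
  · intro x hx hax
    obtain ⟨f, hf, hxf⟩ := (mem_plusSpace s hq hq1 hn _).1 x.2
    have h1 := FPlus_vOp s hq hq1 hn hf x hxf.symm
    have h2 : Supp n 1 (tOp n s hq hq1 f) := by simpa using hf.tOp s hq hq1
    rw [hx] at h1
    have h3 : tOp n s hq hq1 f = 0 := by
      rw [← hw h2, ← h1]
      exact map_zero _
    have h4 : defectCoord n (-1) f = 0 := by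
      rw [← hax, ← hw hf, hxf]
      rfl
    refine Subtype.ext ?_
    rw [← hxf, hf.eq_zero_of_tOp s hq hq1 h3 h4, map_zero]
    rfl
  · intro c
    have hf := supp_defectFun (n := n) (-1) c
    refine ⟨⟨vOp n s hq hq1 (defectFun n (-1) c), (mem_plusSpace s hq hq1 hn _).2 ⟨_, hf, rfl⟩⟩,
      ?_, ?_⟩
    · refine Subtype.ext ?_
      rw [FPlus_vOp s hq hq1 hn hf _ rfl, tOp_defectFun, map_zero]
      rfl
    · change defectCoord n (-1) (wOp n s hq hq1 (vOp n s hq hq1 _)) = c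
      rw [hw hf, defectCoord_defectFun]
  · intro x
    obtain ⟨f, hf, hxf⟩ := (mem_plusSpace s hq hq1 hn _).1 x.2
    have h1 := FPlus_vOp s hq hq1 hn hf x hxf.symm
    have h2 : Supp n 1 (tOp n s hq hq1 f) := by simpa using hf.tOp s hq hq1
    change defectCoord n 1 (wOp n s hq hq1 (FPlus _ _ _ _ x : Ampl (Hilb n) 2)) = 0
    rw [h1, hw h2, defectCoord_tOp]
  · intro y hy
    obtain ⟨f, hf, hyf⟩ := (mem_minusSpace s hq hq1 hn _).1 y.2
    have hd : Supp n (-1) (dOp n s hq hq1 f) := hf.dOp s hq hq1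
    have h4 : defectCoord n 1 f = 0 := by
      rw [← hy, ← hw hf, hyf]
      rfl
    refine Subtype.ext ?_
    rw [FPlus_vOp s hq hq1 hn hd _ (by rw [hG, ← hyf, hw hf]), hf.tOp_dOp s hq hq1 h4, hyf]
  · intro c
    have hf := supp_defectFun (n := n) 1 c
    refine ⟨⟨vOp n s hq hq1 (defectFun n 1 c), (mem_minusSpace s hq hq1 hn _).2 ⟨_, hf, rfl⟩⟩, ?_⟩
    change defectCoord n 1 (wOp n s hq hq1 (vOp n s hq hq1 _)) = c
    rw [hw hf, defectCoord_defectFun]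

end Index

end Podles

end

noncomputable section

namespace Podles

open NCG

variable {n : ℤ} {q s : ℝ}

/-! ## The representation of `U_q(su(2))` -/

section Uq

lemma ketS_of_not {ε : ℤˣ} {L M : ℤ} (h : ¬ hilbAdm n L M) : ketS n ε L M = 0 :=
  Subtype.ext (ket_of_not h)

lemma linearIndependent_ketS (n : ℤ) :
    LinearIndependent ℂ fun i : ℤˣ × Idx n => ketS n i.1 i.2.1.1 i.2.1.2 := by
  refine LinearIndependent.of_comp (ketSpan n).subtype ?_
  have h : (fun i : ℤˣ × Idx n => (ketS n i.1 i.2.1.1 i.2.1.2 : Hilb n)) =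
      stdBasis (ℤˣ × Idx n) := by
    funext i
    rw [stdBasis_apply, bv_eq_ket]
    rfl
  change LinearIndependent ℂ fun i : ℤˣ × Idx n => (ketS n i.1 i.2.1.1 i.2.1.2 : Hilb n)
  rw [h]
  exact (stdBasis (ℤˣ × Idx n)).orthonormal.linearIndependent

lemma span_ketS (n : ℤ) :
    ⊤ ≤ Submodule.span ℂ (Set.range fun i : ℤˣ × Idx n => ketS n i.1 i.2.1.1 i.2.1.2) := by
  rintro ⟨x, hx⟩ -
  induction hx using Submodule.span_induction with
  | mem x h =>
    obtain ⟨⟨ε, L, M⟩, rfl⟩ := h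
    by_cases h : hilbAdm n L M
    · exact Submodule.subset_span ⟨(ε, ⟨(L, M), h⟩), rfl⟩
    · rw [show (⟨ket n ε L M, _⟩ : ketSpan n) = 0 from ketS_of_not h]
      exact zero_mem _
  | zero => exact zero_mem _
  | add x y hx hy ihx ihy => exact add_mem ihx ihy
  | smul c x hx ih => exact Submodule.smul_mem _ c ih

/-- The basis of the span of the basis vectors. -/
def ketBasis (n : ℤ) : Module.Basis (ℤˣ × Idx n) ℂ (ketSpan n) :=
  Module.Basis.mk (linearIndependent_ketS n) (span_ketS n)

lemma ketBasis_apply (i : ℤˣ × Idx n) : ketBasis n i = ketS n i.1 i.2.1.1 i.2.1.2 :=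
  Module.Basis.mk_apply _ _ i

lemma ketSpan_hom_ext {W : Type*} [AddCommGroup W] [Module ℂ W] {f g : ketSpan n →ₗ[ℂ] W}
    (h : ∀ ε L M, hilbAdm n L M → f (ketS n ε L M) = g (ketS n ε L M)) : f = g :=
  (ketBasis n).ext fun i => by
    rw [ketBasis_apply]
    exact h _ _ _ i.2.2

lemma ketSpan_induction {p : ketSpan n → Prop} (zero : p 0) (add : ∀ x y, p x → p y → p (x + y))
    (smul : ∀ (c : ℂ) x, p x → p (c • x)) (ket : ∀ ε L M, hilbAdm n L M → p (ketS n ε L M))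
    (x : ketSpan n) : p x := by
  have hx := span_ketS n (Submodule.mem_top (x := x))
  induction hx using Submodule.span_induction with
  | mem x h =>
    obtain ⟨i, rfl⟩ := h
    exact ket _ _ _ i.2.2
  | zero => exact zero
  | add x y _ _ ihx ihy => exact add x y ihx ihy
  | smul c x _ ih => exact smul c x ih

/-- The linear map that sends `|l,m;εN⟩` to `c(2l,2m)|l,m+a/2;εN⟩`. -/
def ketMap (n : ℤ) (c : ℤ → ℤ → ℝ) (a : ℤ) : ketSpan n →ₗ[ℂ] ketSpan n :=
  (ketBasis n).constr ℂ fun i => (c i.2.1.1 i.2.1.2 : ℂ) • ketS n i.1 i.2.1.1 (i.2.1.2 + a)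

lemma ketMap_ketS_of {c : ℤ → ℤ → ℝ} {a : ℤ} {ε : ℤˣ} {L M : ℤ} (h : hilbAdm n L M) :
    ketMap n c a (ketS n ε L M) = (c L M : ℂ) • ketS n ε L (M + a) := by
  rw [show ketS n ε L M = ketBasis n (ε, ⟨(L, M), h⟩) from (ketBasis_apply (n := n) (ε, ⟨(L, M), h⟩)).symm,
    ketMap,
    Module.Basis.constr_basis]

/-- When the coefficient vanishes at inadmissible labels that would be shifted to admissible ones,
the formula holds for all labels. Products of such maps can then be computed without case
distinctions. -/
lemma ketMap_ketS {c : ℤ → ℤ → ℝ} {a : ℤ}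
    (hc : ∀ L M, ¬ hilbAdm n L M → hilbAdm n L (M + a) → c L M = 0) (ε : ℤˣ) (L M : ℤ) :
    ketMap n c a (ketS n ε L M) = (c L M : ℂ) • ketS n ε L (M + a) := by
  by_cases h : hilbAdm n L M
  · exact ketMap_ketS_of h
  · rw [ketS_of_not h, map_zero]
    by_cases h' : hilbAdm n L (M + a)
    · rw [hc L M h h', Complex.ofReal_zero, zero_smul]
    · rw [ketS_of_not h', smul_zero]

/-- The matrix coefficient of `E`. -/
def cE (q : ℝ) (L M : ℤ) : ℝ := √(br q (L / 2 - M / 2) * br q (L / 2 + M / 2 + 1))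

/-- The matrix coefficient of `F`. -/
def cF (q : ℝ) (L M : ℤ) : ℝ := √(br q (L / 2 + M / 2) * br q (L / 2 - M / 2 + 1))

/-- The matrix coefficient of `K`. -/
def cK (q : ℝ) (_ M : ℤ) : ℝ := q ^ ((M : ℝ) / 2)

/-- The matrix coefficient of `K⁻¹`. -/
def cKinv (q : ℝ) (_ M : ℤ) : ℝ := q ^ (-((M : ℝ) / 2))

lemma hilbAdm_iff' (L M : ℤ) :
    hilbAdm n L M ↔ (-L ≤ n ∧ n ≤ L ∧ 2 ∣ L - n) ∧ -L ≤ M ∧ M ≤ L ∧ 2 ∣ L - M := by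
  simpa using hilbAdm_iff (n := n) 1 L M

/-- `E` leaves or enters the weights of spin `l` only at `m = l` or `m = -l-1`, where `[l-m]` or
`[l+m+1]` is zero. -/
lemma cE_eq_zero {L M : ℤ} (h : ¬ (hilbAdm n L M ∧ hilbAdm n L (M + 2)))
    (h' : hilbAdm n L M ∨ hilbAdm n L (M + 2)) : cE q L M = 0 := by
  rw [hilbAdm_iff', hilbAdm_iff'] at h h'
  have hc : M = L ∨ M = -L - 2 := by omega
  rcases hc with rfl | rfl
  · simp [cE, br_zero]
  · have : (L : ℝ) / 2 + ((-L - 2 : ℤ) : ℝ) / 2 + 1 = 0 := by push_cast; ring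
    rw [cE, this, br_zero, mul_zero, Real.sqrt_zero]

lemma cF_add_two (L M : ℤ) : cF q L (M + 2) = cE q L M := by
  rw [cE, cF, mul_comm]
  push_cast
  ring_nf

lemma cE_sub_two (L M : ℤ) : cE q L (M - 2) = cF q L M := by
  rw [← cF_add_two, sub_add_cancel]

lemma ketMap_cE (ε : ℤˣ) (L M : ℤ) :
    ketMap n (cE q) 2 (ketS n ε L M) = (cE q L M : ℂ) • ketS n ε L (M + 2) :=
  ketMap_ketS (fun _ _ h h' => cE_eq_zero (fun h'' => h h''.1) (.inr h')) ε L M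

lemma ketMap_cF (ε : ℤˣ) (L M : ℤ) :
    ketMap n (cF q) (-2) (ketS n ε L M) = (cF q L M : ℂ) • ketS n ε L (M - 2) := by
  refine ketMap_ketS (fun L M h h' => ?_) ε L M
  rw [← cE_sub_two]
  refine cE_eq_zero (n := n) (fun h'' => h ?_) (.inl h')
  simpa using h''.2

lemma ketMap_cK (ε : ℤˣ) (L M : ℤ) :
    ketMap n (cK q) 0 (ketS n ε L M) = (cK q L M : ℂ) • ketS n ε L M := by
  rw [ketMap_ketS (fun L M h h' => absurd (by simpa using h') h), add_zero]

lemma ketMap_cKinv (ε : ℤˣ) (L M : ℤ) :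
    ketMap n (cKinv q) 0 (ketS n ε L M) = (cKinv q L M : ℂ) • ketS n ε L M := by
  rw [ketMap_ketS (fun L M h h' => absurd (by simpa using h') h), add_zero]

lemma cK_mul_cKinv (hq : 0 < q) (L M : ℤ) : cK q L M * cKinv q L M = 1 := by
  rw [cK, cKinv, ← Real.rpow_add hq, add_neg_cancel, Real.rpow_zero]

lemma cK_add_two (hq : 0 < q) (L L' M : ℤ) : cK q L (M + 2) = q * cK q L' M := by
  have e : ((M + 2 : ℤ) : ℝ) / 2 = 1 + M / 2 := by
    push_cast
    ring
  rw [cK, cK, e, Real.rpow_add hq, Real.rpow_one]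

lemma cE_sq (hq : 0 < q) (hq1 : q < 1) {L M : ℤ} (h : hilbAdm n L M) :
    cE q L M * cE q L M = br q (L / 2 - M / 2) * br q (L / 2 + M / 2 + 1) := by
  obtain ⟨h1, h2⟩ := abs_le.1 (h.bounds 1).1
  exact Real.mul_self_sqrt (mul_nonneg (br_nonneg hq hq1 (by linarith))
    (br_nonneg hq hq1 (by linarith)))

lemma cF_sq (hq : 0 < q) (hq1 : q < 1) {L M : ℤ} (h : hilbAdm n L M) :
    cF q L M * cF q L M = br q (L / 2 + M / 2) * br q (L / 2 - M / 2 + 1) := by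
  obtain ⟨h1, h2⟩ := abs_le.1 (h.bounds 1).1
  exact Real.mul_self_sqrt (mul_nonneg (br_nonneg hq hq1 (by linarith))
    (br_nonneg hq hq1 (by linarith)))

lemma br_commutator (hq : 0 < q) (hq1 : q < 1) (l m : ℝ) :
    br q (l + m) * br q (l - m + 1) - br q (l - m) * br q (l + m + 1) =
      (q - q⁻¹)⁻¹ * ((q ^ m) ^ 2 - (q ^ (-m)) ^ 2) := by
  have hd := (q_sub_inv_neg hq hq1).ne
  have key : (q ^ (l + m) - q ^ (-(l + m))) * (q ^ (l - m + 1) - q ^ (-(l - m + 1))) -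
      (q ^ (l - m) - q ^ (-(l - m))) * (q ^ (l + m + 1) - q ^ (-(l + m + 1))) =
      (q - q⁻¹) * ((q ^ m) ^ 2 - (q ^ (-m)) ^ 2) := by
    have ha := Real.rpow_pos_of_pos hq l
    have hc := Real.rpow_pos_of_pos hq m
    simp only [neg_add, sub_eq_add_neg, neg_neg, Real.rpow_add hq, Real.rpow_neg hq.le,
      Real.rpow_one]
    generalize q ^ l = x at *
    generalize q ^ m = c at *
    field_simp
    ring
  unfold br
  rw [div_mul_div_comm, div_mul_div_comm, ← sub_div, key]
  generalize q - q⁻¹ = d at *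
  field_simp

lemma ketSpan_smul_inner (c : ℂ) (x y : ketSpan n) : ⟪c • x, y⟫_ℂ = conj c * ⟪x, y⟫_ℂ :=
  inner_smul_left (x : Hilb n) (y : Hilb n) c

lemma ketSpan_inner_smul (c : ℂ) (x y : ketSpan n) : ⟪x, c • y⟫_ℂ = c * ⟪x, y⟫_ℂ :=
  inner_smul_right (x : Hilb n) (y : Hilb n) c

lemma inner_ketS {ε : ℤˣ} {L M : ℤ} (h : hilbAdm n L M) (ε' : ℤˣ) (L' M' : ℤ) :
    ⟪ketS n ε' L' M', ketS n ε L M⟫_ℂ = bv (ε, L, M) (ε', L', M') := by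
  rw [← ext_ket h, ext_apply]
  rfl

lemma inner_ketS' {ε : ℤˣ} {L M : ℤ} (h : hilbAdm n L M) (ε' : ℤˣ) (L' M' : ℤ) :
    ⟪ketS n ε L M, ketS n ε' L' M'⟫_ℂ = bv (ε, L, M) (ε', L', M') := by
  refine (inner_conj_symm (𝕜 := ℂ) (ket n ε L M) (ket n ε' L' M')).symm.trans ?_
  rw [← ext_apply, ext_ket h, bv_apply]
  split_ifs <;> simp

lemma symm_of_ketS {S T : ketSpan n →ₗ[ℂ] ketSpan n}
    (h : ∀ ε L M ε' L' M', hilbAdm n L M → hilbAdm n L' M' →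
      ⟪S (ketS n ε L M), ketS n ε' L' M'⟫_ℂ = ⟪ketS n ε L M, T (ketS n ε' L' M')⟫_ℂ)
    (v w : ketSpan n) : ⟪S v, w⟫_ℂ = ⟪v, T w⟫_ℂ := by
  induction v using ketSpan_induction with
  | zero => simp
  | add x y hx hy => rw [map_add, inner_add_left, inner_add_left, hx, hy]
  | smul c x hx => rw [map_smul, ketSpan_smul_inner, ketSpan_smul_inner, hx]
  | ket ε L M hv =>
    induction w using ketSpan_induction with
    | zero => simp
    | add x y hx hy => rw [map_add, inner_add_right, inner_add_right, hx, hy]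
    | smul c x hx => rw [map_smul, ketSpan_inner_smul, ketSpan_inner_smul, hx]
    | ket ε' L' M' hw => exact h ε L M ε' L' M' hv hw

/-- The representation of `U_q(su(2))` on the span of the basis vectors. -/
def uqRep (hq : 0 < q) (hq1 : q < 1) (n : ℤ) : UqRep q (ketSpan n) where
  K := ketMap n (cK q) 0
  Kinv := ketMap n (cKinv q) 0
  E := ketMap n (cE q) 2
  F := ketMap n (cF q) (-2)
  K_Kinv := ketSpan_hom_ext fun ε L M _ => by
    rw [Module.End.mul_apply, ketMap_cKinv, map_smul, ketMap_cK, smul_smul, ← Complex.ofReal_mul,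
      mul_comm, cK_mul_cKinv hq]
    simp
  Kinv_K := ketSpan_hom_ext fun ε L M _ => by
    rw [Module.End.mul_apply, ketMap_cK, map_smul, ketMap_cKinv, smul_smul, ← Complex.ofReal_mul,
      cK_mul_cKinv hq]
    simp
  K_E := ketSpan_hom_ext fun ε L M _ => by
    rw [Module.End.mul_apply, Module.End.mul_apply, ketMap_cKinv, map_smul, map_smul, ketMap_cE,
      map_smul, ketMap_cK, LinearMap.smul_apply, ketMap_cE, smul_smul, smul_smul, smul_smul,
      cK_add_two hq L L]
    congr 1
    have := congrArg Complex.ofReal (cK_mul_cKinv hq L M)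
    push_cast at this ⊢
    linear_combination (q : ℂ) * cE q L M * this
  K_F := ketSpan_hom_ext fun ε L M _ => by
    rw [Module.End.mul_apply, Module.End.mul_apply, ketMap_cKinv, map_smul, map_smul, ketMap_cF,
      map_smul, ketMap_cK, LinearMap.smul_apply, ketMap_cF, smul_smul, smul_smul, smul_smul]
    congr 1
    have hq' : (q : ℂ) ≠ 0 := Complex.ofReal_ne_zero.2 hq.ne'
    have h1 := congrArg Complex.ofReal (cK_mul_cKinv hq L M)
    have h2 := congrArg Complex.ofReal (cK_add_two hq L L (M - 2))
    rw [sub_add_cancel] at h2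
    push_cast at h1 h2
    rw [h2] at h1
    field_simp
    linear_combination (cF q L M : ℂ) * h1
  E_F := ketSpan_hom_ext fun ε L M h => by
    have h1 := br_commutator hq hq1 (L / 2) (M / 2)
    rw [← cE_sq hq hq1 h, ← cF_sq hq hq1 h] at h1
    have h2 := congrArg Complex.ofReal h1
    rw [LinearMap.sub_apply, Module.End.mul_apply, Module.End.mul_apply, ketMap_cE, ketMap_cF,
      map_smul, map_smul, ketMap_cE, ketMap_cF, cE_sub_two, cF_add_two, sub_add_cancel,
      add_sub_cancel_right, LinearMap.smul_apply, LinearMap.sub_apply, pow_two, pow_two,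
      Module.End.mul_apply, Module.End.mul_apply, ketMap_cK, ketMap_cKinv, map_smul, map_smul,
      ketMap_cK, ketMap_cKinv, smul_smul, smul_smul, smul_smul, smul_smul, ← sub_smul, ← sub_smul,
      smul_smul]
    congr 1
    push_cast at h2
    rw [h2, cK, cKinv]
    ring
  K_symm := symm_of_ketS fun ε L M ε' L' M' h h' => by
    rw [ketMap_cK, ketMap_cK, ketSpan_smul_inner, ketSpan_inner_smul, inner_ketS h', bv_apply]
    split_ifs with heq
    · simp only [Prod.mk.injEq] at heq
      obtain ⟨rfl, rfl, rfl⟩ := heq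
      simp
    · simp
  E_adj := symm_of_ketS fun ε L M ε' L' M' h h' => by
    rw [ketMap_cE, ketMap_cF, ketSpan_smul_inner, ketSpan_inner_smul, inner_ketS h', inner_ketS' h,
      bv_apply, bv_apply]
    by_cases heq : (ε, L, M + 2) = (ε', L', M')
    · simp only [Prod.mk.injEq] at heq
      obtain ⟨rfl, rfl, rfl⟩ := heq
      simp [cF_add_two]
    · have : (ε', L', M' - 2) ≠ (ε, L, M) := by
        intro h
        simp only [Prod.mk.injEq] at h heq
        obtain ⟨rfl, rfl, h⟩ := h
        exact heq ⟨rfl, rfl, by omega⟩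
      simp [heq, this]

lemma isSpinRep_uqRep (hq : 0 < q) (hq1 : q < 1) (n : ℤ) : IsSpinRep n (uqRep hq hq1 n) where
  K_ket := by
    rintro ε p L M m - rfl
    exact ketMap_cK ε L M
  E_ket := by
    rintro ε p L M l m - rfl rfl
    exact ketMap_cE ε L M
  F_ket := by
    rintro ε p L M l m - rfl rfl
    exact ketMap_cF ε L M

end Uq

end Podles

end

noncomputable section

namespace Podles

open NCG

variable {n : ℤ} {q s : ℝ}

/-! ## Identities between the coefficients of `E` and those of the representation -/

section CrossCoefficients

/-- The coefficient `√([l-m][l+m+1])` of `E`. -/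
def eC (q l m : ℝ) : ℝ := √(br q (l - m) * br q (l + m + 1))

/-- The square root of a `q`-number. -/
def rt (q x : ℝ) : ℝ := √(br q x)

lemma rt_sq (hq : 0 < q) (hq1 : q < 1) {x : ℝ} (hx : 0 ≤ x) : rt q x * rt q x = br q x :=
  Real.mul_self_sqrt (br_nonneg hq hq1 hx)

lemma eC_eq (hq : 0 < q) (hq1 : q < 1) {l m x y : ℝ} (hx : l - m = x) (hy : l + m + 1 = y) (h : 0 ≤ x) :
    eC q l m = rt q x * rt q y := by
  subst hx hy
  exact Real.sqrt_mul (br_nonneg hq hq1 h) _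

lemma Bplus_eq (hq : 0 < q) (hq1 : q < 1) {N l m t x y l' : ℝ} (ht : -l + m = t) (hx : l + m + 1 = x) (hy : l + m + 2 = y)
    (hl : l + 1 = l') (h : 0 ≤ x) :
    Bplus q s N l m = q ^ t * (rt q x * rt q y) * α q s N l' := by
  subst ht hx hy hl
  rw [Bplus, Real.sqrt_mul (br_nonneg hq hq1 h)]
  rfl

lemma Bzero_eq' (hq : 0 < q) (hq1 : q < 1) {N l m t x y : ℝ} (ht : m + 2 = t) (hx : l - m = x) (hy : l + m + 1 = y)
    (h : 0 ≤ x) :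
    Bzero q s N l m = -(q ^ t * (rt q 2 * rt q x * rt q y) * β q s N l) := by
  subst ht hx hy
  have h2 := br_nonneg hq hq1 (x := 2) (by norm_num)
  rw [Bzero, Real.sqrt_mul (mul_nonneg h2 (br_nonneg hq hq1 h)), Real.sqrt_mul h2]
  rfl

lemma Bminus_eq (hq : 0 < q) (hq1 : q < 1) {N l m t x y : ℝ} (ht : l + m + 1 = t) (hx : l - m = x) (hy : l - m - 1 = y)
    (h : 0 ≤ x) :
    Bminus q s N l m = -(q ^ t * (rt q x * rt q y) * α q s N l) := by
  subst ht hx hy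
  rw [Bminus, Real.sqrt_mul (br_nonneg hq hq1 h)]
  rfl

lemma Aplus_eq (hq : 0 < q) (hq1 : q < 1) {N l m x y l' : ℝ} (hx : l - m + 1 = x) (hy : l + m + 1 = y)
    (hl : l + 1 = l') (h : 0 ≤ x) :
    Aplus q s N l m = q ^ m * (rt q 2 * rt q x * rt q y) * α q s N l' := by
  subst hx hy hl
  have h2 := br_nonneg hq hq1 (x := 2) (by norm_num)
  rw [Aplus, Real.sqrt_mul (mul_nonneg h2 (br_nonneg hq hq1 h)), Real.sqrt_mul h2]
  rfl

lemma br_succ (hq : 0 < q) (hq1 : q < 1) (x : ℝ) : br q (x + 1) = q * br q x + q ^ (-x) := by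
  have h := br_combine hq x 1
  rw [br_one hq hq1, Real.rpow_one] at h
  linarith

lemma br_succ' (hq : 0 < q) (hq1 : q < 1) (x : ℝ) : q * br q (x + 1) = br q x + q ^ (x + 1) := by
  have h := br_combine hq 1 x
  rw [br_one hq hq1, Real.rpow_neg_one, add_comm 1 x] at h
  rw [← h, Real.rpow_add_one hq.ne']
  field_simp

lemma br_add_two (hq : 0 < q) (x : ℝ) : br q (x + 2) = q ^ 2 * br q x + q ^ (-x) * br q 2 := by
  have h := br_combine hq x 2
  rw [Real.rpow_two] at h
  linarith

lemma br_add_two' (hq : 0 < q) (x : ℝ) : q ^ 2 * br q (x + 1) = br q (x - 1) + q ^ (x + 1) * br q 2 := by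
  have h := br_combine hq 2 (x - 1)
  rw [show 2 + (x - 1) = x + 1 by ring, Real.rpow_neg hq.le, Real.rpow_two] at h
  have e : q ^ (x + 1) = q ^ 2 * q ^ (x - 1) := by
    rw [← Real.rpow_two, ← Real.rpow_add hq]
    ring_nf
  rw [← h, e]
  field_simp

/-- The bracket identity behind `cross_Bs_mid`: with `a = l-m` and `b = l+m`, the first two terms on
the right form the bracket in `Azero`. -/
lemma br_mul_br (hq : 0 < q) (hq1 : q < 1) (a b : ℝ) : br q (a + 1) * br q b =
    br q (a + b) - q ^ (b + 1) * br q 2 * br q a + q ^ 2 * br q a * br q (b + 1) := by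
  have h1 := br_combine hq a b
  have h2 := br_succ hq hq1 a
  have h3 := br_succ' hq hq1 b
  have h4 := br_two hq hq1
  have h5 : q * br q 2 = 1 + q ^ 2 := by
    rw [h4]
    field_simp
  have e : q ^ (b + 1) = q * q ^ b := by rw [Real.rpow_add_one hq.ne', mul_comm]
  rw [h2, ← h1, e]
  rw [e] at h3
  linear_combination (-q * br q a) * h3 + q ^ b * br q a * h5

variable {N l m : ℝ}

/-- The components of target spin `l+1`, `l` and `l-1` of `E x₁ = q⁻¹ x₁ E` are this and the next
two lemmas. The families `cross_A` and `cross_Bs` play the same role for `x₀` and `-q x₋₁`. Once the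
roots of brackets are separated by `rt`, both sides here have the same factors. -/
lemma cross_B_top (hq : 0 < q) (hq1 : q < 1) (h1 : m ≤ l) (h2 : -m ≤ l) :
    eC q (l + 1) (m + 1) * Bplus q s N l m = q⁻¹ * Bplus q s N l (m + 1) * eC q l m := by
  rw [eC_eq hq hq1 (x := l - m) (y := l + m + 3) (by ring) (by ring) (by linarith),
    eC_eq hq hq1 rfl rfl (by linarith), Bplus_eq hq hq1 rfl rfl rfl rfl (by linarith),
    Bplus_eq hq hq1 (t := -l + m + 1) (x := l + m + 2) (y := l + m + 3) (by ring) (by ring)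
      (by ring) rfl (by linarith), Real.rpow_add_one hq.ne']
  field_simp

lemma cross_B_mid (hq : 0 < q) (hq1 : q < 1) (h1 : m + 2 ≤ l) :
    eC q l (m + 1) * Bzero q s N l m = q⁻¹ * Bzero q s N l (m + 1) * eC q l m := by
  rw [eC_eq hq hq1 (x := l - m - 1) (y := l + m + 2) (by ring) (by ring) (by linarith),
    eC_eq hq hq1 rfl rfl (by linarith), Bzero_eq' hq hq1 rfl rfl rfl (by linarith),
    Bzero_eq' hq hq1 (t := m + 2 + 1) (x := l - m - 1) (y := l + m + 2) (by ring) (by ring)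
      (by ring) (by linarith), Real.rpow_add_one hq.ne']
  field_simp

lemma cross_B_low (hq : 0 < q) (hq1 : q < 1) (h1 : m + 3 ≤ l) :
    eC q (l - 1) (m + 1) * Bminus q s N l m = q⁻¹ * Bminus q s N l (m + 1) * eC q l m := by
  rw [eC_eq hq hq1 (x := l - m - 2) (y := l + m + 1) (by ring) (by ring) (by linarith),
    eC_eq hq hq1 rfl rfl (by linarith), Bminus_eq hq hq1 rfl rfl rfl (by linarith),
    Bminus_eq hq hq1 (t := l + m + 1 + 1) (x := l - m - 1) (y := l - m - 2) (by ring) (by ring)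
      (by ring) (by linarith), Real.rpow_add_one hq.ne' (l + m + 1)]
  field_simp

/-- After the common roots are factored out, the identity is `[l-m+1] = q[l-m] + q^{-(l-m)}`. -/
lemma cross_A_top (hq : 0 < q) (hq1 : q < 1) (h1 : m ≤ l) (h2 : -m ≤ l) :
    eC q (l + 1) m * Aplus q s N l m =
      Aplus q s N l (m + 1) * eC q l m + rt q 2 * q ^ m * Bplus q s N l m := by
  rw [eC_eq hq hq1 (x := l - m + 1) (y := l + m + 2) (by ring) (by ring) (by linarith),
    eC_eq hq hq1 rfl rfl (by linarith), Aplus_eq hq hq1 rfl rfl rfl (by linarith),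
    Aplus_eq hq hq1 (x := l - m) (y := l + m + 2) (by ring) (by ring) rfl (by linarith),
    Bplus_eq hq hq1 (t := -(l - m)) (by ring) rfl rfl rfl (by linarith),
    Real.rpow_add_one hq.ne']
  have s1 := rt_sq hq hq1 (x := l - m + 1) (by linarith)
  have s0 := rt_sq hq hq1 (x := l - m) (by linarith)
  have id := br_succ hq hq1 (l - m)
  linear_combination q ^ m * rt q 2 * α q s N (l + 1) * rt q (l + m + 1) * rt q (l + m + 2) *
    (s1 - q * s0 + id)

lemma cross_A_mid (hq : 0 < q) (hq1 : q < 1) (h1 : m + 1 ≤ l) :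
    eC q l m * Azero q s N l m =
      Azero q s N l (m + 1) * eC q l m + rt q 2 * q ^ m * Bzero q s N l m := by
  rw [eC_eq hq hq1 rfl rfl (by linarith), Bzero_eq' hq hq1 rfl rfl rfl (by linarith), Azero, Azero,
    show l + (m + 1) + 1 = l + m + 1 + 1 by ring, Real.rpow_add_one hq.ne' (l + m + 1)]
  have s2 := rt_sq hq hq1 (x := 2) (by norm_num)
  have id := br_succ hq hq1 (l - (m + 1))
  rw [show l - (m + 1) + 1 = l - m by ring] at id
  have e : q ^ (l + m + 1) * q ^ (-(l - (m + 1))) = q ^ m * q ^ (m + 2) := by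
    rw [← Real.rpow_add hq, ← Real.rpow_add hq]
    ring_nf
  linear_combination rt q (l - m) * rt q (l + m + 1) * β q s N l *
    (-(q ^ (l + m + 1) * br q 2) * id + q ^ m * q ^ (m + 2) * s2 - br q 2 * e)

lemma cross_A_low (hq : 0 < q) (hq1 : q < 1) (h1 : m + 2 ≤ l) (h2 : -m ≤ l) :
    eC q (l - 1) m * Aplus q s N (l - 1) m =
      Aplus q s N (l - 1) (m + 1) * eC q l m + rt q 2 * q ^ m * Bminus q s N l m := by
  rw [eC_eq hq hq1 (x := l - m - 1) (y := l + m) (by ring) (by ring) (by linarith),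
    eC_eq hq hq1 rfl rfl (by linarith),
    Aplus_eq hq hq1 (x := l - m) (y := l + m) (l' := l) (by ring) (by ring) (by ring) (by linarith),
    Aplus_eq hq hq1 (x := l - m - 1) (y := l + m + 1) (l' := l) (by ring) (by ring) (by ring)
      (by linarith),
    Bminus_eq hq hq1 rfl rfl rfl (by linarith), Real.rpow_add_one hq.ne' m]
  have s1 := rt_sq hq hq1 (x := l + m + 1) (by linarith)
  have s0 := rt_sq hq hq1 (x := l + m) (by linarith)
  have id := br_succ' hq hq1 (l + m)
  linear_combination q ^ m * rt q 2 * α q s N l * rt q (l - m) * rt q (l - m - 1) *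
    (s0 - q * s1 - id)

lemma cross_Bs_top (hq : 0 < q) (hq1 : q < 1) (h1 : m ≤ l) :
    eC q (l + 1) (m - 1) * Bminus q s N (l + 1) (m - 1) =
      q * Bminus q s N (l + 1) m * eC q l m - q * rt q 2 * q ^ m * Aplus q s N l m := by
  rw [eC_eq hq hq1 (x := l - m + 2) (y := l + m + 1) (by ring) (by ring) (by linarith),
    eC_eq hq hq1 rfl rfl (by linarith), Aplus_eq hq hq1 rfl rfl rfl (by linarith),
    Bminus_eq hq hq1 (t := l + m + 1) (x := l - m + 2) (y := l - m + 1) (by ring) (by ring)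
      (by ring) (by linarith),
    Bminus_eq hq hq1 (t := l + m + 1 + 1) (x := l - m + 1) (y := l - m) (by ring) (by ring)
      (by ring) (by linarith), Real.rpow_add_one hq.ne' (l + m + 1)]
  have s2 := rt_sq hq hq1 (x := 2) (by norm_num)
  have s3 := rt_sq hq hq1 (x := l - m + 2) (by linarith)
  have s0 := rt_sq hq hq1 (x := l - m) (by linarith)
  have id := br_add_two hq (l - m)
  have e : q ^ (l + m + 1) * q ^ (-(l - m)) = q * (q ^ m * q ^ m) := by
    rw [← Real.rpow_add hq, ← Real.rpow_add hq, mul_comm q, ← Real.rpow_add_one hq.ne']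
    ring_nf
  linear_combination α q s N (l + 1) * rt q (l - m + 1) * rt q (l + m + 1) *
    (-q ^ (l + m + 1) * s3 + q ^ 2 * q ^ (l + m + 1) * s0 + q * q ^ m * q ^ m * s2
      - q ^ (l + m + 1) * id - br q 2 * e)

lemma cross_Bs_mid (hq : 0 < q) (hq1 : q < 1) (h1 : m ≤ l) (h2 : -m ≤ l) :
    eC q l (m - 1) * Bzero q s N l (m - 1) =
      q * Bzero q s N l m * eC q l m - q * rt q 2 * q ^ m * Azero q s N l m := by
  rw [eC_eq hq hq1 (x := l - m + 1) (y := l + m) (by ring) (by ring) (by linarith),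
    eC_eq hq hq1 rfl rfl (by linarith), Bzero_eq' hq hq1 (t := m + 2) rfl rfl rfl (by linarith),
    Bzero_eq' hq hq1 (t := m + 1) (x := l - m + 1) (y := l + m) (by ring) (by ring) (by ring)
      (by linarith), Azero, show m + 2 = m + 1 + 1 by ring, Real.rpow_add_one hq.ne' (m + 1),
    Real.rpow_add_one hq.ne' m]
  have s1 := rt_sq hq hq1 (x := l - m + 1) (by linarith)
  have s0 := rt_sq hq hq1 (x := l - m) (by linarith)
  have t1 := rt_sq hq hq1 (x := l + m + 1) (by linarith)
  have t0 := rt_sq hq hq1 (x := l + m) (by linarith)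
  have id := br_mul_br hq hq1 (l - m) (l + m)
  rw [show l - m + (l + m) = 2 * l by ring] at id
  linear_combination q ^ m * q * rt q 2 * β q s N l *
    (-(rt q (l + m) * rt q (l + m)) * s1 - br q (l - m + 1) * t0 +
      q ^ 2 * (rt q (l + m + 1) * rt q (l + m + 1)) * s0 + q ^ 2 * br q (l - m) * t1 - id)

lemma cross_Bs_low (hq : 0 < q) (hq1 : q < 1) (h1 : m + 1 ≤ l) (h2 : -m + 1 ≤ l) :
    eC q (l - 1) (m - 1) * Bplus q s N (l - 1) (m - 1) =
      q * Bplus q s N (l - 1) m * eC q l m - q * rt q 2 * q ^ m * Aplus q s N (l - 1) m := by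
  rw [eC_eq hq hq1 (x := l - m) (y := l + m - 1) (by ring) (by ring) (by linarith),
    eC_eq hq hq1 rfl rfl (by linarith),
    Aplus_eq hq hq1 (x := l - m) (y := l + m) (l' := l) (by ring) (by ring) (by ring) (by linarith),
    Bplus_eq hq hq1 (t := -(l - m)) (x := l + m - 1) (y := l + m) (l' := l) (by ring) (by ring)
      (by ring) (by ring) (by linarith),
    Bplus_eq hq hq1 (t := -(l - m) + 1) (x := l + m) (y := l + m + 1) (l' := l) (by ring) (by ring)
      (by ring) (by ring) (by linarith), Real.rpow_add_one hq.ne' (-(l - m))]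
  have s2 := rt_sq hq hq1 (x := 2) (by norm_num)
  have t1 := rt_sq hq hq1 (x := l + m + 1) (by linarith)
  have t0 := rt_sq hq hq1 (x := l + m - 1) (by linarith)
  have id := br_add_two' hq (l + m)
  have e : q ^ (-(l - m)) * q ^ (l + m + 1) = q * (q ^ m * q ^ m) := by
    rw [← Real.rpow_add hq, ← Real.rpow_add hq, mul_comm q, ← Real.rpow_add_one hq.ne']
    ring_nf
  linear_combination α q s N l * rt q (l - m) * rt q (l + m) *
    (q ^ (-(l - m)) * t0 - q ^ 2 * q ^ (-(l - m)) * t1 + q * q ^ m * q ^ m * s2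
      - q ^ (-(l - m)) * id - br q 2 * e)

end CrossCoefficients

end Podles

end

noncomputable section

namespace Podles

open NCG

variable {n : ℤ} {q s : ℝ}

/-! ## Equivariance -/

section Equivariance

variable (n s) in
lemma repGen_ket_mem (hq : 0 < q) (hq1 : q < 1) (g : Gen) {ε : ℤˣ} {L M : ℤ} (h : hilbAdm n L M) :
    repGen n s hq hq1 g (ket n ε L M) ∈ ketSpan n := by
  have hk : ∀ (c : ℂ) L M, c • ket n ε L M ∈ ketSpan n := fun c L M =>
    Submodule.smul_mem _ c (ketS n ε L M).2
  cases g with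
  | A =>
    rw [repGen, sub_apply, smul_apply, smul_apply, one_apply_eq_self, blk₁₁_ket n s hq hq1 h]
    exact sub_mem (Submodule.smul_mem _ _ (add_mem (add_mem (hk _ _ _) (hk _ _ _)) (hk _ _ _)))
      (hk _ _ _)
  | B =>
    rw [repGen, smul_apply, blk₁₂_ket n s hq hq1 h]
    exact Submodule.smul_mem _ _ (add_mem (add_mem (hk _ _ _) (hk _ _ _)) (hk _ _ _))
  | Bs =>
    rw [repGen, smul_apply, blk₂₁_ket n s hq hq1 h]
    exact Submodule.smul_mem _ _ (add_mem (add_mem (hk _ _ _) (hk _ _ _)) (hk _ _ _))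

lemma map_mem_ketSpan {T : Hilb n →L[ℂ] Hilb n}
    (h : ∀ ε L M, hilbAdm n L M → T (ket n ε L M) ∈ ketSpan n) {v : Hilb n} (hv : v ∈ ketSpan n) :
    T v ∈ ketSpan n := by
  have key : ∀ v : ketSpan n, T v ∈ ketSpan n := fun v => by
    induction v using ketSpan_induction with
    | zero => simp
    | add x y hx hy => rw [Submodule.coe_add, map_add]; exact add_mem hx hy
    | smul c x hx => rw [Submodule.coe_smul, map_smul]; exact Submodule.smul_mem _ c hx
    | ket ε L M hL => exact h ε L M hL
  exact key ⟨v, hv⟩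

variable (n s) in
lemma rep_mem (hq : 0 < q) (hq1 : q < 1) (hn : n ≠ 0) (a : Alg q s) :
    ∀ v ∈ ketSpan n, rep n s hq hq1 hn a v ∈ ketSpan n := by
  induction a using alg_induction with
  | h_scalar z =>
    intro v hv
    rw [AlgHomClass.commutes, Algebra.algebraMap_eq_smul_one, smul_apply, one_apply_eq_self]
    exact Submodule.smul_mem _ z hv
  | h_gen g =>
    intro v hv
    rw [rep_gen]
    exact map_mem_ketSpan (fun ε L M h => repGen_ket_mem n s hq hq1 g h) hv
  | h_mul a b ha hb =>
    intro v hv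
    rw [map_mul]
    exact ha _ (hb v hv)
  | h_add a b ha hb =>
    intro v hv
    rw [map_add]
    exact add_mem (ha v hv) (hb v hv)

variable (n s) in
/-- The representation on the span of the basis vectors. -/
def repV (hq : 0 < q) (hq1 : q < 1) (hn : n ≠ 0) : Alg q s →ₐ[ℂ] Module.End ℂ (ketSpan n) :=
  AlgHom.ofLinearMap
    { toFun := fun a =>
        ((rep n s hq hq1 hn a : Hilb n →L[ℂ] Hilb n) : Hilb n →ₗ[ℂ] Hilb n).restrict
          (rep_mem n s hq hq1 hn a)
      map_add' := fun a b => LinearMap.ext fun v => Subtype.ext (by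
        change rep n s hq hq1 hn (a + b) v = rep n s hq hq1 hn a v + rep n s hq hq1 hn b v
        rw [map_add]; rfl)
      map_smul' := fun c a => LinearMap.ext fun v => Subtype.ext (by
        change rep n s hq hq1 hn (c • a) v = c • rep n s hq hq1 hn a v
        rw [map_smul]; rfl) }
    (LinearMap.ext fun v => Subtype.ext (by
      change rep n s hq hq1 hn 1 v = v
      rw [map_one]; rfl))
    fun a b => LinearMap.ext fun v => Subtype.ext (by
      change rep n s hq hq1 hn (a * b) v = rep n s hq hq1 hn a (rep n s hq hq1 hn b v)
      rw [map_mul]; rfl)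

variable {hq : 0 < q} {hq1 : q < 1} {hn : n ≠ 0}

lemma repV_x₁ {L M : ℤ} (h : hilbAdm n L M) (ε : ℤˣ) {m : ℝ} (hm : m = M / 2) :
    repV n s hq hq1 hn (x₁ q s) (ketS n ε L M) =
      (Bplus q s (spin n ε) (L / 2) m : ℂ) • ketS n ε (L + 2) (M + 2) +
      (Bzero q s (spin n ε) (L / 2) m : ℂ) • ketS n ε L (M + 2) +
      (Bminus q s (spin n ε) (L / 2) m : ℂ) • ketS n ε (L - 2) (M + 2) :=
  Subtype.ext ((isPodlesRep_rep n s hq hq1 hn).x₁_ket ε ⟨(L, M), h⟩ L M _ _ rfl rfl hm)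

lemma repV_x₀ {L M : ℤ} (h : hilbAdm n L M) (ε : ℤˣ) {m : ℝ} (hm : m = M / 2) :
    repV n s hq hq1 hn (x₀ q s) (ketS n ε L M) =
      (Aplus q s (spin n ε) (L / 2) m : ℂ) • ketS n ε (L + 2) M +
      (Azero q s (spin n ε) (L / 2) m : ℂ) • ketS n ε L M +
      (Aplus q s (spin n ε) (L / 2 - 1) m : ℂ) • ketS n ε (L - 2) M :=
  Subtype.ext ((isPodlesRep_rep n s hq hq1 hn).x₀_ket ε ⟨(L, M), h⟩ L M _ _ rfl rfl hm)

lemma repV_xm₁ {L M : ℤ} (h : hilbAdm n L M) (ε : ℤˣ) {m : ℝ} (hm : m = M / 2) :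
    repV n s hq hq1 hn (-((q : ℂ) • xm₁ q s)) (ketS n ε L M) =
      (Bminus q s (spin n ε) (L / 2 + 1) (m - 1) : ℂ) • ketS n ε (L + 2) (M - 2) +
      (Bzero q s (spin n ε) (L / 2) (m - 1) : ℂ) • ketS n ε L (M - 2) +
      (Bplus q s (spin n ε) (L / 2 - 1) (m - 1) : ℂ) • ketS n ε (L - 2) (M - 2) :=
  Subtype.ext ((isPodlesRep_rep n s hq hq1 hn).xm₁_ket ε ⟨(L, M), h⟩ L M _ _ rfl rfl hm)

lemma cE_eq {L M : ℤ} {l m : ℝ} (hl : l = L / 2) (hm : m = M / 2) : cE q L M = eC q l m := by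
  rw [cE, eC, hl, hm]

lemma smul_ketS_congr {ε : ℤˣ} {L M L' M' : ℤ} {a b : ℂ} (hL : L = L') (hM : M = M')
    (h : hilbAdm n L' M' → a = b) : a • ketS n ε L M = b • ketS n ε L' M' := by
  subst hL hM
  exact Subtype.ext (smul_ket_congr n h)

/-- If `(l,m)` is admissible, `E|l,m⟩` may be treated as a multiple of an admissible vector. -/
lemma map_cE_congr {L M : ℤ} (h : hilbAdm n L M) {v w : ketSpan n}
    (hv : hilbAdm n L (M + 2) → v = w) : (cE q L M : ℂ) • v = (cE q L M : ℂ) • w := by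
  by_cases h' : hilbAdm n L (M + 2)
  · rw [hv h']
  · rw [cE_eq_zero (n := n) (fun h'' => h' h''.2) (.inl h), Complex.ofReal_zero, zero_smul,
      zero_smul]

lemma ketMap_cE_x₁ : ketMap n (cE q) 2 * repV n s hq hq1 hn (x₁ q s) =
    (q : ℂ)⁻¹ • (repV n s hq hq1 hn (x₁ q s) * ketMap n (cE q) 2) :=
  ketSpan_hom_ext fun ε L M h => by
    obtain ⟨h1, h2⟩ := abs_le.1 (h.bounds 1).1
    rw [LinearMap.smul_apply, Module.End.mul_apply, Module.End.mul_apply, repV_x₁ h ε rfl,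
      ketMap_cE, map_smul, map_cE_congr h fun h' => repV_x₁ h' ε (m := M / 2 + 1) (by
        push_cast; ring), map_add, map_add, map_smul, map_smul, map_smul, ketMap_cE, ketMap_cE,
      ketMap_cE]
    simp only [smul_add, smul_smul]
    congr 1
    · congr 1
      · refine smul_ketS_congr rfl rfl fun h' => ?_
        have := cross_B_top (s := s) hq hq1 (N := spin n ε) (l := L / 2) (m := M / 2)
          (by linarith) (by linarith)
        rw [cE_eq (L := L + 2) (M := M + 2) (l := L / 2 + 1) (m := M / 2 + 1)
          (by push_cast; ring) (by push_cast; ring), cE_eq (L := L) (M := M) rfl rfl]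
        replace this := congrArg Complex.ofReal this
        push_cast at this ⊢
        linear_combination this
      · refine smul_ketS_congr rfl rfl fun h' => ?_
        obtain ⟨h3, h4⟩ := abs_le.1 (h'.bounds 1).1
        push_cast at h4
        have := cross_B_mid (s := s) hq hq1 (N := spin n ε) (l := L / 2) (m := M / 2)
          (by linarith)
        rw [cE_eq (L := L) (M := M + 2) (l := L / 2) (m := M / 2 + 1)
          rfl (by push_cast; ring), cE_eq (L := L) (M := M) rfl rfl]
        replace this := congrArg Complex.ofReal this
        push_cast at this ⊢
        linear_combination this
    · refine smul_ketS_congr rfl rfl fun h' => ?_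
      obtain ⟨h3, h4⟩ := abs_le.1 (h'.bounds 1).1
      push_cast at h4
      have := cross_B_low (s := s) hq hq1 (N := spin n ε) (l := L / 2) (m := M / 2)
        (by linarith)
      rw [cE_eq (L := L - 2) (M := M + 2) (l := L / 2 - 1) (m := M / 2 + 1)
        (by push_cast; ring) (by push_cast; ring), cE_eq (L := L) (M := M) rfl rfl]
      replace this := congrArg Complex.ofReal this
      push_cast at this ⊢
      linear_combination this

lemma ketMap_cE_x₀ : ketMap n (cE q) 2 * repV n s hq hq1 hn (x₀ q s) =
    (rt q 2 : ℂ) • (repV n s hq hq1 hn (x₁ q s) * ketMap n (cK q) 0) +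
      repV n s hq hq1 hn (x₀ q s) * ketMap n (cE q) 2 :=
  ketSpan_hom_ext fun ε L M h => by
    obtain ⟨h1, h2⟩ := abs_le.1 (h.bounds 1).1
    rw [LinearMap.add_apply, LinearMap.smul_apply, Module.End.mul_apply, Module.End.mul_apply,
      Module.End.mul_apply, repV_x₀ h ε rfl,
      ketMap_cE, ketMap_cK, map_smul, map_smul, repV_x₁ h ε rfl,
      map_cE_congr h fun h' => repV_x₀ h' ε (m := M / 2 + 1) (by
        push_cast; ring), map_add, map_add, map_smul, map_smul, map_smul, ketMap_cE, ketMap_cE,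
      ketMap_cE]
    simp only [smul_add, smul_smul]
    have c1 : ((Aplus q s (spin n ε) (L / 2) (M / 2) : ℂ) * cE q (L + 2) M) •
        ketS n ε (L + 2) (M + 2) = (rt q 2 * (cK q L M * Bplus q s (spin n ε) (L / 2) (M / 2)) +
          (cE q L M : ℂ) * Aplus q s (spin n ε) (L / 2) (M / 2 + 1)) •
            ketS n ε (L + 2) (M + 2) := by
      refine smul_ketS_congr rfl rfl fun h' => ?_
      have := cross_A_top (s := s) hq hq1 (N := spin n ε) (l := L / 2) (m := M / 2)
        (by linarith) (by linarith)
      rw [cE_eq (L := L + 2) (M := M) (l := L / 2 + 1) (m := M / 2)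
        (by push_cast; ring) rfl, cE_eq (L := L) (M := M) rfl rfl, cK]
      replace this := congrArg Complex.ofReal this
      push_cast at this ⊢
      linear_combination this
    have c2 : ((Azero q s (spin n ε) (L / 2) (M / 2) : ℂ) * cE q L M) •
        ketS n ε L (M + 2) = (rt q 2 * (cK q L M * Bzero q s (spin n ε) (L / 2) (M / 2)) +
          (cE q L M : ℂ) * Azero q s (spin n ε) (L / 2) (M / 2 + 1)) •
            ketS n ε L (M + 2) := by
      refine smul_ketS_congr rfl rfl fun h' => ?_
      obtain ⟨h3, h4⟩ := abs_le.1 (h'.bounds 1).1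
      push_cast at h4
      have := cross_A_mid (s := s) hq hq1 (N := spin n ε) (l := L / 2) (m := M / 2)
        (by linarith)
      rw [cE_eq (L := L) (M := M) rfl rfl, cK]
      replace this := congrArg Complex.ofReal this
      push_cast at this ⊢
      linear_combination this
    have c3 : ((Aplus q s (spin n ε) (L / 2 - 1) (M / 2) : ℂ) * cE q (L - 2) M) •
        ketS n ε (L - 2) (M + 2) = (rt q 2 * (cK q L M * Bminus q s (spin n ε) (L / 2) (M / 2)) +
          (cE q L M : ℂ) * Aplus q s (spin n ε) (L / 2 - 1) (M / 2 + 1)) •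
            ketS n ε (L - 2) (M + 2) := by
      refine smul_ketS_congr rfl rfl fun h' => ?_
      obtain ⟨h3, h4⟩ := abs_le.1 (h'.bounds 1).1
      push_cast at h4
      have := cross_A_low (s := s) hq hq1 (N := spin n ε) (l := L / 2) (m := M / 2)
        (by linarith) (by linarith)
      rw [cE_eq (L := L - 2) (M := M) (l := L / 2 - 1) (m := M / 2)
        (by push_cast; ring) rfl, cE_eq (L := L) (M := M) rfl rfl, cK]
      replace this := congrArg Complex.ofReal this
      push_cast at this ⊢
      linear_combination this
    rw [c1, c2, c3]
    simp only [add_smul]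
    abel

lemma ketMap_cE_xm₁ : ketMap n (cE q) 2 * repV n s hq hq1 hn (-((q : ℂ) • xm₁ q s)) =
    (q : ℂ) • (repV n s hq hq1 hn (-((q : ℂ) • xm₁ q s)) * ketMap n (cE q) 2) -
      ((q : ℂ) * rt q 2) • (repV n s hq hq1 hn (x₀ q s) * ketMap n (cK q) 0) :=
  ketSpan_hom_ext fun ε L M h => by
    obtain ⟨h1, h2⟩ := abs_le.1 (h.bounds 1).1
    rw [LinearMap.sub_apply, LinearMap.smul_apply, LinearMap.smul_apply, Module.End.mul_apply,
      Module.End.mul_apply, Module.End.mul_apply, repV_xm₁ h ε rfl,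
      ketMap_cE, ketMap_cK, map_smul, map_smul, repV_x₀ h ε rfl,
      map_cE_congr h fun h' => repV_xm₁ h' ε (m := M / 2 + 1) (by
        push_cast; ring), map_add, map_add, map_smul, map_smul, map_smul, ketMap_cE, ketMap_cE,
      ketMap_cE]
    simp only [smul_add, smul_smul, sub_add_cancel, add_sub_cancel_right]
    have c1 : ((Bminus q s (spin n ε) (L / 2 + 1) (M / 2 - 1) : ℂ) * cE q (L + 2) (M - 2)) •
        ketS n ε (L + 2) M = (q * (cE q L M * Bminus q s (spin n ε) (L / 2 + 1) (M / 2)) -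
          q * rt q 2 * ((cK q L M : ℂ) * Aplus q s (spin n ε) (L / 2) (M / 2))) •
            ketS n ε (L + 2) M := by
      refine smul_ketS_congr rfl rfl fun h' => ?_
      have := cross_Bs_top (s := s) hq hq1 (N := spin n ε) (l := L / 2) (m := M / 2)
        (by linarith)
      rw [cE_eq (L := L + 2) (M := M - 2) (l := L / 2 + 1) (m := M / 2 - 1)
        (by push_cast; ring) (by push_cast; ring), cE_eq (L := L) (M := M) rfl rfl, cK]
      replace this := congrArg Complex.ofReal this
      push_cast at this ⊢
      linear_combination this
    have c2 : ((Bzero q s (spin n ε) (L / 2) (M / 2 - 1) : ℂ) * cE q L (M - 2)) •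
        ketS n ε L M = (q * (cE q L M * Bzero q s (spin n ε) (L / 2) (M / 2)) -
          q * rt q 2 * ((cK q L M : ℂ) * Azero q s (spin n ε) (L / 2) (M / 2))) •
            ketS n ε L M := by
      refine smul_ketS_congr rfl rfl fun h' => ?_
      have := cross_Bs_mid (s := s) hq hq1 (N := spin n ε) (l := L / 2) (m := M / 2)
        (by linarith) (by linarith)
      rw [cE_eq (L := L) (M := M - 2) (l := L / 2) (m := M / 2 - 1)
        rfl (by push_cast; ring), cE_eq (L := L) (M := M) rfl rfl, cK]
      replace this := congrArg Complex.ofReal this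
      push_cast at this ⊢
      linear_combination this
    have c3 : ((Bplus q s (spin n ε) (L / 2 - 1) (M / 2 - 1) : ℂ) * cE q (L - 2) (M - 2)) •
        ketS n ε (L - 2) M = (q * (cE q L M * Bplus q s (spin n ε) (L / 2 - 1) (M / 2)) -
          q * rt q 2 * ((cK q L M : ℂ) * Aplus q s (spin n ε) (L / 2 - 1) (M / 2))) •
            ketS n ε (L - 2) M := by
      refine smul_ketS_congr rfl rfl fun h' => ?_
      obtain ⟨h3, h4⟩ := abs_le.1 (h'.bounds 1).1
      push_cast at h3 h4
      have := cross_Bs_low (s := s) hq hq1 (N := spin n ε) (l := L / 2) (m := M / 2)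
        (by linarith) (by linarith)
      rw [cE_eq (L := L - 2) (M := M - 2) (l := L / 2 - 1) (m := M / 2 - 1)
        (by push_cast; ring) (by push_cast; ring), cE_eq (L := L) (M := M) rfl rfl, cK]
      replace this := congrArg Complex.ofReal this
      push_cast at this ⊢
      linear_combination this
    rw [c1, c2, c3]
    simp only [sub_smul]
    abel

lemma ketMap_cK_x₁ : ketMap n (cK q) 0 * repV n s hq hq1 hn (x₁ q s) =
    (q : ℂ) • (repV n s hq hq1 hn (x₁ q s) * ketMap n (cK q) 0) :=
  ketSpan_hom_ext fun ε L M h => by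
    rw [LinearMap.smul_apply, Module.End.mul_apply, Module.End.mul_apply, repV_x₁ h ε rfl,
      ketMap_cK, map_smul, repV_x₁ h ε rfl, map_add, map_add, map_smul, map_smul, map_smul,
      ketMap_cK, ketMap_cK, ketMap_cK, cK_add_two hq _ L, cK_add_two hq _ L, cK_add_two hq _ L]
    push_cast
    module

lemma ketMap_cK_x₀ : ketMap n (cK q) 0 * repV n s hq hq1 hn (x₀ q s) =
    repV n s hq hq1 hn (x₀ q s) * ketMap n (cK q) 0 :=
  ketSpan_hom_ext fun ε L M h => by
    rw [Module.End.mul_apply, Module.End.mul_apply, repV_x₀ h ε rfl,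
      ketMap_cK, map_smul, repV_x₀ h ε rfl, map_add, map_add, map_smul, map_smul, map_smul,
      ketMap_cK, ketMap_cK, ketMap_cK]
    unfold cK
    module

lemma ketMap_cK_xm₁ : ketMap n (cK q) 0 * repV n s hq hq1 hn (-((q : ℂ) • xm₁ q s)) =
    (q : ℂ)⁻¹ • (repV n s hq hq1 hn (-((q : ℂ) • xm₁ q s)) * ketMap n (cK q) 0) :=
  ketSpan_hom_ext fun ε L M h => by
    have hq' : (q : ℂ) ≠ 0 := Complex.ofReal_ne_zero.2 hq.ne'
    have e := cK_add_two hq L L (M - 2)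
    rw [sub_add_cancel] at e
    rw [LinearMap.smul_apply, Module.End.mul_apply, Module.End.mul_apply, repV_xm₁ h ε rfl,
      ketMap_cK, map_smul, repV_xm₁ h ε rfl, map_add, map_add, map_smul, map_smul, map_smul,
      ketMap_cK, ketMap_cK, ketMap_cK, e, Complex.ofReal_mul, mul_smul (q : ℂ),
      inv_smul_smul₀ hq']
    unfold cK
    module

end Equivariance

end Podles

end

noncomputable section

namespace Podles

open NCG

variable {n : ℤ} {q s : ℝ}

/-! ### The crossed product relations -/

section Crossed

/-- It reduces the covariance relation for `K⁻¹` to that for `K`. -/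
lemma actK_actKinv (s : ℝ) (hq : 0 < q) (a : Alg q s) : actK s hq (actKinv s hq a) = a := by
  have hq' : (q : ℂ) ≠ 0 := Complex.ofReal_ne_zero.2 hq.ne'
  induction a using alg_induction with
  | h_scalar z => rw [AlgHom.commutes, AlgHom.commutes]
  | h_gen g =>
    rw [actKinv_gen]
    cases g
    · exact actK_gen hq .A
    · change actK s hq ((q : ℂ)⁻¹ • gen q s .B) = _
      rw [map_smul, actK_gen hq .B, inv_smul_smul₀ hq']
    · change actK s hq ((q : ℂ) • gen q s .Bs) = _
      rw [map_smul, actK_gen hq .Bs, smul_inv_smul₀ hq']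
  | h_mul a b ha hb => rw [map_mul, map_mul, ha, hb]
  | h_add a b ha hb => rw [map_add, map_add, ha, hb]

/-- The operator `T` satisfies `T a = (T ▷ a) K + (K⁻¹ ▷ a) T`. -/
def IsTwisted (ρ : Alg q s →ₐ[ℂ] Module.End ℂ (ketSpan n)) (hq : 0 < q)
    (T K : Module.End ℂ (ketSpan n)) (t : Alg q s →ₗ[ℂ] Alg q s) (a : Alg q s) : Prop :=
  T * ρ a = ρ (t a) * K + ρ (actKinv s hq a) * T

variable {hq : 0 < q} {hq1 : q < 1} {hn : n ≠ 0}

lemma gen_B_eq (q s : ℝ) : gen q s .B = (√(1 + q ^ 2) : ℂ)⁻¹ • x₁ q s := by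
  rw [x₁, inv_smul_smul₀ (sqrt_ne q)]

lemma gen_Bs_eq (s : ℝ) (hq : 0 < q) :
    gen q s .Bs = (√(1 + q ^ 2) : ℂ)⁻¹ • (-((q : ℂ) • xm₁ q s)) := by
  rw [neg_q_smul_xm₁ s hq, inv_smul_smul₀ (sqrt_ne q)]

lemma x₀_eq (q s : ℝ) :
    x₀ q s = -((1 + (q : ℂ) ^ 2) • gen q s .A - (1 - (s : ℂ) ^ 2) • 1) := by
  rw [x₀]
  abel

lemma sqrt_one_add_sq (hq : 0 < q) (hq1 : q < 1) : √(1 + q ^ 2) = √q * rt q 2 := by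
  rw [rt, br_two hq hq1, ← Real.sqrt_mul hq.le]
  congr 1
  field_simp

lemma uqRep_K_mul_repV (a : Alg q s) : (uqRep hq hq1 n).K * repV n s hq hq1 hn a =
    repV n s hq hq1 hn (actK s hq a) * (uqRep hq hq1 n).K := by
  induction a using alg_induction with
  | h_scalar z =>
    rw [AlgHom.commutes, AlgHom.commutes, AlgHom.commutes]
    exact (Algebra.commutes (A := Module.End ℂ (ketSpan n)) z _).symm
  | h_gen g =>
    change ketMap n (cK q) 0 * _ = _ * ketMap n (cK q) 0
    rw [actK_gen]
    cases g
    · simp only [gen_A_eq, map_smul, map_sub, map_one]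
      rw [mul_smul_comm, smul_mul_assoc, mul_sub, sub_mul, ketMap_cK_x₀, mul_smul_comm,
        smul_mul_assoc, mul_one, one_mul]
    · simp only [gen_B_eq, map_smul]
      rw [mul_smul_comm, ketMap_cK_x₁, smul_mul_assoc, smul_mul_assoc, smul_comm]
    · simp only [gen_Bs_eq s hq, map_smul]
      rw [mul_smul_comm, ketMap_cK_xm₁, smul_mul_assoc, smul_mul_assoc, smul_comm]
  | h_mul a b ha hb => rw [map_mul, map_mul, map_mul, ← mul_assoc, ha, mul_assoc, hb, mul_assoc]
  | h_add a b ha hb => rw [map_add, map_add, map_add, mul_add, add_mul, ha, hb]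

lemma uqRep_Kinv_mul_repV (a : Alg q s) : (uqRep hq hq1 n).Kinv * repV n s hq hq1 hn a =
    repV n s hq hq1 hn (actKinv s hq a) * (uqRep hq hq1 n).Kinv := by
  have h := uqRep_K_mul_repV (hq := hq) (hq1 := hq1) (hn := hn) (actKinv s hq a)
  rw [actK_actKinv] at h
  calc _ = (uqRep hq hq1 n).Kinv * (repV n s hq hq1 hn a * (uqRep hq hq1 n).K) *
        (uqRep hq hq1 n).Kinv := by
        rw [mul_assoc, mul_assoc, (uqRep hq hq1 n).K_Kinv, mul_one]
    _ = _ := by rw [← h, ← mul_assoc, (uqRep hq hq1 n).Kinv_K, one_mul]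

/-- For a product `ab`, `T` is moved past `a` and then past `b`; the factor `K` left by the first
move passes `b` by covariance. This reproduces the twisted Leibniz rule of `t`, so the relation
propagates from the generators. -/
lemma isTwisted_of_gen {T : Module.End ℂ (ketSpan n)} {t : Alg q s →ₗ[ℂ] Alg q s}
    (hone : t 1 = 0)
    (hmul : ∀ a b, t (a * b) = t a * actK s hq b + actKinv s hq a * t b)
    (h : ∀ g, IsTwisted (repV n s hq hq1 hn) hq T (uqRep hq hq1 n).K t (gen q s g))
    (a : Alg q s) : IsTwisted (repV n s hq hq1 hn) hq T (uqRep hq hq1 n).K t a := by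
  unfold IsTwisted at *
  induction a using alg_induction with
  | h_scalar z =>
    have ht : t (algebraMap ℂ _ z) = 0 := by
      rw [Algebra.algebraMap_eq_smul_one, map_smul, hone, smul_zero]
    rw [ht, AlgHom.commutes, AlgHom.commutes, AlgHom.commutes, map_zero, zero_mul, zero_add]
    exact (Algebra.commutes (A := Module.End ℂ (ketSpan n)) z _).symm
  | h_gen g => exact h g
  | h_mul a b ha hb =>
    rw [map_mul, hmul, map_add, map_mul, map_mul, map_mul, map_mul, ← mul_assoc, ha, add_mul,
      mul_assoc _ (uqRep hq hq1 n).K, uqRep_K_mul_repV, mul_assoc _ T, hb]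
    simp only [mul_add, add_mul, mul_assoc, add_assoc]
  | h_add a b ha hb =>
    rw [map_add, map_add, map_add, map_add, map_add, mul_add, add_mul, add_mul, ha, hb]
    abel

lemma isTwisted_E_gen (g : Gen) : IsTwisted (repV n s hq hq1 hn) hq (uqRep hq hq1 n).E
    (uqRep hq hq1 n).K (actE s hq) (gen q s g) := by
  have hr : (√q : ℂ) ≠ 0 := Complex.ofReal_ne_zero.2 (Real.sqrt_pos.2 hq).ne'
  have hr2 : (√q : ℂ) ^ 2 = q := by exact_mod_cast Real.sq_sqrt hq.le
  -- `√(1+q²) = √q √[2]` reconciles the normalization of `x₁` with the factor `√[2]` in the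
  -- commutation of `E` with `x₀` and `x₋₁`.
  have hs := congrArg Complex.ofReal (sqrt_one_add_sq hq hq1)
  rw [Complex.ofReal_mul] at hs
  have hs2 : (√(1 + q ^ 2 : ℝ) : ℂ) ^ 2 = 1 + (q : ℂ) ^ 2 := by
    exact_mod_cast Real.sq_sqrt (show (0 : ℝ) ≤ 1 + q ^ 2 by positivity)
  have hs0 := sqrt_ne q
  change ketMap n (cE q) 2 * _ = _ * ketMap n (cK q) 0 + _ * ketMap n (cE q) 2
  rw [actE_gen, actKinv_gen]
  cases g
  · simp only [valE, gen_A_eq, gen_B_eq, ← neg_smul, map_smul, map_sub, map_one]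
    rw [mul_smul_comm, mul_sub, ketMap_cE_x₀]
    simp only [mul_smul_comm, smul_mul_assoc, sub_mul, mul_one, one_mul]
    generalize repV n s hq hq1 hn (x₁ q s) * ketMap n (cK q) 0 = P
    generalize repV n s hq hq1 hn (x₀ q s) * ketMap n (cE q) 2 = Q
    rw [← hs2]
    match_scalars
    · field_simp
    · rw [hs] at hs0 ⊢
      field_simp
    · field_simp
  · simp only [valE, gen_B_eq, map_smul, map_zero]
    rw [mul_smul_comm, ketMap_cE_x₁, zero_mul, zero_add, smul_mul_assoc, smul_mul_assoc,
      smul_comm]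
  · simp only [valE]
    rw [show (1 + (q : ℂ) ^ 2) • gen q s .A - (1 - (s : ℂ) ^ 2) • 1 = - x₀ q s by
      rw [x₀_eq, neg_neg]]
    simp only [gen_Bs_eq s hq, smul_neg (√q : ℂ), ← neg_smul (√q : ℂ), map_smul]
    rw [mul_smul_comm, ketMap_cE_xm₁]
    simp only [smul_mul_assoc]
    generalize repV n s hq hq1 hn (x₀ q s) * ketMap n (cK q) 0 = P
    generalize repV n s hq hq1 hn (-((q : ℂ) • xm₁ q s)) * ketMap n (cE q) 2 = Q
    rw [← hr2, hs]
    rw [hs] at hs0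
    match_scalars
    · field_simp
    · have : (rt q 2 : ℂ) ≠ 0 := right_ne_zero_of_mul hs0
      field_simp

lemma actE_one (s : ℝ) (hq : 0 < q) : actE s hq 1 = 0 := by
  have h := actE_mul (s := s) hq 1 1
  rw [map_one (actK s hq), map_one (actKinv s hq), mul_one, mul_one, one_mul] at h
  exact left_eq_add.1 h

lemma actF_one (s : ℝ) (hq : 0 < q) : actF s hq 1 = 0 := by
  have h := actF_mul (s := s) hq 1 1
  rw [map_one (actK s hq), map_one (actKinv s hq), mul_one, mul_one, one_mul] at h
  exact left_eq_add.1 h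

lemma isTwisted_E (a : Alg q s) : IsTwisted (repV n s hq hq1 hn) hq (uqRep hq hq1 n).E
    (uqRep hq hq1 n).K (actE s hq) a :=
  isTwisted_of_gen (actE_one s hq) (actE_mul hq) isTwisted_E_gen a

lemma inner_repV (a : Alg q s) (v w : ketSpan n) :
    ⟪repV n s hq hq1 hn a v, w⟫_ℂ = ⟪v, repV n s hq hq1 hn (star a) w⟫_ℂ := by
  change ⟪rep n s hq hq1 hn a v, (w : Hilb n)⟫_ℂ = ⟪(v : Hilb n), rep n s hq hq1 hn (star a) w⟫_ℂ
  rw [map_star, ContinuousLinearMap.star_eq_adjoint, ContinuousLinearMap.adjoint_inner_right]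

/-- The adjoint of the relation for `E`. -/
lemma uqRep_F_mul_repV (a : Alg q s) :
    (uqRep hq hq1 n).F * repV n s hq hq1 hn (star (actKinv s hq a)) =
      repV n s hq hq1 hn (star a) * (uqRep hq hq1 n).F -
        (uqRep hq hq1 n).K * repV n s hq hq1 hn (star (actE s hq a)) := by
  refine LinearMap.ext fun w => ext_inner_left ℂ fun v => ?_
  have h := congrArg (fun T => ⟪T v, w⟫_ℂ) (isTwisted_E (hq := hq) (hq1 := hq1) (hn := hn) a)
  simp only [LinearMap.add_apply, Module.End.mul_apply, inner_add_left] at h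
  rw [(uqRep hq hq1 n).E_adj, inner_repV, inner_repV, inner_repV, (uqRep hq hq1 n).E_adj,
    (uqRep hq hq1 n).K_symm] at h
  rw [LinearMap.sub_apply, inner_sub_right]
  exact eq_sub_of_add_eq' h.symm

lemma star_x₀ (q s : ℝ) : star (x₀ q s) = x₀ q s := by
  simp [x₀, star_gen, Gen.adj]

lemma actK_x₀ (s : ℝ) (hq : 0 < q) : actK s hq (x₀ q s) = x₀ q s := by
  have h : actK s hq (gen q s .A) = gen q s .A := actK_gen hq .A
  simp [x₀, h]

/-- No new coefficient computation is needed. The adjoint of the relation for `E` at the generator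
`g*` is a relation for `F g`, since `(K⁻¹ ▷ g*)*` is a multiple of `g`; moving `K` to the right by
covariance gives the claim. -/
lemma isTwisted_F_gen (g : Gen) : IsTwisted (repV n s hq hq1 hn) hq (uqRep hq hq1 n).F
    (uqRep hq hq1 n).K (actF s hq) (gen q s g) := by
  have hr : (√q : ℂ) ≠ 0 := Complex.ofReal_ne_zero.2 (Real.sqrt_pos.2 hq).ne'
  have hr2 : (√q : ℂ) ^ 2 = q := by exact_mod_cast Real.sq_sqrt hq.le
  have hq' : (q : ℂ) ≠ 0 := Complex.ofReal_ne_zero.2 hq.ne'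
  have hx : (1 + (q : ℂ) ^ 2) • gen q s .A - (1 - (s : ℂ) ^ 2) • 1 = - x₀ q s := by
    rw [x₀_eq, neg_neg]
  have hK := uqRep_K_mul_repV (s := s) (hq := hq) (hq1 := hq1) (hn := hn)
  have h := uqRep_F_mul_repV (hq := hq) (hq1 := hq1) (hn := hn) (gen q s g.adj)
  unfold IsTwisted
  rw [actKinv_gen, actE_gen, hK] at h
  rw [actF_gen, actKinv_gen]
  cases g
  · simp only [Gen.adj, valE, valF, ← neg_smul, star_smul, star_gen, actK_gen, map_smul,
      smul_mul_assoc] at h ⊢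
    rw [h, Complex.star_def, map_neg, map_inv₀, Complex.conj_ofReal, ← hr2]
    generalize repV n s hq hq1 hn (gen q s .Bs) * _ = P
    match_scalars
    · ring
    · field_simp
  · simp only [Gen.adj, valE, valF, hx, smul_neg, neg_neg, ← neg_smul, star_smul, star_gen,
      star_x₀, actK_x₀, map_smul, smul_mul_assoc, mul_smul_comm] at h ⊢
    rw [Complex.star_def, Complex.conj_ofReal, map_neg, Complex.conj_ofReal] at h
    rw [← inv_smul_smul₀ hq' ((uqRep hq hq1 n).F * _), h, ← hr2]
    generalize repV n s hq hq1 hn (x₀ q s) * _ = P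
    match_scalars <;> field_simp
  · simp only [Gen.adj, valE, valF, star_smul, star_gen, star_zero, map_zero, zero_mul, sub_zero,
      zero_add, map_smul, smul_mul_assoc, mul_smul_comm] at h ⊢
    rw [Complex.star_def, map_inv₀, Complex.conj_ofReal] at h
    rw [← h, smul_inv_smul₀ hq']

lemma isTwisted_F (a : Alg q s) : IsTwisted (repV n s hq hq1 hn) hq (uqRep hq hq1 n).F
    (uqRep hq hq1 n).K (actF s hq) a :=
  isTwisted_of_gen (actF_one s hq) (actF_mul hq) isTwisted_F_gen a

/-! ### The flip and the grading on the span of the basis vectors -/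

lemma dense_ketSpan (n : ℤ) : Dense (ketSpan n : Set (Hilb n)) := by
  have h := (stdBasis (ℤˣ × Idx n)).dense_span
  rw [← Submodule.dense_iff_topologicalClosure_eq_top] at h
  refine h.mono (Submodule.span_mono ?_)
  rintro - ⟨i, rfl⟩
  exact ⟨(i.1, i.2.1.1, i.2.1.2), by rw [stdBasis_apply, bv_eq_ket]⟩

lemma flip_mem (v : Hilb n) (hv : v ∈ ketSpan n) : flip n v ∈ ketSpan n :=
  map_mem_ketSpan (fun ε L M _ => flip_ket n ε L M ▸ (ketS n (-ε) L M).2) hv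

lemma grading_mem (v : Hilb n) (hv : v ∈ ketSpan n) : grading n v ∈ ketSpan n :=
  map_mem_ketSpan (fun ε L M _ => grading_ket n ε L M ▸ Submodule.smul_mem _ _ (ketS n ε L M).2) hv

/-- Operators on the span that are multiples of a shift of the labels `m`, with coefficients
that do not depend on the sign, commute with the flip and with the grading. -/
lemma ketMap_comm_flip_grading {c : ℤ → ℤ → ℝ} {a : ℤ}
    (h : ∀ ε L M, ketMap n c a (ketS n ε L M) = (c L M : ℂ) • ketS n ε L (M + a)) (v : ketSpan n) :
    (ketMap n c a ⟨flip n v, flip_mem (n := n) v v.2⟩ : Hilb n) = flip n (ketMap n c a v) ∧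
    (ketMap n c a ⟨grading n v, grading_mem (n := n) v v.2⟩ : Hilb n) = grading n (ketMap n c a v) := by
  let f : ketSpan n →ₗ[ℂ] ketSpan n :=
    ((flip n : Hilb n →L[ℂ] Hilb n) : Hilb n →ₗ[ℂ] Hilb n).restrict flip_mem
  let g : ketSpan n →ₗ[ℂ] ketSpan n :=
    ((grading n : Hilb n →L[ℂ] Hilb n) : Hilb n →ₗ[ℂ] Hilb n).restrict grading_mem
  have hf : ∀ ε L M, f (ketS n ε L M) = ketS n (-ε) L M := fun ε L M =>
    Subtype.ext (flip_ket n ε L M)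
  have hg : ∀ ε L M, g (ketS n ε L M) = (-((ε : ℤ) : ℂ)) • ketS n ε L M := fun ε L M =>
    Subtype.ext (grading_ket n ε L M)
  have hfc : ketMap n c a ∘ₗ f = f ∘ₗ ketMap n c a := ketSpan_hom_ext fun ε L M _ => by
    rw [LinearMap.comp_apply, LinearMap.comp_apply, hf, h, h, map_smul, hf]
  have hgc : ketMap n c a ∘ₗ g = g ∘ₗ ketMap n c a := ketSpan_hom_ext fun ε L M _ => by
    rw [LinearMap.comp_apply, LinearMap.comp_apply, hg, map_smul, h, map_smul, hg, smul_comm]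
  exact ⟨congrArg Subtype.val (LinearMap.congr_fun hfc v),
    congrArg Subtype.val (LinearMap.congr_fun hgc v)⟩

lemma coe_of_mul_repV {S T : Module.End ℂ (ketSpan n)} {a b : Alg q s}
    (h : S * repV n s hq hq1 hn a = repV n s hq hq1 hn b * T) (v : ketSpan n) :
    (S ⟨rep n s hq hq1 hn a v, rep_mem n s hq hq1 hn a v v.2⟩ : Hilb n) =
      rep n s hq hq1 hn b (T v) := by
  have h' : S (repV n s hq hq1 hn a v) = repV n s hq hq1 hn b (T v) := LinearMap.congr_fun h v
  exact congrArg Subtype.val h'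

lemma IsTwisted.coe {S K : Module.End ℂ (ketSpan n)} {t : Alg q s →ₗ[ℂ] Alg q s} {a : Alg q s}
    (h : IsTwisted (repV n s hq hq1 hn) hq S K t a) (v : ketSpan n) :
    (S ⟨rep n s hq hq1 hn a v, rep_mem n s hq hq1 hn a v v.2⟩ : Hilb n) =
      rep n s hq hq1 hn (t a) (K v) + rep n s hq hq1 hn (actKinv s hq a) (S v) := by
  have h' : S (repV n s hq hq1 hn a v) = repV n s hq hq1 hn (t a) (K v) +
    repV n s hq hq1 hn (actKinv s hq a) (S v) := LinearMap.congr_fun h v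
  exact congrArg Subtype.val h'

variable (n s hq hq1 hn) in
lemma isEquivariant_rep : IsEquivariant hq (rep n s hq hq1 hn) (flip n) (grading n)
    (uqRep hq hq1 n) := by
  have hK := ketMap_comm_flip_grading (n := n) (c := cK q) (a := 0) fun ε L M => by
    rw [ketMap_cK, add_zero]
  have hKi := ketMap_comm_flip_grading (n := n) (c := cKinv q) (a := 0) fun ε L M => by
    rw [ketMap_cKinv, add_zero]
  have hE := ketMap_comm_flip_grading (n := n) (c := cE q) (a := 2) ketMap_cE
  have hF := ketMap_comm_flip_grading (n := n) (c := cF q) (a := -2) ketMap_cF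
  exact {
    dense := dense_ketSpan n
    π_mem := rep_mem n s hq hq1 hn
    F_mem := flip_mem
    γ_mem := grading_mem
    cross_K := fun a v => coe_of_mul_repV (uqRep_K_mul_repV a) v
    cross_Kinv := fun a v => coe_of_mul_repV (uqRep_Kinv_mul_repV a) v
    cross_E := fun a v => (isTwisted_E a).coe v
    cross_F := fun a v => (isTwisted_F a).coe v
    F_comm := fun v => ⟨(hK v).1, (hKi v).1, (hE v).1, (hF v).1⟩
    γ_comm := fun v => ⟨(hK v).2, (hKi v).2, (hE v).2, (hF v).2⟩
    γ_π := grading_comm_rep s hq hq1 hn }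

end Crossed

end Podles

end

theorem mainTheorem1 (q s : ℝ) (hq₀ : 0 < q) (hq₁ : q < 1) (hs₀ : 0 ≤ s) (hs₁ : s ≤ 1)
    (n : ℤ) (hn : n ≠ 0) :
    (Podles.idem q s * Podles.idem q s = Podles.idem q s ∧
      Podles.IsInvariant hq₀ (Podles.idem q s)) ∧
    ∃ π : Podles.Alg q s →⋆ₐ[ℂ] (Podles.Hilb n →L[ℂ] Podles.Hilb n),
      Podles.IsPodlesRep n π ∧
      (∀ π' : Podles.Alg q s →⋆ₐ[ℂ] (Podles.Hilb n →L[ℂ] Podles.Hilb n),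
        Podles.IsPodlesRep n π' → π' = π) ∧
      NCG.IsEvenFredholmModule π (Podles.flip n) (Podles.grading n) ∧
      (∃ R : Podles.UqRep q (Podles.ketSpan n), Podles.IsSpinRep n R ∧
        Podles.IsEquivariant hq₀ π (Podles.flip n) (Podles.grading n) R) ∧
      NCG.IsOneSummable π (Podles.flip n) ∧
      (NCG.FPlus π (Podles.flip n) (Podles.grading n) (Podles.idem q s)).IsFredholm ∧
      NCG.pairing π (Podles.flip n) (Podles.grading n) (Podles.idem q s) = n ∧
      NCG.IsNontrivial π (Podles.flip n) (Podles.grading n) := by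
  obtain ⟨hF, hI⟩ := Podles.isFredholm_and_pairing s hq₀ hq₁ hn
  have he := Podles.idem_mul_idem hq₀ s
  have hπ := Podles.isPodlesRep_rep n s hq₀ hq₁ hn
  exact ⟨⟨he, Podles.idem_isInvariant hq₀ s⟩, Podles.rep n s hq₀ hq₁ hn, hπ,
    fun _ h' => Podles.isPodlesRep_unique hπ h', Podles.isEvenFredholmModule_rep s hq₀ hq₁ hn,
    ⟨Podles.uqRep hq₀ hq₁ n, Podles.isSpinRep_uqRep hq₀ hq₁ n,
      Podles.isEquivariant_rep n s hq₀ hq₁ hn⟩,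
    -- The invariant idempotent itself, of size `2`, witnesses non-triviality: its index is `n ≠ 0`.
    Podles.isOneSummable_rep s hq₀ hq₁ hn, hF, hI, 2, Podles.idem q s, he, hF, by rwa [hI]⟩
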